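/- Let $\delta>0$, let $\beta\in C^1([0,\delta])$ be real-valued with $\beta'(\eta)>0$ for $\eta\in(0,\delta)$, put $h=e^{-\beta}$, and let $G_0=\{(\xi,\eta):\xi\in\mathbb R,\ 0<\eta<\delta\}$ be the straight strip. Let $L_2(G_0;h)$ be the space of complex functions that are square-integrable on $G_0$ with weight $h(\eta)$. For $\omega\in\mathbb R$ let $$\mathcal A_0(\omega)=\omega\mathcal L_0-\mathcal M_0,\qquad \mathcal L_0\Phi=-\Phi_{\xi\xi}-\Phi_{\eta\eta}+\beta'(\eta)\Phi_\eta,\qquad \mathcal M_0\Phi=-i\beta'(\eta)\Phi_\xi,$$ acting into $L_2(G_0;h)$ from the domain, with its $H^2$-topology, $$\operatorname{Dom}(\mathcal A_0)=\{\Phi\in H^2(G_0):\ \Phi|_{\eta=0}=0,\ \Phi_\eta|_{\eta=\delta}=0\}.$$ The essential spectrum $\operatorname{spec}_{\mathrm{ess}}(\mathcal A_0)$ is the set of $\omega\in\mathbb R$ for which $\mathcal A_0(\omega)$ is not Fredholm. Let $\widetilde H^1_0((0,\delta),0,h)$ be the closure, in the norm $\left(\int_0^\delta(|\phi|^2+|\phi'|^2)e^{-\beta}\,d\eta\right)^{1/2}$,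 of the functions $\phi\in C^\infty((0,\delta))$ of finite norm that vanish near $0$. Then the supremum $$\Omega_*=\sup_{0\neq\phi\in\widetilde H^1_0((0,\delta),0,h)}\frac{\frac12\int_0^\delta\beta'(\eta)e^{-\beta(\eta)}|\phi(\eta)|^2\,d\eta}{\sqrt{\int_0^\delta e^{-\beta(\eta)}|\phi'(\eta)|^2\,d\eta\cdot\int_0^\delta e^{-\beta(\eta)}|\phi(\eta)|^2\,d\eta}}$$ is finite, $\Omega_*>0$, and $$\operatorname{spec}_{\mathrm{ess}}(\mathcal A_0)=[-\Omega_*,\Omega_*].$$ -/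

import Mathlib

open MeasureTheory Set
open scoped ENNReal

namespace ShelfWaves

noncomputable section

/-- The straight strip `G₀ = ℝ × (0, δ)`, with points `(ξ, η)`. -/
def strip (δ : ℝ) : Set (ℝ × ℝ) := {z | 0 < z.2 ∧ z.2 < δ}

/-- The weighted measure `e^{-β(η)} dξ dη` on the strip. -/
def stripMeasure (β : ℝ → ℝ) (δ : ℝ) : Measure (ℝ × ℝ) :=
  (volume.restrict (strip δ)).withDensity fun z => ENNReal.ofReal (Real.exp (-β z.2))

/-- The complex Hilbert space `L₂(G₀; h)` with weight `h = e^{-β}`. -/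
abbrev L2h (β : ℝ → ℝ) (δ : ℝ) : Type := Lp ℂ 2 (stripMeasure β δ)

/-- Integration by parts over the strip in the direction `v`, with no boundary term:
`∫_G f ∂ᵥψ = - ∫_G g ψ` for all test functions `ψ ∈ C_c^∞(ℝ²)` with support contained in `V`. -/
def ByParts (δ : ℝ) (V : Set (ℝ × ℝ)) (v : ℝ × ℝ) (f g : ℝ × ℝ → ℂ) : Prop :=
  ∀ ψ : ℝ × ℝ → ℝ, ContDiff ℝ (⊤ : ℕ∞) ψ → HasCompactSupport ψ → tsupport ψ ⊆ V →
    ∫ z in strip δ, (fderiv ℝ ψ z v) • f z = -∫ z in strip δ, ψ z • g z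

/-- `g` is the weak derivative of `f` in the strip, in the direction `v`. -/
def HasWeakPartial (δ : ℝ) (v : ℝ × ℝ) (f g : ℝ × ℝ → ℂ) : Prop :=
  ByParts δ (strip δ) v f g

/-- For `f` with weak `η`-derivative `fη` in the strip (both in `L₂`): the trace of `f` on the lower
boundary `∂₁G = {η = 0}` is zero. Green's formula for test functions `ψ` that vanish near
`{η ≥ δ}` (but not near `{η = 0}`) reads `∫_G (f ∂ψ/∂η + fη ψ) = -∫_ℝ (tr f)(ξ) ψ(ξ, 0) dξ`,
and the condition says that the boundary term is zero for all such `ψ`. -/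
def ZeroTraceLower (δ : ℝ) (f fη : ℝ × ℝ → ℂ) : Prop :=
  ByParts δ {z | z.2 < δ} (0, 1) f fη

/-- For `f` with weak `η`-derivative `fη` in the strip (both in `L₂`): the trace of `f` on the upper
boundary `∂₂G = {η = δ}` is zero, in the same sense, with test functions that vanish near
`{η ≤ 0}`. -/
def ZeroTraceUpper (δ : ℝ) (f fη : ℝ × ℝ → ℂ) : Prop :=
  ByParts δ {z | 0 < z.2} (0, 1) f fη

/-! ### Facts about the weighted space that the definitions below need -/

lemma measurableSet_strip (δ : ℝ) : MeasurableSet (strip δ) :=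
  (measurableSet_lt measurable_const measurable_snd).inter
    (measurableSet_lt measurable_snd measurable_const)

lemma isOpen_strip (δ : ℝ) : IsOpen (strip δ) :=
  (isOpen_lt continuous_const continuous_snd).inter (isOpen_lt continuous_snd continuous_const)

lemma stripMeasure_ac (β : ℝ → ℝ) (δ : ℝ) : stripMeasure β δ ≪ volume.restrict (strip δ) :=
  withDensity_absolutelyContinuous _ _

lemma ae_stripMeasure_mem (β : ℝ → ℝ) (δ : ℝ) : ∀ᵐ z ∂(stripMeasure β δ), z ∈ strip δ :=
  (stripMeasure_ac β δ).ae_le (ae_restrict_mem (measurableSet_strip δ))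

lemma volume_le_stripMeasure {β : ℝ → ℝ} {δ : ℝ} (hβ : ContinuousOn β (Icc 0 δ)) :
    ∃ c : ℝ≥0∞, c ≠ ∞ ∧ volume.restrict (strip δ) ≤ c • stripMeasure β δ := by
  obtain ⟨C, hC⟩ := isCompact_Icc.exists_bound_of_continuousOn hβ
  have hle : (volume.restrict (strip δ)).withDensity
      (fun _ => ENNReal.ofReal (Real.exp (-C))) ≤ stripMeasure β δ := by
    refine withDensity_mono ?_
    filter_upwards [ae_restrict_mem (measurableSet_strip δ)] with z hz
    refine ENNReal.ofReal_le_ofReal (Real.exp_le_exp.2 (neg_le_neg ?_))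
    exact (le_abs_self _).trans (hC z.2 ⟨hz.1.le, hz.2.le⟩)
  rw [withDensity_const] at hle
  refine ⟨(ENNReal.ofReal (Real.exp (-C)))⁻¹, ?_, ?_⟩
  · simp [Real.exp_pos]
  · intro s
    have h := hle s
    simp only [Measure.smul_apply, smul_eq_mul] at h ⊢
    calc volume.restrict (strip δ) s
        = (ENNReal.ofReal (Real.exp (-C)))⁻¹ *
            (ENNReal.ofReal (Real.exp (-C)) * volume.restrict (strip δ) s) := by
          rw [← mul_assoc, ENNReal.inv_mul_cancel (by simp [Real.exp_pos]) (by simp), one_mul]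
      _ ≤ _ := by gcongr

lemma volume_ac_stripMeasure {β : ℝ → ℝ} {δ : ℝ} (hβ : ContinuousOn β (Icc 0 δ)) :
    volume.restrict (strip δ) ≪ stripMeasure β δ := by
  obtain ⟨c, -, hle⟩ := volume_le_stripMeasure hβ
  exact Measure.absolutelyContinuous_of_le_smul hle

lemma memLp_volume {β : ℝ → ℝ} {δ : ℝ} (hβ : ContinuousOn β (Icc 0 δ)) (f : L2h β δ) :
    MemLp f 2 (volume.restrict (strip δ)) := by
  obtain ⟨c, hc, hle⟩ := volume_le_stripMeasure hβ
  exact (Lp.memLp f).of_measure_le_smul hc hle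

lemma integrable_test_smul {β : ℝ → ℝ} {δ : ℝ} (hβ : ContinuousOn β (Icc 0 δ)) (f : L2h β δ)
    {ψ : ℝ × ℝ → ℝ} (hψ : Continuous ψ) (hc : HasCompactSupport ψ) :
    Integrable (fun z => ψ z • f z) (volume.restrict (strip δ)) :=
  ((memLp_volume hβ f).locallyIntegrable (by norm_num)).integrable_smul_left_of_hasCompactSupport
    hψ hc

/-- The pairs in `L₂(G; h)²` that satisfy an integration-by-parts relation form a subspace. -/
def byPartsSubmodule {β : ℝ → ℝ} {δ : ℝ} (hβ : ContinuousOn β (Icc 0 δ))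
    (V : Set (ℝ × ℝ)) (v : ℝ × ℝ) : Submodule ℂ (L2h β δ × L2h β δ) where
  carrier := {p | ByParts δ V v p.1 p.2}
  zero_mem' := by
    intro ψ _ _ _
    have h0 : ((0 : L2h β δ) : ℝ × ℝ → ℂ) =ᵐ[volume.restrict (strip δ)] 0 :=
      (volume_ac_stripMeasure hβ).ae_le (Lp.coeFn_zero ..)
    have e : ∀ u : ℝ × ℝ → ℝ, ∫ z in strip δ, u z • ((0 : L2h β δ) : ℝ × ℝ → ℂ) z = 0 := by
      intro u
      rw [integral_congr_ae (g := fun _ => (0 : ℂ)), integral_zero]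
      filter_upwards [h0] with z hz
      rw [hz, Pi.zero_apply, smul_zero]
    simp only [Prod.fst_zero, Prod.snd_zero]
    rw [e, e, neg_zero]
  add_mem' := by
    rintro ⟨f, g⟩ ⟨f', g'⟩ h h' ψ hψ hc hV
    have hd : Continuous fun z => fderiv ℝ ψ z v :=
      (hψ.continuous_fderiv (by simp)).clm_apply continuous_const
    have hdc : HasCompactSupport fun z => fderiv ℝ ψ z v := hc.fderiv_apply (𝕜 := ℝ) v
    have e1 : ∫ z in strip δ, (fderiv ℝ ψ z v) • (f + f' : L2h β δ) z
        = (∫ z in strip δ, (fderiv ℝ ψ z v) • f z) + ∫ z in strip δ, (fderiv ℝ ψ z v) • f' z := by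
      rw [← integral_add (integrable_test_smul hβ f hd hdc) (integrable_test_smul hβ f' hd hdc)]
      refine integral_congr_ae ?_
      filter_upwards [(volume_ac_stripMeasure hβ).ae_le (Lp.coeFn_add f f')] with z hz
      simp only [hz, Pi.add_apply, smul_add]
    have e2 : ∫ z in strip δ, ψ z • (g + g' : L2h β δ) z
        = (∫ z in strip δ, ψ z • g z) + ∫ z in strip δ, ψ z • g' z := by
      rw [← integral_add (integrable_test_smul hβ g hψ.continuous hc)
        (integrable_test_smul hβ g' hψ.continuous hc)]
      refine integral_congr_ae ?_
      filter_upwards [(volume_ac_stripMeasure hβ).ae_le (Lp.coeFn_add g g')] with z hz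
      simp only [hz, Pi.add_apply, smul_add]
    have a := h ψ hψ hc hV
    have b := h' ψ hψ hc hV
    simp only [Prod.mk_add_mk] at a b ⊢
    rw [e1, e2, a, b, neg_add]
  smul_mem' := by
    rintro c ⟨f, g⟩ h ψ hψ hc hV
    have e1 : ∫ z in strip δ, (fderiv ℝ ψ z v) • (c • f : L2h β δ) z
        = c • ∫ z in strip δ, (fderiv ℝ ψ z v) • f z := by
      rw [← integral_smul]
      refine integral_congr_ae ?_
      filter_upwards [(volume_ac_stripMeasure hβ).ae_le (Lp.coeFn_smul c f)] with z hz
      simp only [hz, Pi.smul_apply, smul_comm c]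
    have e2 : ∫ z in strip δ, ψ z • (c • g : L2h β δ) z = c • ∫ z in strip δ, ψ z • g z := by
      rw [← integral_smul]
      refine integral_congr_ae ?_
      filter_upwards [(volume_ac_stripMeasure hβ).ae_le (Lp.coeFn_smul c g)] with z hz
      simp only [hz, Pi.smul_apply, smul_comm c]
    have a := h ψ hψ hc hV
    simp only [Prod.smul_mk] at a ⊢
    rw [e1, e2, a, smul_neg]

lemma memLp_deriv {β : ℝ → ℝ} {δ : ℝ} (hδ : 0 < δ) (hβ : ContDiffOn ℝ 1 β (Icc 0 δ)) :
    MemLp (fun z : ℝ × ℝ => ((deriv β z.2 : ℝ) : ℂ)) ∞ (stripMeasure β δ) := by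
  obtain ⟨C, hC⟩ := isCompact_Icc.exists_bound_of_continuousOn
    (hβ.continuousOn_derivWithin (uniqueDiffOn_Icc hδ) le_rfl)
  refine memLp_top_of_bound (C := C) ?_ ?_
  · exact (Complex.measurable_ofReal.comp
      ((measurable_deriv β).comp measurable_snd)).aestronglyMeasurable
  · filter_upwards [ae_stripMeasure_mem β δ] with z hz
    have h := hC z.2 ⟨hz.1.le, hz.2.le⟩
    rw [derivWithin_of_mem_nhds (Icc_mem_nhds hz.1 hz.2)] at h
    simpa using h

/-! ### The pencil -/

/-- The domain of the pencil: the functions in the Sobolev space `H²(G₀)` with `Φ = 0` on the lower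
boundary and `∂Φ/∂η = 0` on the upper boundary, with its `H²` topology. A function `Φ ∈ H²` is
recorded with its weak derivatives as the tuple `J = (Φ, Φ_ξ, Φ_η, Φ_ξξ, Φ_ξη, Φ_ηη)` of elements
of `L₂(G₀; h)` (the weak derivatives are determined by `Φ`, so this is a copy of `H²`); since `β` is bounded on `[0, δ]`, the weight does not change the space. -/
def domain {β : ℝ → ℝ} {δ : ℝ} (hβ : ContDiffOn ℝ 1 β (Icc 0 δ)) :
    Submodule ℂ (Fin 6 → L2h β δ) where
  carrier := {J |
    HasWeakPartial δ (1, 0) (J 0) (J 1) ∧ HasWeakPartial δ (0, 1) (J 0) (J 2) ∧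
    HasWeakPartial δ (1, 0) (J 1) (J 3) ∧ HasWeakPartial δ (0, 1) (J 1) (J 4) ∧
    HasWeakPartial δ (0, 1) (J 2) (J 5) ∧
    ZeroTraceLower δ (J 0) (J 2) ∧ ZeroTraceUpper δ (J 2) (J 5)}
  zero_mem' :=
    have z : ∀ V v, ByParts δ V v (0 : L2h β δ) (0 : L2h β δ) := fun V v =>
      (byPartsSubmodule hβ.continuousOn V v).zero_mem
    ⟨z _ _, z _ _, z _ _, z _ _, z _ _, z _ _, z _ _⟩
  add_mem' := by
    have a : ∀ V v (f g f' g' : L2h β δ), ByParts δ V v f g → ByParts δ V v f' g' →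
        ByParts δ V v (f + f' : L2h β δ) (g + g' : L2h β δ) := fun V v f g f' g' h h' =>
      (byPartsSubmodule hβ.continuousOn V v).add_mem (x := (f, g)) (y := (f', g')) h h'
    rintro J K ⟨h1, h2, h3, h4, h5, h6, h7⟩ ⟨k1, k2, k3, k4, k5, k6, k7⟩
    exact ⟨a _ _ _ _ _ _ h1 k1, a _ _ _ _ _ _ h2 k2, a _ _ _ _ _ _ h3 k3, a _ _ _ _ _ _ h4 k4,
      a _ _ _ _ _ _ h5 k5, a _ _ _ _ _ _ h6 k6, a _ _ _ _ _ _ h7 k7⟩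
  smul_mem' := by
    have a : ∀ (c : ℂ) V v (f g : L2h β δ), ByParts δ V v f g →
        ByParts δ V v (c • f : L2h β δ) (c • g : L2h β δ) := fun c V v f g h =>
      (byPartsSubmodule hβ.continuousOn V v).smul_mem (x := (f, g)) c h
    rintro c J ⟨h1, h2, h3, h4, h5, h6, h7⟩
    exact ⟨a _ _ _ _ _ h1, a _ _ _ _ _ h2, a _ _ _ _ _ h3, a _ _ _ _ _ h4,
      a _ _ _ _ _ h5, a _ _ _ _ _ h6, a _ _ _ _ _ h7⟩

/-- The `i`-th entry of the tuple `(Φ, Φ_ξ, Φ_η, Φ_ξξ, Φ_ξη, Φ_ηη)`. -/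
def entry {β : ℝ → ℝ} {δ : ℝ} (hβ : ContDiffOn ℝ 1 β (Icc 0 δ)) (i : Fin 6) :
    domain hβ →L[ℂ] L2h β δ :=
  (ContinuousLinearMap.proj i).comp (domain hβ).subtypeL

/-- Multiplication by the bounded function `β'(η)` on `L₂(G₀; h)`. -/
def mulDeriv {β : ℝ → ℝ} {δ : ℝ} (hδ : 0 < δ) (hβ : ContDiffOn ℝ 1 β (Icc 0 δ)) :
    L2h β δ →L[ℂ] L2h β δ :=
  (ContinuousLinearMap.mul ℂ ℂ).holderL (stripMeasure β δ) ∞ 2 2 (memLp_deriv hδ hβ).toLp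

lemma mulDeriv_apply {β : ℝ → ℝ} {δ : ℝ} (hδ : 0 < δ) (hβ : ContDiffOn ℝ 1 β (Icc 0 δ))
    (f : L2h β δ) :
    mulDeriv hδ hβ f =ᵐ[stripMeasure β δ] fun z => ((deriv β z.2 : ℝ) : ℂ) * f z := by
  have h := (ContinuousLinearMap.mul ℂ ℂ).coeFn_holder (r := 2) (memLp_deriv hδ hβ).toLp f
  filter_upwards [h, (memLp_deriv hδ hβ).coeFn_toLp] with z h1 h2
  exact h1.trans (by simp [h2])

/-- `𝓛₀ Φ = -Φ_ξξ - Φ_ηη + β' Φ_η`. -/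
def opL {β : ℝ → ℝ} {δ : ℝ} (hδ : 0 < δ) (hβ : ContDiffOn ℝ 1 β (Icc 0 δ)) :
    domain hβ →L[ℂ] L2h β δ :=
  -entry hβ 3 - entry hβ 5 + (mulDeriv hδ hβ).comp (entry hβ 2)

/-- `𝓜₀ Φ = -i β' Φ_ξ`. -/
def opM {β : ℝ → ℝ} {δ : ℝ} (hδ : 0 < δ) (hβ : ContDiffOn ℝ 1 β (Icc 0 δ)) :
    domain hβ →L[ℂ] L2h β δ :=
  (-Complex.I) • (mulDeriv hδ hβ).comp (entry hβ 1)

/-- The operator pencil `𝓐₀(ω) = ω 𝓛₀ - 𝓜₀` of the straight strip. -/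
def pencil {β : ℝ → ℝ} {δ : ℝ} (hδ : 0 < δ) (hβ : ContDiffOn ℝ 1 β (Icc 0 δ)) (ω : ℝ) :
    domain hβ →L[ℂ] L2h β δ :=
  (ω : ℂ) • opL hδ hβ - opM hδ hβ

/-- The essential spectrum of the pencil: the real `ω` for which `𝓐₀(ω)` is not Fredholm. -/
def essSpectrum {β : ℝ → ℝ} {δ : ℝ} (hδ : 0 < δ) (hβ : ContDiffOn ℝ 1 β (Icc 0 δ)) : Set ℝ :=
  {ω | ¬ (pencil hδ hβ ω).IsFredholm}

/-! ### The number `Ω_*` -/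

/-- The weighted measure `e^{-β(η)} dη` on `(0, δ)`. -/
def intervalMeasure (β : ℝ → ℝ) (δ : ℝ) : Measure ℝ :=
  (volume.restrict (Ioo 0 δ)).withDensity fun η => ENNReal.ofReal (Real.exp (-β η))

/-- `φ` belongs to `H̃¹₀((0, δ), 0, h)` and `φ'` is its (weak) derivative: `(φ, φ')` is a limit in
`L₂((0, δ); h)²` of pairs `(χ, χ')` with `χ` smooth on `(0, δ)` and vanishing near `0`. -/
def MemH10 (β : ℝ → ℝ) (δ : ℝ) (φ φ' : ℝ → ℂ) : Prop :=
  MemLp φ 2 (intervalMeasure β δ) ∧ MemLp φ' 2 (intervalMeasure β δ) ∧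
  ∀ ε : ℝ≥0∞, 0 < ε → ∃ χ : ℝ → ℂ,
    ContDiffOn ℝ (⊤ : ℕ∞) χ (Ioo 0 δ) ∧ (0 : ℝ) ∉ closure (Function.support χ ∩ Ioo 0 δ) ∧
    eLpNorm (φ - χ) 2 (intervalMeasure β δ) < ε ∧
    eLpNorm (φ' - deriv χ) 2 (intervalMeasure β δ) < ε

/-- The values of the quotient that defines `Ω_*`, over the nonzero `φ ∈ H̃¹₀((0, δ), 0, h)`. -/
def quotients (β : ℝ → ℝ) (δ : ℝ) : Set ℝ :=
  {r | ∃ φ φ' : ℝ → ℂ, MemH10 β δ φ φ' ∧ ¬ φ =ᵐ[volume.restrict (Ioo 0 δ)] 0 ∧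
    r = ((1 / 2) * ∫ η in Ioo 0 δ, deriv β η * Real.exp (-β η) * ‖φ η‖ ^ 2) /
      √((∫ η in Ioo 0 δ, Real.exp (-β η) * ‖φ' η‖ ^ 2) *
        ∫ η in Ioo 0 δ, Real.exp (-β η) * ‖φ η‖ ^ 2)}

/-- `Ω_*`, the supremum of these quotients. -/
def omegaStar (β : ℝ → ℝ) (δ : ℝ) : ℝ := sSup (quotients β δ)

end

end ShelfWaves

/-! The coefficients do not depend on `ξ`. On `e^{ikξ} φ(η)` the form of the pencil becomes `ω(‖φ'‖²
+ k²‖φ‖²) - k ∫ β' h |φ|²`, with norms in `L₂((0, δ); h)`. For fixed `φ` the bracket is at least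
`2|k| ‖φ'‖ ‖φ‖`, with equality at `|k| = ‖φ'‖ / ‖φ‖`. So for `ω > 0` these forms are coercive when
`ω > Ω_*`, and one of them degenerates when `ω ≤ Ω_*`. Negative `ω` reduce to this by `k ↦ -k`.

Writing `φ = Jg` with the compact integration operator `J` identifies `H̃¹₀` with the range of `J`
(`MemH10.toLp_eq`, `memH10_volterra`). The quotient becomes `⟨Jg, BJg⟩ / (2‖g‖‖Jg‖)`, where `B` is
multiplication by `β'`. It is bounded because `J` and `B` are, and it is positive at `φ = η`.

Inside the interval: for `0 < ω ≤ Ω_*` the bottom `Λ(k)` of the form of `ω + J*(ωk² - kB)J` is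
continuous in `k`, positive at `k = 0`, and nonpositive somewhere. Hence it vanishes at some `k`.
There the operator is nonnegative and equals `ω` minus a compact operator, so it has a kernel
(`exists_quadPencil_eq_zero`). A kernel vector is a classical solution `φ` of the boundary value
problem on the interval (`exists_isMode`). Products of `φ` with ever wider, mutually disjoint wave
packets of wave number `k` form a singular sequence (`IsMode.not_isFredholm`).

Outside the interval: Plancherel in `ξ` and the variational inequality for each wave number give
coercivity of the form on the strip (`exists_coercive`), and the Lax-Milgram lemma yields a weak
solution. It lies in `H²`: translation invariance shows that its `ξ`-derivative is again in the form
domain, and the equation then supplies the second `η`-derivative and the natural boundary condition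
(`pencil_surjective`). Symmetry of the pencil turns surjectivity into bijectivity
(`isFredholm_of_surjective`).

Traces are encoded by integration by parts against test functions only. To integrate by parts
between two Sobolev functions, one is translated along the strip or across it (`inner_shift_sub`),
which avoids trace theorems and density theorems for the domain. -/

namespace ShelfWaves

open Filter Topology
open scoped ComplexConjugate

noncomputable section

/-! ### Translations of the plane -/

/-- The space `L₂(ℝ²)`. -/
abbrev L2plane : Type := Lp ℂ 2 (volume : Measure (ℝ × ℝ))

/-- The translation operator `φ ↦ φ(· + v)` on `L₂(ℝ²)`. -/
def shift (v : ℝ × ℝ) : L2plane →ₗᵢ[ℂ] L2plane :=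
  Lp.compMeasurePreservingₗᵢ ℂ (fun z => z + v) (measurePreserving_add_right volume v)

lemma shift_coeFn (v : ℝ × ℝ) (φ : L2plane) : shift v φ =ᵐ[volume] fun z => φ (z + v) :=
  Lp.coeFn_compMeasurePreserving φ (measurePreserving_add_right volume v)

lemma continuous_shift (φ : L2plane) : Continuous fun v => shift v φ := by
  let G : ℝ × ℝ → C(ℝ × ℝ, ℝ × ℝ) := fun v => ⟨fun z => z + v, by fun_prop⟩
  have hG : Continuous G := by
    refine ContinuousMap.continuous_of_continuous_uncurry _ ?_
    simp only [G, Function.uncurry_def, ContinuousMap.coe_mk]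
    fun_prop
  exact (continuous_const (y := φ)).compMeasurePreservingLp hG
    (fun v => measurePreserving_add_right volume v) (by simp)

lemma shift_shift (v w : ℝ × ℝ) (φ : L2plane) : shift v (shift w φ) = shift (v + w) φ := by
  refine Lp.ext ?_
  have h := (measurePreserving_add_right volume v).quasiMeasurePreserving.ae_eq_comp
    (shift_coeFn w φ)
  filter_upwards [shift_coeFn v (shift w φ), shift_coeFn (v + w) φ, h] with z h1 h2 h3
  rw [h1, h2]
  simpa [Function.comp_def, add_assoc] using h3

lemma shift_zero (φ : L2plane) : shift 0 φ = φ := by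
  refine Lp.ext ?_
  filter_upwards [shift_coeFn 0 φ] with z h1
  simpa using h1

lemma inner_shift_right (v : ℝ × ℝ) (a b : L2plane) :
    inner ℂ a (shift v b) = inner ℂ (shift (-v) a) b := by
  rw [← (shift (-v)).inner_map_map a, shift_shift, neg_add_cancel, shift_zero]

lemma memLp_indicator_strip {δ : ℝ} {f : ℝ × ℝ → ℂ} (hf : MemLp f 2 (volume.restrict (strip δ))) :
    MemLp ((strip δ).indicator f) 2 volume :=
  (memLp_indicator_iff_restrict (measurableSet_strip δ)).2 hf

/-- Extension by zero of a square-integrable function on the strip. -/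
def zext {δ : ℝ} {f : ℝ × ℝ → ℂ} (hf : MemLp f 2 (volume.restrict (strip δ))) : L2plane :=
  (memLp_indicator_strip hf).toLp

lemma zext_coeFn {δ : ℝ} {f : ℝ × ℝ → ℂ} (hf : MemLp f 2 (volume.restrict (strip δ))) :
    zext hf =ᵐ[volume] (strip δ).indicator f := MemLp.coeFn_toLp _

lemma inner_zext {δ : ℝ} {f : ℝ × ℝ → ℂ} (hf : MemLp f 2 (volume.restrict (strip δ)))
    (φ : L2plane) : inner ℂ (zext hf) φ = ∫ z in strip δ, conj (f z) * φ z := by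
  rw [L2.inner_def, ← integral_indicator (measurableSet_strip δ)]
  refine integral_congr_ae ?_
  filter_upwards [zext_coeFn hf] with z hz
  rw [hz]
  by_cases h : z ∈ strip δ
  · simp [h, mul_comm]
  · simp [h]

lemma inner_zext_zext {δ : ℝ} {f g : ℝ × ℝ → ℂ} (hf : MemLp f 2 (volume.restrict (strip δ)))
    (hg : MemLp g 2 (volume.restrict (strip δ))) :
    inner ℂ (zext hf) (zext hg) = ∫ z in strip δ, conj (f z) * g z := by
  rw [inner_zext]
  refine integral_congr_ae ?_
  filter_upwards [ae_restrict_of_ae (zext_coeFn hg), ae_restrict_mem (measurableSet_strip δ)]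
    with z hz hm
  rw [hz, indicator_of_mem hm]

lemma memLp_test {ψ : ℝ × ℝ → ℝ} (hψ : Continuous ψ) (hc : HasCompactSupport ψ)
    (μ : Measure (ℝ × ℝ)) [IsFiniteMeasureOnCompacts μ] :
    MemLp (fun z => (ψ z : ℂ)) 2 μ :=
  (Complex.continuous_ofReal.comp hψ).memLp_of_hasCompactSupport
    (hc.comp_left (g := ((↑) : ℝ → ℂ)) (by simp))

/-- A real test function as an element of `L₂(ℝ²)`. -/
def testLp {ψ : ℝ × ℝ → ℝ} (hψ : Continuous ψ) (hc : HasCompactSupport ψ) : L2plane :=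
  (memLp_test hψ hc volume).toLp

lemma inner_zext_shift_test {δ : ℝ} {f : ℝ × ℝ → ℂ}
    (hf : MemLp f 2 (volume.restrict (strip δ))) {ψ : ℝ × ℝ → ℝ} (hψ : Continuous ψ)
    (hc : HasCompactSupport ψ) (v : ℝ × ℝ) :
    inner ℂ (zext hf) (shift v (testLp hψ hc)) = conj (∫ z in strip δ, ψ (z + v) • f z) := by
  rw [inner_zext, ← integral_conj]
  refine integral_congr_ae (ae_restrict_of_ae ?_)
  have h := (measurePreserving_add_right volume v).quasiMeasurePreserving.ae_eq_comp
    (memLp_test hψ hc volume).coeFn_toLp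
  filter_upwards [shift_coeFn v (testLp hψ hc), h] with z h1 h2
  rw [h1]
  simp only [Function.comp_def] at h2
  rw [testLp, h2]
  simp [mul_comm]

/-- A closed subspace of `L₂(ℝ²)` that contains the test functions of the strip contains all
functions that vanish outside the strip. -/
lemma mem_of_tests_mem {δ : ℝ} {M : Submodule ℂ L2plane} (hM : IsClosed (M : Set L2plane))
    (h : ∀ (ψ : ℝ × ℝ → ℝ) (hψ : ContDiff ℝ (⊤ : ℕ∞) ψ) (hc : HasCompactSupport ψ),
      tsupport ψ ⊆ strip δ → testLp hψ.continuous hc ∈ M)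
    {f : ℝ × ℝ → ℂ} (hf : MemLp f 2 (volume.restrict (strip δ))) : zext hf ∈ M := by
  have : CompleteSpace M := hM.completeSpace_coe
  -- A closed subspace is its own double orthogonal complement, and an element orthogonal to all
  -- test functions of the strip vanishes almost everywhere there.
  rw [← Submodule.orthogonal_orthogonal M, Submodule.mem_orthogonal]
  intro r hr
  have hr0 : ∀ᵐ z ∂volume, z ∈ strip δ → (r : ℝ × ℝ → ℂ) z = 0 := by
    refine (isOpen_strip δ).ae_eq_zero_of_integral_contDiff_smul_eq_zero
      (((Lp.memLp r).locallyIntegrable (by norm_num)).locallyIntegrableOn _) ?_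
    intro ψ hψ hc hs
    have h1 := (Submodule.mem_orthogonal _ _).1 hr _ (h ψ hψ hc hs)
    rw [L2.inner_def] at h1
    rw [← h1]
    refine integral_congr_ae ?_
    filter_upwards [(memLp_test hψ.continuous hc volume).coeFn_toLp] with z hz
    rw [testLp, hz]
    simp [mul_comm]
  rw [← inner_conj_symm, inner_zext, integral_eq_zero_of_ae, map_zero]
  filter_upwards [ae_restrict_of_ae hr0, ae_restrict_mem (measurableSet_strip δ)] with z h1 h2
  simp [h1 h2]

/-- The translation acts on the test function, so the derivative falls on `ψ` and `f` needs no
regularity. The result has the shape to which `ByParts` applies. -/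
lemma hasDerivAt_integral_shift {δ : ℝ} {f : ℝ × ℝ → ℂ}
    (hf : MemLp f 2 (volume.restrict (strip δ))) {ψ : ℝ × ℝ → ℝ}
    (hψ : ContDiff ℝ (⊤ : ℕ∞) ψ) (hc : HasCompactSupport ψ) (v : ℝ × ℝ) (t₀ : ℝ) :
    HasDerivAt (fun t : ℝ => ∫ z in strip δ, ψ (z + t • v) • f z)
      (∫ z in strip δ, (fderiv ℝ ψ (z + t₀ • v) v) • f z) t₀ := by
  have hfd : Continuous fun z => fderiv ℝ ψ z v :=
    (hψ.continuous_fderiv (by simp)).clm_apply continuous_const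
  have hfc : HasCompactSupport fun z => fderiv ℝ ψ z v := hc.fderiv_apply (𝕜 := ℝ) v
  obtain ⟨C, hC⟩ := hfd.bounded_above_of_compact_support hfc
  have hloc : LocallyIntegrable f (volume.restrict (strip δ)) := hf.locallyIntegrable (by norm_num)
  -- all the translates are supported in one compact set
  set K : Set (ℝ × ℝ) :=
    (fun p : (ℝ × ℝ) × ℝ => p.1 - p.2 • v) '' (tsupport ψ ×ˢ Metric.closedBall t₀ 1) with hK
  have hKc : IsCompact K :=
    (hc.isCompact.prod (isCompact_closedBall t₀ 1)).image (by fun_prop)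
  have hKm : ∀ z : ℝ × ℝ, ∀ t ∈ Metric.ball t₀ 1, z + t • v ∈ tsupport ψ → z ∈ K := by
    intro z t ht hz
    exact ⟨(z + t • v, t), ⟨hz, Metric.ball_subset_closedBall ht⟩, by simp⟩
  refine (hasDerivAt_integral_of_dominated_loc_of_deriv_le
    (F := fun t z => ψ (z + t • v) • f z) (F' := fun t z => (fderiv ℝ ψ (z + t • v) v) • f z)
    (bound := K.indicator fun z => C * ‖f z‖) (Metric.ball_mem_nhds t₀ one_pos) ?_ ?_ ?_ ?_ ?_ ?_).2
  · refine Eventually.of_forall fun t => ?_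
    exact (by have := hψ.continuous; fun_prop : Continuous fun z : ℝ × ℝ => ψ (z + t • v)).aestronglyMeasurable.smul
      hf.aestronglyMeasurable
  · refine LocallyIntegrable.integrable_smul_left_of_hasCompactSupport hloc
      (by have := hψ.continuous; fun_prop : Continuous fun z : ℝ × ℝ => ψ (z + t₀ • v)) ?_
    exact hc.comp_homeomorph (Homeomorph.addRight (t₀ • v))
  · exact (hfd.comp (by fun_prop : Continuous fun z : ℝ × ℝ => z + t₀ • v)).aestronglyMeasurable.smul
      hf.aestronglyMeasurable
  · filter_upwards with z t ht
    by_cases hz : z ∈ K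
    · rw [indicator_of_mem hz, norm_smul]
      gcongr
      exact hC _
    · rw [indicator_of_notMem hz]
      have : z + t • v ∉ tsupport ψ := fun h => hz (hKm z t ht h)
      rw [image_eq_zero_of_notMem_tsupport (f := fun z => fderiv ℝ ψ z v)]
      · simp
      · exact fun h => this (tsupport_fderiv_apply_subset ℝ v h)
  · exact (integrable_indicator_iff hKc.measurableSet).2
      ((hloc.integrableOn_isCompact hKc).norm.const_mul C)
  · filter_upwards with z t ht
    have h1 : HasDerivAt (fun t : ℝ => z + t • v) v t := by
      simpa using ((hasDerivAt_id t).smul_const v).const_add z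
    have h2 := ((hψ.differentiable (by simp)) (z + t • v)).hasFDerivAt.comp_hasDerivAt t h1
    exact h2.smul_const (f z)

/-- Integration of a weak derivative along translates. -/
theorem inner_shift_sub {δ : ℝ} {U : Set (ℝ × ℝ)} {v : ℝ × ℝ} {f g : ℝ × ℝ → ℂ}
    (hf : MemLp f 2 (volume.restrict (strip δ))) (hg : MemLp g 2 (volume.restrict (strip δ)))
    (h : ByParts δ U v f g) {T : ℝ} (hT : 0 ≤ T)
    (hU : ∀ s ∈ Icc 0 T, ∀ z ∈ strip δ, z - s • v ∈ U)
    {φ : ℝ × ℝ → ℂ} (hφ : MemLp φ 2 (volume.restrict (strip δ))) :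
    inner ℂ (zext hf) (shift (T • v) (zext hφ)) - inner ℂ (zext hf) (zext hφ)
      = -∫ s in (0 : ℝ)..T, inner ℂ (zext hg) (shift (s • v) (zext hφ)) := by
  have hcont : ∀ φ : L2plane, Continuous fun s : ℝ => inner ℂ (zext hg) (shift (s • v) φ) :=
    fun φ => continuous_const.inner ((continuous_shift φ).comp (by fun_prop))
  -- The difference of the two sides is a bounded linear functional of `φ`. Its kernel is therefore
  -- closed, and it suffices to treat test functions.
  let Λ : L2plane →ₗ[ℂ] ℂ :=
    { toFun := fun φ => inner ℂ (zext hf) (shift (T • v) φ) - inner ℂ (zext hf) φ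
        + ∫ s in (0 : ℝ)..T, inner ℂ (zext hg) (shift (s • v) φ)
      map_add' := fun a b => by
        simp only [map_add, inner_add_right]
        rw [intervalIntegral.integral_add ((hcont a).intervalIntegrable _ _)
          ((hcont b).intervalIntegrable _ _)]
        ring
      map_smul' := fun c a => by
        simp only [map_smul, inner_smul_right, RingHom.id_apply, smul_eq_mul]
        rw [intervalIntegral.integral_const_mul]
        ring }
  have hΛ : ∀ φ, ‖Λ φ‖ ≤ (‖zext hf‖ + ‖zext hf‖ + ‖zext hg‖ * |T - 0|) * ‖φ‖ := by
    intro φ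
    have b1 : ‖∫ s in (0 : ℝ)..T, inner ℂ (zext hg) (shift (s • v) φ)‖
        ≤ (‖zext hg‖ * ‖φ‖) * |T - 0| := by
      refine intervalIntegral.norm_integral_le_of_norm_le_const fun s _ => ?_
      simpa using norm_inner_le_norm (𝕜 := ℂ) (zext hg) (shift (s • v) φ)
    have b2 := norm_inner_le_norm (𝕜 := ℂ) (zext hf) (shift (T • v) φ)
    have b3 := norm_inner_le_norm (𝕜 := ℂ) (zext hf) φ
    rw [(shift (T • v)).norm_map] at b2
    refine (norm_add_le _ _).trans ((add_le_add_left (norm_sub_le _ _) _).trans ?_)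
    linarith
  let Λ' := Λ.mkContinuous _ hΛ
  have hker : zext hφ ∈ LinearMap.ker Λ := by
    refine mem_of_tests_mem (δ := δ) (M := LinearMap.ker Λ) ?_ ?_ hφ
    · exact Λ'.isClosed_ker
    · intro ψ hψ hc hs
      rw [LinearMap.mem_ker]
      change inner ℂ (zext hf) (shift (T • v) (testLp hψ.continuous hc))
        - inner ℂ (zext hf) (testLp hψ.continuous hc)
        + ∫ s in (0 : ℝ)..T, inner ℂ (zext hg) (shift (s • v) (testLp hψ.continuous hc)) = 0
      -- By `hU` the translated test function is still supported in `U`, so `ByParts` converts the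
      -- derivative of the pairing with `f` into a pairing with `g`.
      have hder : ∀ t ∈ uIcc 0 T, HasDerivAt
          (fun t : ℝ => inner ℂ (zext hf) (shift (t • v) (testLp hψ.continuous hc)))
          (-inner ℂ (zext hg) (shift (t • v) (testLp hψ.continuous hc))) t := by
        intro t ht
        rw [uIcc_of_le hT] at ht
        simp only [inner_zext_shift_test]
        have h1 := hasDerivAt_integral_shift hf hψ hc v t
        have h2 : ∫ z in strip δ, (fderiv ℝ ψ (z + t • v) v) • f z
            = -∫ z in strip δ, ψ (z + t • v) • g z := by
          have h3 := h (fun z => ψ (z + t • v)) (by fun_prop)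
            (hc.comp_homeomorph (Homeomorph.addRight (t • v))) ?_
          · simpa only [fderiv_comp_add_right] using h3
          · intro z hz
            have : z + t • v ∈ tsupport ψ :=
              tsupport_comp_subset_preimage ψ (f := fun z => z + t • v) (by fun_prop) hz
            simpa using hU t ht _ (hs this)
        rw [h2] at h1
        have h4 := (Complex.conjCLE : ℂ →L[ℝ] ℂ).hasFDerivAt.comp_hasDerivAt t h1
        simpa [Function.comp_def] using h4
      have := intervalIntegral.integral_eq_sub_of_hasDerivAt hder
        ((hcont _).neg.intervalIntegrable _ _)
      rw [intervalIntegral.integral_neg, zero_smul, shift_zero] at this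
      rw [← this]
      ring
  have := LinearMap.mem_ker.1 hker
  exact eq_neg_of_add_eq_zero_left this

/-! ### Integration by parts for pairs of weakly differentiable functions -/

/-- Reversing the direction lets `inner_shift_sub` be used with the translation moved to the other
factor. -/
lemma ByParts.neg_right {δ : ℝ} {U : Set (ℝ × ℝ)} {v : ℝ × ℝ} {f g : ℝ × ℝ → ℂ}
    (h : ByParts δ U v f g) : ByParts δ U (-v) f (-g) := by
  intro ψ hψ hc hs
  have := h ψ hψ hc hs
  simp only [map_neg, neg_smul, Pi.neg_apply, smul_neg, integral_neg, this]

lemma ByParts.congr {δ : ℝ} {U : Set (ℝ × ℝ)} {v : ℝ × ℝ} {f g f' g' : ℝ × ℝ → ℂ}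
    (h : ByParts δ U v f g) (hf : f =ᵐ[volume.restrict (strip δ)] f')
    (hg : g =ᵐ[volume.restrict (strip δ)] g') : ByParts δ U v f' g' := by
  intro ψ hψ hc hs
  have e1 : ∫ z in strip δ, (fderiv ℝ ψ z v) • f z = ∫ z in strip δ, (fderiv ℝ ψ z v) • f' z :=
    integral_congr_ae (by filter_upwards [hf] with z hz; rw [hz])
  have e2 : ∫ z in strip δ, ψ z • g z = ∫ z in strip δ, ψ z • g' z :=
    integral_congr_ae (by filter_upwards [hg] with z hz; rw [hz])
  rw [← e1, ← e2]
  exact h ψ hψ hc hs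

lemma ByParts.mono {δ : ℝ} {U V : Set (ℝ × ℝ)} {v : ℝ × ℝ} {f g : ℝ × ℝ → ℂ}
    (h : ByParts δ U v f g) (hV : V ⊆ U) : ByParts δ V v f g :=
  fun ψ hψ hc hs => h ψ hψ hc (hs.trans hV)

/-- Only the one-sided derivative at `0` is available, because the translation identities are proved
for `T ≥ 0`. -/
lemma eq_zero_of_integral_eq_zero {k : ℝ → ℂ} (hk : Continuous k)
    (h : ∀ T, 0 ≤ T → ∫ s in (0 : ℝ)..T, k s = 0) : k 0 = 0 := by
  have h1 := (hk.integral_hasStrictDerivAt 0 0).hasDerivAt.hasDerivWithinAt (s := Ici 0)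
  have h2 : HasDerivWithinAt (fun T => ∫ s in (0 : ℝ)..T, k s) 0 (Ici 0) 0 :=
    (hasDerivWithinAt_const 0 (Ici (0 : ℝ)) (0 : ℂ)).congr (fun T hT => h T hT) (h 0 le_rfl)
  exact (uniqueDiffWithinAt_Ici 0).eq_deriv _ h1 h2

lemma smul_e1 (s : ℝ) : s • ((1 : ℝ), (0 : ℝ)) = (s, 0) := by simp
lemma smul_e2 (s : ℝ) : s • ((0 : ℝ), (1 : ℝ)) = (0, s) := by simp

lemma intervalIntegral_conj (f : ℝ → ℂ) (a b : ℝ) :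
    ∫ s in a..b, conj (f s) = conj (∫ s in a..b, f s) := by
  simp [intervalIntegral, integral_conj]

/-- Integration of a weak derivative along translates, with the translations on the function
itself. -/
theorem shift_inner_sub {δ : ℝ} {U : Set (ℝ × ℝ)} {v : ℝ × ℝ} {F G : ℝ × ℝ → ℂ}
    (hF : MemLp F 2 (volume.restrict (strip δ))) (hG : MemLp G 2 (volume.restrict (strip δ)))
    (H : ByParts δ U v F G) {T : ℝ} (hT : 0 ≤ T)
    (hU : ∀ s ∈ Icc 0 T, ∀ z ∈ strip δ, z + s • v ∈ U)
    {f : ℝ × ℝ → ℂ} (hf : MemLp f 2 (volume.restrict (strip δ))) :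
    inner ℂ (zext hf) (shift (T • v) (zext hF)) - inner ℂ (zext hf) (zext hF)
      = ∫ s in (0 : ℝ)..T, inner ℂ (zext hf) (shift (s • v) (zext hG)) := by
  -- The earlier identity with direction `-v` and the roles of the factors exchanged; conjugation
  -- then brings the factors back into order.
  have h2 := inner_shift_sub hF hG.neg H.neg_right hT
    (fun s hs z hz => by simpa using hU s hs z hz) hf
  have h3 := congrArg conj h2
  have e : ∀ (w : ℝ × ℝ) (a b : L2plane),
      conj (inner ℂ a (shift (-w) b)) = inner ℂ b (shift w a) := by
    intro w a b
    rw [inner_conj_symm, inner_shift_right]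
  have en : zext hG.neg = -zext hG := by
    rw [zext, zext, ← MemLp.toLp_neg]
    congr 1
    exact funext fun z => by by_cases hz : z ∈ strip δ <;> simp [hz]
  rw [map_sub, map_neg, ← intervalIntegral_conj] at h3
  simp only [smul_neg, e, en, inner_conj_symm, map_neg, inner_neg_right] at h3
  rw [h3, intervalIntegral.integral_neg, neg_neg]

/-- Skew-symmetry of the weak derivative in the direction `ξ`. -/
theorem HasWeakPartial.integral_mul_eq_neg {δ : ℝ} {f g F G : ℝ × ℝ → ℂ}
    (hf : MemLp f 2 (volume.restrict (strip δ))) (hg : MemLp g 2 (volume.restrict (strip δ)))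
    (hF : MemLp F 2 (volume.restrict (strip δ))) (hG : MemLp G 2 (volume.restrict (strip δ)))
    (h : HasWeakPartial δ (1, 0) f g) (H : HasWeakPartial δ (1, 0) F G) :
    ∫ z in strip δ, conj (f z) * G z = -∫ z in strip δ, conj (g z) * F z := by
  rw [← inner_zext_zext hf hG, ← inner_zext_zext hg hF]
  have hcont : ∀ a φ : L2plane,
      Continuous fun s : ℝ => inner ℂ a (shift (s • ((1 : ℝ), (0 : ℝ))) φ) :=
    fun a φ => continuous_const.inner ((continuous_shift φ).comp (by fun_prop))
  -- Translations along `ξ` preserve the strip, so both translation identities describe the same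
  -- difference for every `T ≥ 0`. Comparing the integrands at `0` gives the claim.
  have key := eq_zero_of_integral_eq_zero
    (k := fun s : ℝ => inner ℂ (zext hg) (shift (s • ((1 : ℝ), (0 : ℝ))) (zext hF))
      + inner ℂ (zext hf) (shift (s • ((1 : ℝ), (0 : ℝ))) (zext hG)))
    ((hcont _ _).add (hcont _ _)) ?_
  · simp only [zero_smul, shift_zero] at key
    exact eq_neg_of_add_eq_zero_right key
  · intro T hT
    rw [intervalIntegral.integral_add ((hcont _ _).intervalIntegrable _ _)
      ((hcont _ _).intervalIntegrable _ _)]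
    have h1 := inner_shift_sub hf hg h hT
      (fun s _ z hz => by simpa [strip, smul_e1] using hz) hF
    have h2 := shift_inner_sub hF hG H hT
      (fun s _ z hz => by simpa [strip, smul_e1] using hz) hf
    rw [← h2, h1]
    ring

/-- A translation by the full width makes the supports disjoint. -/
lemma inner_zext_shift_eq_zero {δ : ℝ} {f g : ℝ × ℝ → ℂ}
    (hf : MemLp f 2 (volume.restrict (strip δ))) (hg : MemLp g 2 (volume.restrict (strip δ))) :
    inner ℂ (zext hf) (shift (δ • ((0 : ℝ), (1 : ℝ))) (zext hg)) = 0 := by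
  rw [inner_zext]
  refine integral_eq_zero_of_ae ?_
  have h := (measurePreserving_add_right volume
    (δ • ((0 : ℝ), (1 : ℝ)))).quasiMeasurePreserving.ae_eq_comp (zext_coeFn hg)
  filter_upwards [ae_restrict_of_ae (shift_coeFn (δ • ((0 : ℝ), (1 : ℝ))) (zext hg)),
    ae_restrict_of_ae h, ae_restrict_mem (measurableSet_strip δ)] with z h1 h2 hz
  simp only [Function.comp_def] at h2
  rw [h1, h2, indicator_of_notMem, mul_zero, Pi.zero_apply]
  rintro ⟨-, h⟩
  have := hz.1
  simp at h
  linarith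

/-- Integration by parts in the direction `η` between a function with zero lower trace and one with
zero upper trace. -/
theorem ZeroTraceLower.integral_mul_eq_neg {δ : ℝ} (hδ : 0 ≤ δ) {f g F G : ℝ × ℝ → ℂ}
    (hf : MemLp f 2 (volume.restrict (strip δ))) (hg : MemLp g 2 (volume.restrict (strip δ)))
    (hF : MemLp F 2 (volume.restrict (strip δ))) (hG : MemLp G 2 (volume.restrict (strip δ)))
    (h : ZeroTraceLower δ f g) (H : ZeroTraceUpper δ F G) :
    ∫ z in strip δ, conj (f z) * G z = -∫ z in strip δ, conj (g z) * F z := by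
  rw [← inner_zext_zext hf hG, ← inner_zext_zext hg hF]
  -- The function with zero lower trace may be tested with functions pushed down through `η = 0`,
  -- the one with zero upper trace with functions pushed up through `η = δ`. Both identities contain
  -- the integral of `⟨g, G(· + s e₂)⟩` over `0 ≤ s ≤ δ`; at `s = δ` the other translated pairings
  -- vanish, and comparison finishes.
  have h1 := inner_shift_sub hf hg h hδ (fun s hs z hz => by
    have := hz.2
    simp only [smul_e2, mem_ofPred_eq, Prod.snd_sub]
    linarith [hs.1]) hG
  have h2 := shift_inner_sub hF hG H hδ (fun s hs z hz => by
    have := hz.1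
    simp only [smul_e2, mem_ofPred_eq, Prod.snd_add]
    linarith [hs.1]) hg
  rw [inner_zext_shift_eq_zero] at h1 h2
  rw [← h2, zero_sub, zero_sub, neg_neg] at h1
  linear_combination -h1

/-! ### Product rule -/

/-- A polynomial close to `ρ'` is integrated from `ρ 0`. This controls the function and its
derivative at the same time. -/
lemma exists_smooth_near {δ : ℝ} {ρ ρ' : ℝ → ℝ} (hρ : ContinuousOn ρ (Icc 0 δ))
    (hρ' : ContinuousOn ρ' (Icc 0 δ)) (hd : ∀ η ∈ Ioo 0 δ, HasDerivAt ρ (ρ' η) η)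
    {ε : ℝ} (hε : 0 < ε) :
    ∃ P : ℝ → ℝ, ContDiff ℝ (⊤ : ℕ∞) P ∧ (∀ η ∈ Icc 0 δ, |P η - ρ η| ≤ ε * δ) ∧
      ∀ η ∈ Icc 0 δ, |deriv P η - ρ' η| ≤ ε := by
  obtain ⟨p, hp⟩ := exists_polynomial_near_of_continuousOn 0 δ ρ' hρ' ε hε
  have hder : ∀ η, HasDerivAt (fun η => ρ 0 + ∫ s in (0 : ℝ)..η, p.eval s) (p.eval η) η := by
    intro η
    exact ((p.continuous.integral_hasStrictDerivAt 0 η).hasDerivAt).const_add _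
  refine ⟨fun η => ρ 0 + ∫ s in (0 : ℝ)..η, p.eval s, ?_, ?_, ?_⟩
  · rw [contDiff_infty_iff_deriv]
    refine ⟨fun η => (hder η).differentiableAt, ?_⟩
    rw [funext fun η => (hder η).deriv]
    simpa using p.contDiff_aeval (𝕜 := ℝ) ((⊤ : ℕ∞) : WithTop ℕ∞)
  · intro η hη
    have hsub : uIcc 0 η ⊆ Icc 0 δ := by
      rw [uIcc_of_le hη.1]
      exact Icc_subset_Icc_right hη.2
    have h1 : ∫ s in (0 : ℝ)..η, ρ' s = ρ η - ρ 0 :=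
      intervalIntegral.integral_eq_sub_of_hasDerivAt_of_le hη.1
        (hρ.mono (Icc_subset_Icc_right hη.2))
        (fun s hs => hd s ⟨hs.1, hs.2.trans_le hη.2⟩) (hρ'.mono hsub).intervalIntegrable
    have h2 : ρ 0 + (∫ s in (0 : ℝ)..η, p.eval s) - ρ η
        = ∫ s in (0 : ℝ)..η, (p.eval s - ρ' s) := by
      rw [intervalIntegral.integral_sub (p.continuous.intervalIntegrable _ _)
        (hρ'.mono hsub).intervalIntegrable, h1]
      ring
    rw [h2, ← Real.norm_eq_abs]
    refine (intervalIntegral.norm_integral_le_of_norm_le_const (C := ε) ?_).trans ?_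
    · intro s hs
      exact (hp s (hsub (uIoc_subset_uIcc hs))).le
    · rw [sub_zero, abs_of_nonneg hη.1]
      exact mul_le_mul_of_nonneg_left hη.2 hε.le
  · intro η hη
    rw [(hder η).deriv]
    exact (hp η hη).le

lemma aestronglyMeasurable_of_continuousOn {δ : ℝ} {σ : ℝ → ℝ} (hσ : ContinuousOn σ (Icc 0 δ)) :
    AEStronglyMeasurable (fun z : ℝ × ℝ => (σ z.2 : ℂ)) (volume.restrict (strip δ)) := by
  refine ContinuousOn.aestronglyMeasurable ?_ (measurableSet_strip δ)
  exact Complex.continuous_ofReal.comp_continuousOn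
    (hσ.comp continuous_snd.continuousOn fun z hz => ⟨hz.1.le, hz.2.le⟩)

/-- Product rule for weak derivatives, for a factor that depends on `η` only and can be
approximated by smooth functions. -/
theorem ByParts.mul_of_approx {δ : ℝ} {U : Set (ℝ × ℝ)} {v : ℝ × ℝ} {f g : ℝ × ℝ → ℂ}
    (hf : MemLp f 2 (volume.restrict (strip δ))) (hg : MemLp g 2 (volume.restrict (strip δ)))
    (h : ByParts δ U v f g) {ρ ρ' : ℝ → ℝ} (hρ : ContinuousOn ρ (Icc 0 δ))
    (hρ' : ContinuousOn ρ' (Icc 0 δ))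
    (happ : ∀ ε > 0, ∃ P : ℝ → ℝ, ContDiff ℝ (⊤ : ℕ∞) P ∧ (∀ η ∈ Icc 0 δ, |P η - ρ η| ≤ ε) ∧
      ∀ η ∈ Icc 0 δ, |v.2| * |deriv P η - ρ' η| ≤ ε) :
    ByParts δ U v (fun z => (ρ z.2 : ℂ) * f z)
      (fun z => (ρ z.2 : ℂ) * g z + (v.2 : ℂ) * (ρ' z.2 : ℂ) * f z) := by
  intro ψ hψ hc hs
  have hfl : LocallyIntegrable f (volume.restrict (strip δ)) := hf.locallyIntegrable (by norm_num)
  have hgl : LocallyIntegrable g (volume.restrict (strip δ)) := hg.locallyIntegrable (by norm_num)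
  have hdψ : Continuous fun z => fderiv ℝ ψ z v :=
    (hψ.continuous_fderiv (by simp)).clm_apply continuous_const
  have hdc : HasCompactSupport fun z => fderiv ℝ ψ z v := hc.fderiv_apply (𝕜 := ℝ) v
  have i1 : Integrable (fun z => (fderiv ℝ ψ z v) • f z) (volume.restrict (strip δ)) :=
    LocallyIntegrable.integrable_smul_left_of_hasCompactSupport hfl hdψ hdc
  have i2 : Integrable (fun z => ψ z • f z) (volume.restrict (strip δ)) :=
    LocallyIntegrable.integrable_smul_left_of_hasCompactSupport hfl hψ.continuous hc
  have i3 : Integrable (fun z => ψ z • g z) (volume.restrict (strip δ)) :=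
    LocallyIntegrable.integrable_smul_left_of_hasCompactSupport hgl hψ.continuous hc
  have hint : ∀ {σ : ℝ → ℝ} {u : ℝ × ℝ → ℂ}, ContinuousOn σ (Icc 0 δ) →
      Integrable u (volume.restrict (strip δ)) →
      Integrable (fun z => (σ z.2 : ℂ) * u z) (volume.restrict (strip δ)) := by
    intro σ u hσ hu
    obtain ⟨C, hC⟩ := isCompact_Icc.exists_bound_of_continuousOn hσ
    refine hu.bdd_mul (c := C) (aestronglyMeasurable_of_continuousOn hσ) ?_
    filter_upwards [ae_restrict_mem (measurableSet_strip δ)] with z hz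
    simpa using hC z.2 ⟨hz.1.le, hz.2.le⟩
  -- `Q σ σ'` is the defect in the product rule, linear in the pair. For smooth `P` the function `P
  -- ψ` is an admissible test function, so `Q P P' = 0`; the general case follows by approximation.
  set Q : (ℝ → ℝ) → (ℝ → ℝ) → ℂ := fun σ σ' => ∫ z in strip δ,
    ((σ z.2 : ℂ) * ((fderiv ℝ ψ z v) • f z) + ((v.2 : ℂ) * ((σ' z.2 : ℂ) * (ψ z • f z))
      + (σ z.2 : ℂ) * (ψ z • g z))) with hQ
  have hQi : ∀ {σ σ' : ℝ → ℝ}, ContinuousOn σ (Icc 0 δ) → ContinuousOn σ' (Icc 0 δ) →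
      Integrable (fun z : ℝ × ℝ => (σ z.2 : ℂ) * ((fderiv ℝ ψ z v) • f z)
        + ((v.2 : ℂ) * ((σ' z.2 : ℂ) * (ψ z • f z)) + (σ z.2 : ℂ) * (ψ z • g z)))
        (volume.restrict (strip δ)) := fun hσ hσ' =>
    (hint hσ i1).add (((hint hσ' i2).const_mul _).add (hint hσ i3))
  have hsmooth : ∀ P : ℝ → ℝ, ContDiff ℝ (⊤ : ℕ∞) P → Q P (deriv P) = 0 := by
    intro P hP
    have hPs : ContDiff ℝ (⊤ : ℕ∞) fun z : ℝ × ℝ => P z.2 * ψ z := by fun_prop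
    have hb := h (fun z => P z.2 * ψ z) hPs hc.mul_left
      ((tsupport_mul_subset_right (f := fun z : ℝ × ℝ => P z.2)).trans hs)
    have hfd : ∀ z, fderiv ℝ (fun z : ℝ × ℝ => P z.2 * ψ z) z v
        = P z.2 * fderiv ℝ ψ z v + v.2 * deriv P z.2 * ψ z := by
      intro z
      have h1 : HasFDerivAt (fun z : ℝ × ℝ => P z.2)
          (deriv P z.2 • ContinuousLinearMap.snd ℝ ℝ ℝ) z :=
        ((hP.differentiable (by simp)) z.2).hasDerivAt.comp_hasFDerivAt z hasFDerivAt_snd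
      have h2 := h1.mul ((hψ.differentiable (by simp)) z).hasFDerivAt
      have h3 : fderiv ℝ (fun z : ℝ × ℝ => P z.2 * ψ z) z = _ := h2.fderiv
      rw [h3]
      simp
      ring
    simp only [hfd] at hb
    have hP' : ContinuousOn (deriv P) (Icc 0 δ) :=
      (hP.continuous_deriv (by simp)).continuousOn
    rw [eq_neg_iff_add_eq_zero, ← integral_add] at hb
    · rw [← hb, hQ]
      refine integral_congr_ae (Eventually.of_forall fun z => ?_)
      simp only [Complex.real_smul]
      push_cast
      ring
    · refine ((hint hP.continuous.continuousOn i1).add ((hint hP' i2).const_mul (v.2 : ℂ))).congr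
        (Eventually.of_forall fun z => ?_)
      simp only [Pi.add_apply, Complex.real_smul]
      push_cast
      ring
    · refine (hint hP.continuous.continuousOn i3).congr (Eventually.of_forall fun z => ?_)
      simp only [Complex.real_smul]
      push_cast
      ring
  have hQ0 : Q ρ ρ' = 0 := by
    set K : ℝ := ∫ z in strip δ, (‖(fderiv ℝ ψ z v) • f z‖ + (‖ψ z • f z‖ + ‖ψ z • g z‖)) with hK
    have hKi : Integrable (fun z => ‖(fderiv ℝ ψ z v) • f z‖ + (‖ψ z • f z‖ + ‖ψ z • g z‖)) (volume.restrict (strip δ)) :=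
      i1.norm.add (i2.norm.add i3.norm)
    have hle : ∀ ε > 0, ‖Q ρ ρ'‖ ≤ ε * K := by
      intro ε hε
      obtain ⟨P, hP, hP1, hP2⟩ := happ ε hε
      have hP' : ContinuousOn (deriv P) (Icc 0 δ) :=
        (hP.continuous_deriv (by simp)).continuousOn
      have e : Q ρ ρ' = Q ρ ρ' - Q P (deriv P) := by rw [hsmooth P hP, sub_zero]
      rw [e, hQ]
      simp only
      rw [← integral_sub (hQi hρ hρ') (hQi hP.continuous.continuousOn hP'), hK,
        ← integral_const_mul]
      refine norm_integral_le_of_norm_le (hKi.const_mul ε) ?_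
      filter_upwards [ae_restrict_mem (measurableSet_strip δ)] with z hz
      have b1 := hP1 z.2 ⟨hz.1.le, hz.2.le⟩
      have b2 := hP2 z.2 ⟨hz.1.le, hz.2.le⟩
      have e2 : ∀ a b c : ℂ, ((ρ z.2 : ℂ) * a + ((v.2 : ℂ) * ((ρ' z.2 : ℂ) * b) + (ρ z.2 : ℂ) * c))
          - ((P z.2 : ℂ) * a + ((v.2 : ℂ) * (((deriv P z.2 : ℝ) : ℂ) * b) + (P z.2 : ℂ) * c))
          = -((P z.2 - ρ z.2 : ℝ) : ℂ) * a + (-(v.2 : ℂ) * (((deriv P z.2 - ρ' z.2 : ℝ) : ℂ) * b)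
            + -((P z.2 - ρ z.2 : ℝ) : ℂ) * c) := by
        intro a b c
        push_cast
        ring
      rw [e2]
      refine (norm_add_le _ _).trans ?_
      refine (add_le_add_right (norm_add_le _ _) _).trans ?_
      simp only [norm_mul, norm_neg, Complex.norm_real, Real.norm_eq_abs]
      have n1 := norm_nonneg ((fderiv ℝ ψ z v) • f z)
      have n2 := norm_nonneg (ψ z • f z)
      have n3 := norm_nonneg (ψ z • g z)
      have c1 := mul_le_mul_of_nonneg_right b1 n1
      have c2 := mul_le_mul_of_nonneg_right b2 n2
      have c3 := mul_le_mul_of_nonneg_right b1 n3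
      linarith
    by_contra hne
    have hpos : 0 < ‖Q ρ ρ'‖ := norm_pos_iff.2 hne
    have hKpos : 0 < K := by
      have := hle 1 one_pos
      linarith
    have := hle (‖Q ρ ρ'‖ / (2 * K)) (by positivity)
    field_simp at this
    linarith
  rw [eq_neg_iff_add_eq_zero, ← integral_add, ← hQ0]
  · refine integral_congr_ae (Eventually.of_forall fun z => ?_)
    simp only [Complex.real_smul]
    ring
  · refine (hint hρ i1).congr (Eventually.of_forall fun z => ?_)
    simp only [Complex.real_smul]
    ring
  · refine ((hint hρ i3).add ((hint hρ' i2).const_mul (v.2 : ℂ))).congr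
      (Eventually.of_forall fun z => ?_)
    simp only [Pi.add_apply, Complex.real_smul]
    ring

/-- Product rule for weak derivatives, for a `C¹` factor that depends on `η` only. -/
theorem ByParts.mul {δ : ℝ} (hδ : 0 < δ) {U : Set (ℝ × ℝ)} {v : ℝ × ℝ} {f g : ℝ × ℝ → ℂ}
    (hf : MemLp f 2 (volume.restrict (strip δ))) (hg : MemLp g 2 (volume.restrict (strip δ)))
    (h : ByParts δ U v f g) {ρ ρ' : ℝ → ℝ} (hρ : ContinuousOn ρ (Icc 0 δ))
    (hρ' : ContinuousOn ρ' (Icc 0 δ)) (hd : ∀ η ∈ Ioo 0 δ, HasDerivAt ρ (ρ' η) η) :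
    ByParts δ U v (fun z => (ρ z.2 : ℂ) * f z)
      (fun z => (ρ z.2 : ℂ) * g z + (v.2 : ℂ) * (ρ' z.2 : ℂ) * f z) := by
  refine h.mul_of_approx hf hg hρ hρ' fun ε hε => ?_
  obtain ⟨P, hP, hP1, hP2⟩ := exists_smooth_near hρ hρ' hd
    (lt_min (div_pos hε hδ) (div_pos hε (by positivity : 0 < |v.2| + 1)))
  refine ⟨P, hP, fun η hη => (hP1 η hη).trans ?_, fun η hη => ?_⟩
  · calc _ ≤ ε / δ * δ := by gcongr; exact min_le_left _ _
      _ = ε := by field_simp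
  · calc _ ≤ |v.2| * (ε / (|v.2| + 1)) := by
          gcongr
          exact (hP2 η hη).trans (min_le_right _ _)
      _ ≤ ε := by
          rw [mul_div_assoc', div_le_iff₀ (by positivity)]
          nlinarith [abs_nonneg v.2]

/-- Multiplication by a continuous function of `η` commutes with the weak `ξ`-derivative. -/
theorem HasWeakPartial.mul_continuous {δ : ℝ} {f g : ℝ × ℝ → ℂ}
    (hf : MemLp f 2 (volume.restrict (strip δ))) (hg : MemLp g 2 (volume.restrict (strip δ)))
    (h : HasWeakPartial δ (1, 0) f g) {ρ : ℝ → ℝ} (hρ : ContinuousOn ρ (Icc 0 δ)) :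
    HasWeakPartial δ (1, 0) (fun z => (ρ z.2 : ℂ) * f z) (fun z => (ρ z.2 : ℂ) * g z) := by
  have := ByParts.mul_of_approx hf hg h (ρ' := 0) hρ continuousOn_const fun ε hε => by
    obtain ⟨p, hp⟩ := exists_polynomial_near_of_continuousOn 0 δ ρ hρ ε hε
    exact ⟨fun η => p.eval η, by simpa using p.contDiff_aeval (𝕜 := ℝ) ((⊤ : ℕ∞) : WithTop ℕ∞),
      fun η hη => (hp η hη).le, fun η hη => by simpa using hε.le⟩
  exact this.congr ae_eq_rfl (ae_of_all _ fun z => by simp)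

/-! ### The weighted space and the domain of the pencil -/

section Weighted

variable {β : ℝ → ℝ} {δ : ℝ}

lemma aemeasurable_weight (hβ : ContinuousOn β (Icc 0 δ)) :
    AEMeasurable (fun z : ℝ × ℝ => ENNReal.ofReal (Real.exp (-β z.2)))
      (volume.restrict (strip δ)) := by
  refine AEMeasurable.ennreal_ofReal (ContinuousOn.aemeasurable ?_ (measurableSet_strip δ))
  exact Real.continuous_exp.comp_continuousOn
    (hβ.neg.comp continuous_snd.continuousOn fun z hz => ⟨hz.1.le, hz.2.le⟩)

lemma integral_stripMeasure (hβ : ContinuousOn β (Icc 0 δ)) {E : Type*} [NormedAddCommGroup E]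
    [NormedSpace ℝ E] (u : ℝ × ℝ → E) :
    ∫ z, u z ∂(stripMeasure β δ) = ∫ z in strip δ, Real.exp (-β z.2) • u z := by
  rw [stripMeasure, integral_withDensity_eq_integral_toReal_smul₀ (aemeasurable_weight hβ) (by simp)]
  simp [ENNReal.toReal_ofReal, Real.exp_nonneg]

lemma inner_L2h (hβ : ContinuousOn β (Icc 0 δ)) (f g : L2h β δ) :
    inner ℂ f g = ∫ z in strip δ, ((Real.exp (-β z.2) : ℝ) : ℂ) * (conj (f z) * g z) := by
  rw [L2.inner_def, integral_stripMeasure hβ]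
  refine integral_congr_ae (ae_of_all _ fun z => ?_)
  simp only [RCLike.inner_apply, Complex.real_smul]
  ring

lemma stripMeasure_le_volume (hβ : ContinuousOn β (Icc 0 δ)) :
    ∃ c : ℝ≥0∞, c ≠ ∞ ∧ stripMeasure β δ ≤ c • volume.restrict (strip δ) := by
  obtain ⟨C, hC⟩ := isCompact_Icc.exists_bound_of_continuousOn hβ
  refine ⟨ENNReal.ofReal (Real.exp C), by simp, ?_⟩
  rw [← withDensity_const]
  refine withDensity_mono ?_
  filter_upwards [ae_restrict_mem (measurableSet_strip δ)] with z hz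
  refine ENNReal.ofReal_le_ofReal (Real.exp_le_exp.2 ?_)
  exact (neg_le_abs _).trans (hC z.2 ⟨hz.1.le, hz.2.le⟩)

lemma memLp_stripMeasure (hβ : ContinuousOn β (Icc 0 δ)) {f : ℝ × ℝ → ℂ}
    (hf : MemLp f 2 (volume.restrict (strip δ))) : MemLp f 2 (stripMeasure β δ) := by
  obtain ⟨c, hc, hle⟩ := stripMeasure_le_volume hβ
  exact hf.of_measure_le_smul hc hle

lemma memLp_mul {σ : ℝ → ℝ} (hσ : ContinuousOn σ (Icc 0 δ)) {f : ℝ × ℝ → ℂ}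
    (hf : MemLp f 2 (volume.restrict (strip δ))) :
    MemLp (fun z => (σ z.2 : ℂ) * f z) 2 (volume.restrict (strip δ)) := by
  obtain ⟨C, hC⟩ := isCompact_Icc.exists_bound_of_continuousOn hσ
  refine (hf.const_mul (C : ℂ)).mono
    ((aestronglyMeasurable_of_continuousOn hσ).mul hf.aestronglyMeasurable) ?_
  filter_upwards [ae_restrict_mem (measurableSet_strip δ)] with z hz
  have := hC z.2 ⟨hz.1.le, hz.2.le⟩
  simp only [norm_mul, Complex.norm_real]
  gcongr
  exact this.trans (le_abs_self C)

/-- A function of the strip, multiplied by a continuous function of `η`, as an element of the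
weighted space. -/
def mulLp (hβ : ContinuousOn β (Icc 0 δ)) {σ : ℝ → ℝ} (hσ : ContinuousOn σ (Icc 0 δ))
    {f : ℝ × ℝ → ℂ} (hf : MemLp f 2 (volume.restrict (strip δ))) : L2h β δ :=
  (memLp_stripMeasure hβ (memLp_mul hσ hf)).toLp

lemma mulLp_coeFn (hβ : ContinuousOn β (Icc 0 δ)) {σ : ℝ → ℝ} (hσ : ContinuousOn σ (Icc 0 δ))
    {f : ℝ × ℝ → ℂ} (hf : MemLp f 2 (volume.restrict (strip δ))) :
    mulLp hβ hσ hf =ᵐ[volume.restrict (strip δ)] fun z => (σ z.2 : ℂ) * f z :=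
  (volume_ac_stripMeasure hβ).ae_le (MemLp.coeFn_toLp _)

lemma continuousOn_exp (hβ : ContinuousOn β (Icc 0 δ)) :
    ContinuousOn (fun η => Real.exp (β η)) (Icc 0 δ) :=
  Real.continuous_exp.comp_continuousOn hβ

lemma continuousOn_exp_neg (hβ : ContinuousOn β (Icc 0 δ)) :
    ContinuousOn (fun η => Real.exp (-β η)) (Icc 0 δ) :=
  Real.continuous_exp.comp_continuousOn hβ.neg

/-- Pairing with `ψ` without weight is the weighted inner product with `e^β ψ`. -/
lemma inner_mulLp_exp (hβ : ContinuousOn β (Icc 0 δ)) {f : ℝ × ℝ → ℂ}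
    (hf : MemLp f 2 (volume.restrict (strip δ))) (g : L2h β δ) :
    inner ℂ (mulLp hβ (continuousOn_exp hβ) hf) g = ∫ z in strip δ, conj (f z) * g z := by
  rw [inner_L2h hβ]
  refine integral_congr_ae ?_
  filter_upwards [mulLp_coeFn hβ (continuousOn_exp hβ) hf] with z hz
  rw [hz, map_mul, Complex.conj_ofReal, mul_assoc, ← mul_assoc, ← Complex.ofReal_mul,
    ← Real.exp_add]
  simp

lemma byParts_iff_inner (hβ : ContinuousOn β (Icc 0 δ)) (U : Set (ℝ × ℝ)) (v : ℝ × ℝ)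
    (f g : L2h β δ) : ByParts δ U v f g ↔
    ∀ (ψ : ℝ × ℝ → ℝ) (hψ : ContDiff ℝ (⊤ : ℕ∞) ψ) (hc : HasCompactSupport ψ), tsupport ψ ⊆ U →
      inner ℂ (mulLp hβ (continuousOn_exp hβ) (memLp_test (ψ := fun z => fderiv ℝ ψ z v)
        ((hψ.continuous_fderiv (by simp)).clm_apply continuous_const)
          (hc.fderiv_apply (𝕜 := ℝ) v) _)) f
        = -inner ℂ (mulLp hβ (continuousOn_exp hβ) (memLp_test hψ.continuous hc _)) g := by
  simp only [inner_mulLp_exp, Complex.conj_ofReal]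
  rfl

/-- Each test function gives one equation between continuous functionals. This is behind the
completeness of the domain and the passage to closures in the form domain. -/
lemma isClosed_byPartsSubmodule (hβ : ContinuousOn β (Icc 0 δ)) (U : Set (ℝ × ℝ)) (v : ℝ × ℝ) :
    IsClosed (byPartsSubmodule hβ U v : Set (L2h β δ × L2h β δ)) := by
  have : (byPartsSubmodule hβ U v : Set (L2h β δ × L2h β δ))
      = {p | ByParts δ U v p.1 p.2} := rfl
  rw [this]
  simp only [byParts_iff_inner hβ]
  simp only [ofPred_forall]
  refine isClosed_iInter fun ψ => isClosed_iInter fun hψ => isClosed_iInter fun hc =>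
    isClosed_iInter fun hs => ?_
  exact isClosed_eq (continuous_const.inner continuous_fst)
    (continuous_const.inner continuous_snd).neg

/-- Uniqueness of weak derivatives. It ensures that an element of the domain is determined by its
entry `0`. -/
lemma HasWeakPartial.eq_zero {v : ℝ × ℝ} (hβ : ContinuousOn β (Icc 0 δ)) {f g : L2h β δ}
    (h : HasWeakPartial δ v f g) (hf : f = 0) : g = 0 := by
  have hg : ∀ᵐ z ∂volume, z ∈ strip δ → (strip δ).indicator g z = 0 := by
    refine (isOpen_strip δ).ae_eq_zero_of_integral_contDiff_smul_eq_zero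
      (((memLp_indicator_strip (memLp_volume hβ g)).locallyIntegrable
        (by norm_num)).locallyIntegrableOn _) ?_
    intro ψ hψ hc hs
    have h1 := h ψ hψ hc hs
    have h0 : f =ᵐ[volume.restrict (strip δ)] 0 := by
      rw [hf]
      exact (volume_ac_stripMeasure hβ).ae_le (Lp.coeFn_zero ..)
    rw [integral_eq_zero_of_ae (f := fun z => (fderiv ℝ ψ z v) • f z)
      (by filter_upwards [h0] with z hz; simp [hz])] at h1
    rw [eq_comm, neg_eq_zero, ← integral_indicator (measurableSet_strip δ)] at h1
    rw [← h1]
    refine integral_congr_ae (ae_of_all _ fun z => ?_)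
    by_cases hz : z ∈ strip δ <;> simp [hz]
  refine Lp.ext ?_
  have h2 : ∀ᵐ z ∂(volume.restrict (strip δ)), g z = 0 := by
    filter_upwards [ae_restrict_of_ae hg, ae_restrict_mem (measurableSet_strip δ)] with z hz hm
    simpa [hm] using hz hm
  filter_upwards [(stripMeasure_ac β δ).ae_le h2, Lp.coeFn_zero ℂ 2 (stripMeasure β δ)]
    with z h3 h4
  rw [h3, h4, Pi.zero_apply]

end Weighted

/-! ### Integration by parts with the weight; Green's formula and symmetry of the pencil. -/

section Domain

variable {β : ℝ → ℝ} {δ : ℝ}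

lemma derivWithin_eq_deriv {η : ℝ} (hη : η ∈ Ioo 0 δ) :
    derivWithin β (Icc 0 δ) η = deriv β η :=
  derivWithin_of_mem_nhds (Icc_mem_nhds hη.1 hη.2)

lemma hasDerivAt_derivWithin (hβ : ContDiffOn ℝ 1 β (Icc 0 δ)) {η : ℝ} (hη : η ∈ Ioo 0 δ) :
    HasDerivAt β (derivWithin β (Icc 0 δ) η) η :=
  ((hβ.differentiableOn (by simp)) η ⟨hη.1.le, hη.2.le⟩).hasDerivWithinAt.hasDerivAt
    (Icc_mem_nhds hη.1 hη.2)

lemma continuousOn_derivWithin (hδ : 0 < δ) (hβ : ContDiffOn ℝ 1 β (Icc 0 δ)) :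
    ContinuousOn (derivWithin β (Icc 0 δ)) (Icc 0 δ) :=
  hβ.continuousOn_derivWithin (uniqueDiffOn_Icc hδ) le_rfl

lemma mulDeriv_coeFn (hδ : 0 < δ) (hβ : ContDiffOn ℝ 1 β (Icc 0 δ)) (f : L2h β δ) :
    mulDeriv hδ hβ f =ᵐ[volume.restrict (strip δ)]
      fun z => ((derivWithin β (Icc 0 δ) z.2 : ℝ) : ℂ) * f z := by
  filter_upwards [(volume_ac_stripMeasure hβ.continuousOn).ae_le (mulDeriv_apply hδ hβ f),
    ae_restrict_mem (measurableSet_strip δ)] with z h1 h2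
  rw [h1, derivWithin_eq_deriv h2]

lemma inner_mulDeriv_right (hδ : 0 < δ) (hβ : ContDiffOn ℝ 1 β (Icc 0 δ)) (f g : L2h β δ) :
    inner ℂ f (mulDeriv hδ hβ g) = inner ℂ (mulDeriv hδ hβ f) g := by
  rw [inner_L2h hβ.continuousOn, inner_L2h hβ.continuousOn]
  refine integral_congr_ae ?_
  filter_upwards [mulDeriv_coeFn hδ hβ f, mulDeriv_coeFn hδ hβ g] with z h1 h2
  rw [h1, h2, map_mul, Complex.conj_ofReal]
  ring

/-- Skew-symmetry of the weak `ξ`-derivative in the weighted space. -/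
lemma HasWeakPartial.inner_eq_neg (hβ : ContinuousOn β (Icc 0 δ)) {f g F G : L2h β δ}
    (h : HasWeakPartial δ (1, 0) f g) (H : HasWeakPartial δ (1, 0) F G) :
    inner ℂ f G = -inner ℂ g F := by
  have mF := memLp_volume hβ F
  have mG := memLp_volume hβ G
  have hw := continuousOn_exp_neg hβ
  have := HasWeakPartial.integral_mul_eq_neg (memLp_volume hβ f) (memLp_volume hβ g)
    (memLp_mul hw mF) (memLp_mul hw mG) h (H.mul_continuous mF mG hw)
  rw [inner_L2h hβ, inner_L2h hβ]
  refine (integral_congr_ae (ae_of_all _ fun z => ?_)).trans (this.trans (congrArg Neg.neg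
    (integral_congr_ae (ae_of_all _ fun z => ?_)))) <;> ring

lemma HasWeakPartial.inner_mulDeriv_eq_neg (hδ : 0 < δ) (hβ : ContDiffOn ℝ 1 β (Icc 0 δ))
    {f g F G : L2h β δ} (h : HasWeakPartial δ (1, 0) f g) (H : HasWeakPartial δ (1, 0) F G) :
    inner ℂ f (mulDeriv hδ hβ G) = -inner ℂ g (mulDeriv hδ hβ F) := by
  refine h.inner_eq_neg hβ.continuousOn ?_
  exact (H.mul_continuous (memLp_volume hβ.continuousOn F) (memLp_volume hβ.continuousOn G)
    (continuousOn_derivWithin hδ hβ)).congr (mulDeriv_coeFn hδ hβ F).symm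
    (mulDeriv_coeFn hδ hβ G).symm

lemma hasDerivAt_exp_neg (hβ : ContDiffOn ℝ 1 β (Icc 0 δ)) {η : ℝ} (hη : η ∈ Ioo 0 δ) :
    HasDerivAt (fun η => Real.exp (-β η))
      (Real.exp (-β η) * -derivWithin β (Icc 0 δ) η) η :=
  (hasDerivAt_derivWithin hβ hη).neg.exp

/-- Integration by parts in the direction `η` in the weighted space. -/
lemma ZeroTraceLower.inner_eq (hδ : 0 < δ) (hβ : ContDiffOn ℝ 1 β (Icc 0 δ))
    {f g F G : L2h β δ} (h : ZeroTraceLower δ f g) (H : ZeroTraceUpper δ F G) :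
    inner ℂ g F = inner ℂ f (-G + mulDeriv hδ hβ F) := by
  have hβc := hβ.continuousOn
  have mF := memLp_volume hβc F
  have mG := memLp_volume hβc G
  have hw := continuousOn_exp_neg hβc
  have hw' : ContinuousOn (fun η => Real.exp (-β η) * -derivWithin β (Icc 0 δ) η) (Icc 0 δ) :=
    hw.mul (continuousOn_derivWithin hδ hβ).neg
  -- The weight is attached to `F`. Differentiating `e^{-β}` creates the first-order term `β' F`.
  have H' := ByParts.mul hδ mF mG H hw hw' fun η hη => hasDerivAt_exp_neg hβ hη
  have mG' : MemLp (fun z : ℝ × ℝ => ((Real.exp (-β z.2) : ℝ) : ℂ) * G z + (((0 : ℝ), (1 : ℝ)).2 : ℂ)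
      * ((Real.exp (-β z.2) * -derivWithin β (Icc 0 δ) z.2 : ℝ) : ℂ) * F z) 2
      (volume.restrict (strip δ)) := by
    refine ((memLp_mul hw mG).add (memLp_mul hw' mF)).ae_eq (ae_of_all _ fun z => ?_)
    simp
  have := ZeroTraceLower.integral_mul_eq_neg hδ.le (memLp_volume hβc f) (memLp_volume hβc g)
    (memLp_mul hw mF) mG' h H'
  rw [eq_neg_iff_add_eq_zero, add_comm, ← eq_neg_iff_add_eq_zero] at this
  rw [inner_L2h hβc, inner_L2h hβc]
  convert! this using 1
  · refine integral_congr_ae (ae_of_all _ fun z => ?_)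
    ring
  · rw [← integral_neg]
    refine integral_congr_ae ?_
    have hadd : ((-G + mulDeriv hδ hβ F : L2h β δ) : ℝ × ℝ → ℂ) =ᵐ[volume.restrict (strip δ)]
        fun z => -G z + mulDeriv hδ hβ F z := by
      filter_upwards [(volume_ac_stripMeasure hβc).ae_le (Lp.coeFn_add (-G) (mulDeriv hδ hβ F)),
        (volume_ac_stripMeasure hβc).ae_le (Lp.coeFn_neg G)] with z h1 h2
      rw [h1, Pi.add_apply, h2, Pi.neg_apply]
    filter_upwards [hadd, mulDeriv_coeFn hδ hβ F] with z h1 h2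
    rw [h1, h2]
    push_cast
    ring

lemma isClosed_domain (hβ : ContDiffOn ℝ 1 β (Icc 0 δ)) :
    IsClosed (domain hβ : Set (Fin 6 → L2h β δ)) := by
  have key : ∀ (U : Set (ℝ × ℝ)) (v : ℝ × ℝ) (i j : Fin 6),
      IsClosed {J : Fin 6 → L2h β δ | ByParts δ U v (J i) (J j)} := fun U v i j =>
    (isClosed_byPartsSubmodule hβ.continuousOn U v).preimage
      (f := fun J : Fin 6 → L2h β δ => (J i, J j)) (by fun_prop)
  have : (domain hβ : Set (Fin 6 → L2h β δ)) = {J |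
    HasWeakPartial δ (1, 0) (J 0) (J 1) ∧ HasWeakPartial δ (0, 1) (J 0) (J 2) ∧
    HasWeakPartial δ (1, 0) (J 1) (J 3) ∧ HasWeakPartial δ (0, 1) (J 1) (J 4) ∧
    HasWeakPartial δ (0, 1) (J 2) (J 5) ∧
    ZeroTraceLower δ (J 0) (J 2) ∧ ZeroTraceUpper δ (J 2) (J 5)} := rfl
  rw [this]
  exact (key _ _ 0 1).and ((key _ _ 0 2).and ((key _ _ 1 3).and ((key _ _ 1 4).and
    ((key _ _ 2 5).and ((key _ _ 0 2).and (key _ _ 2 5))))))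

instance completeSpace_domain (hβ : ContDiffOn ℝ 1 β (Icc 0 δ)) : CompleteSpace (domain hβ) :=
  (isClosed_domain hβ).completeSpace_coe

lemma pencil_apply (hδ : 0 < δ) (hβ : ContDiffOn ℝ 1 β (Icc 0 δ)) (ω : ℝ) (J : domain hβ) :
    pencil hδ hβ ω J = (ω : ℂ) • (-J.1 3 + (-J.1 5 + mulDeriv hδ hβ (J.1 2)))
      + Complex.I • mulDeriv hδ hβ (J.1 1) := by
  change (ω : ℂ) • (-J.1 3 - J.1 5 + mulDeriv hδ hβ (J.1 2))
    - (-Complex.I) • mulDeriv hδ hβ (J.1 1) = _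
  rw [neg_smul, sub_neg_eq_add, sub_eq_add_neg, add_assoc]

/-- Green's formula. -/
theorem inner_pencil (hδ : 0 < δ) (hβ : ContDiffOn ℝ 1 β (Icc 0 δ)) (ω : ℝ) (J : domain hβ)
    {y₀ y₁ y₂ : L2h β δ} (h₁ : HasWeakPartial δ (1, 0) y₀ y₁) (h₂ : ZeroTraceLower δ y₀ y₂) :
    inner ℂ y₀ (pencil hδ hβ ω J) = ω * (inner ℂ y₁ (J.1 1) + inner ℂ y₂ (J.1 2))
      + Complex.I * inner ℂ y₀ (mulDeriv hδ hβ (J.1 1)) := by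
  obtain ⟨-, -, h3, -, -, -, h7⟩ := J.2
  have e1 := h₁.inner_eq_neg hβ.continuousOn h3
  have e2 := h₂.inner_eq hδ hβ h7
  rw [pencil_apply, inner_add_right, inner_smul_right, inner_smul_right, inner_add_right, ← e2,
    inner_neg_right, e1, neg_neg]

/-- The second-order part is symmetric by Green's formula. In the first-order part the factor `i`
compensates the skew-symmetry of `∂_ξ`, which commutes with multiplication by `β'(η)`. -/
theorem inner_pencil_symm (hδ : 0 < δ) (hβ : ContDiffOn ℝ 1 β (Icc 0 δ)) (ω : ℝ)
    (J K : domain hβ) :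
    inner ℂ (K.1 0) (pencil hδ hβ ω J) = inner ℂ (pencil hδ hβ ω K) (J.1 0) := by
  rw [inner_pencil hδ hβ ω J K.2.1 K.2.2.2.2.2.2.1,
    ← inner_conj_symm (pencil hδ hβ ω K),
    inner_pencil hδ hβ ω K J.2.1 J.2.2.2.2.2.2.1]
  simp only [map_add, map_mul, Complex.conj_ofReal, inner_conj_symm, Complex.conj_I]
  rw [K.2.1.inner_mulDeriv_eq_neg hδ hβ J.2.1, inner_mulDeriv_right]
  ring

/-- A surjective operator of the pencil is Fredholm. -/
theorem isFredholm_of_surjective (hδ : 0 < δ) (hβ : ContDiffOn ℝ 1 β (Icc 0 δ)) (ω : ℝ)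
    (h : Function.Surjective (pencil hδ hβ ω)) : (pencil hδ hβ ω).IsFredholm := by
  have hinj : (pencil hδ hβ ω).ker = ⊥ := by
    rw [LinearMap.ker_eq_bot']
    intro J hJ
    -- By symmetry the kernel is orthogonal to the range; choosing a preimage of `J.1 0` itself
    -- forces it to be zero.
    obtain ⟨K, hK⟩ := h (J.1 0)
    have h0 : J.1 0 = 0 := by
      have := inner_pencil_symm hδ hβ ω J K
      rw [hK, show pencil hδ hβ ω J = 0 from hJ, inner_zero_right] at this
      exact inner_self_eq_zero.1 this.symm
    obtain ⟨k1, k2, k3, k4, k5, -, -⟩ := J.2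
    have e1 := k1.eq_zero hβ.continuousOn h0
    have e2 := k2.eq_zero hβ.continuousOn h0
    have e3 := k3.eq_zero hβ.continuousOn e1
    have e4 := k4.eq_zero hβ.continuousOn e1
    have e5 := k5.eq_zero hβ.continuousOn e2
    ext i : 2
    fin_cases i
    exacts [h0, e1, e2, e3, e4, e5]
  let e := ContinuousLinearEquiv.ofBijective (pencil hδ hβ ω) hinj
    (LinearMap.range_eq_top.2 h)
  refine ContinuousLinearMap.IsFredholm.of_isQuasiInverse (v := (e.symm : L2h β δ →L[ℂ] domain hβ)) ?_
  have := e.isQuasiInverse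
  exact this

end Domain

/-! ### The weighted space on the interval and the integration operator -/

section Interval

variable {β : ℝ → ℝ} {δ : ℝ}

/-- The complex Hilbert space `L₂((0, δ); h)`. -/
abbrev L2i (β : ℝ → ℝ) (δ : ℝ) : Type := Lp ℂ 2 (intervalMeasure β δ)

lemma intervalMeasure_ac (β : ℝ → ℝ) (δ : ℝ) : intervalMeasure β δ ≪ volume.restrict (Ioo 0 δ) :=
  withDensity_absolutelyContinuous _ _

lemma aemeasurable_weight_interval (hβ : ContinuousOn β (Icc 0 δ)) :
    AEMeasurable (fun η : ℝ => ENNReal.ofReal (Real.exp (-β η))) (volume.restrict (Ioo 0 δ)) := by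
  refine AEMeasurable.ennreal_ofReal (ContinuousOn.aemeasurable ?_ measurableSet_Ioo)
  exact (continuousOn_exp_neg hβ).mono Ioo_subset_Icc_self

lemma volume_ac_intervalMeasure (hβ : ContinuousOn β (Icc 0 δ)) :
    volume.restrict (Ioo 0 δ) ≪ intervalMeasure β δ :=
  withDensity_absolutelyContinuous' (aemeasurable_weight_interval hβ)
    (ae_of_all _ fun η => by simp [Real.exp_pos])

lemma integral_intervalMeasure (hβ : ContinuousOn β (Icc 0 δ)) {E : Type*} [NormedAddCommGroup E]
    [NormedSpace ℝ E] (u : ℝ → E) :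
    ∫ η, u η ∂(intervalMeasure β δ) = ∫ η in Ioo 0 δ, Real.exp (-β η) • u η := by
  rw [intervalMeasure, integral_withDensity_eq_integral_toReal_smul₀
    (aemeasurable_weight_interval hβ) (by simp)]
  simp [ENNReal.toReal_ofReal, Real.exp_nonneg]

lemma inner_L2i (hβ : ContinuousOn β (Icc 0 δ)) (f g : L2i β δ) :
    inner ℂ f g = ∫ η in Ioo 0 δ, ((Real.exp (-β η) : ℝ) : ℂ) * (conj (f η) * g η) := by
  rw [L2.inner_def, integral_intervalMeasure hβ]
  refine integral_congr_ae (ae_of_all _ fun z => ?_)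
  simp only [RCLike.inner_apply, Complex.real_smul]
  ring

lemma norm_sq_L2i (hβ : ContinuousOn β (Icc 0 δ)) (f : L2i β δ) :
    ‖f‖ ^ 2 = ∫ η in Ioo 0 δ, Real.exp (-β η) * ‖f η‖ ^ 2 := by
  have h := inner_self_eq_norm_sq_to_K (𝕜 := ℂ) f
  rw [inner_L2i hβ] at h
  have e : ∀ η, ((Real.exp (-β η) : ℝ) : ℂ) * (conj (f η) * f η)
      = ((Real.exp (-β η) * ‖f η‖ ^ 2 : ℝ) : ℂ) := by
    intro η
    rw [mul_comm (conj (f η)), Complex.mul_conj, Complex.normSq_eq_norm_sq]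
    push_cast
    ring
  simp only [e] at h
  rw [integral_complex_ofReal] at h
  have h' : ((∫ η in Ioo 0 δ, Real.exp (-β η) * ‖f η‖ ^ 2 : ℝ) : ℂ) = ((‖f‖ ^ 2 : ℝ) : ℂ) := by
    rw [h]; norm_cast
  exact (Complex.ofReal_injective h').symm

instance isFiniteMeasure_intervalMeasure [hβ : Fact (ContinuousOn β (Icc 0 δ))] :
    IsFiniteMeasure (intervalMeasure β δ) := by
  obtain ⟨C, hC⟩ := isCompact_Icc.exists_bound_of_continuousOn (continuousOn_exp_neg hβ.out)
  refine isFiniteMeasure_withDensity (ne_of_lt ?_)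
  calc ∫⁻ η in Ioo 0 δ, ENNReal.ofReal (Real.exp (-β η))
      ≤ ∫⁻ η in Ioo 0 δ, ENNReal.ofReal C := by
        refine setLIntegral_mono measurable_const fun η hη => ENNReal.ofReal_le_ofReal ?_
        exact (le_abs_self _).trans (hC η ⟨hη.1.le, hη.2.le⟩)
    _ < ∞ := by simp [ENNReal.mul_lt_top_iff]

lemma memLp_of_continuousOn (hβ : ContinuousOn β (Icc 0 δ)) {f : ℝ → ℂ}
    (hf : ContinuousOn f (Icc 0 δ)) (p : ℝ≥0∞) : MemLp f p (intervalMeasure β δ) := by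
  have := Fact.mk hβ
  obtain ⟨C, hC⟩ := isCompact_Icc.exists_bound_of_continuousOn hf
  refine MemLp.of_bound (C := C) ?_ ?_
  · exact ((hf.mono Ioo_subset_Icc_self).aestronglyMeasurable measurableSet_Ioo).mono_ac
      (intervalMeasure_ac β δ)
  · refine (intervalMeasure_ac β δ).ae_le ?_
    filter_upwards [ae_restrict_mem measurableSet_Ioo] with η hη
    exact hC η ⟨hη.1.le, hη.2.le⟩

lemma volume_le_intervalMeasure (hβ : ContinuousOn β (Icc 0 δ)) :
    ∃ c : ℝ≥0∞, c ≠ ∞ ∧ volume.restrict (Ioo 0 δ) ≤ c • intervalMeasure β δ := by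
  obtain ⟨C, hC⟩ := isCompact_Icc.exists_bound_of_continuousOn (continuousOn_exp hβ)
  refine ⟨ENNReal.ofReal C, by simp, ?_⟩
  rw [intervalMeasure, ← withDensity_smul' _ _ (by simp)]
  conv_lhs => rw [← withDensity_one (μ := volume.restrict (Ioo 0 δ))]
  refine withDensity_mono ?_
  filter_upwards [ae_restrict_mem measurableSet_Ioo] with η hη
  have h1 := (le_abs_self _).trans (hC η ⟨hη.1.le, hη.2.le⟩)
  have hC0 : 0 ≤ C := (Real.exp_nonneg _).trans h1
  simp only [Pi.one_apply, Pi.smul_apply, smul_eq_mul]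
  rw [← ENNReal.ofReal_mul hC0, ← ENNReal.ofReal_one]
  refine ENNReal.ofReal_le_ofReal ?_
  calc (1 : ℝ) = Real.exp (β η) * Real.exp (-β η) := by rw [← Real.exp_add]; simp
    _ ≤ _ := by gcongr

lemma memLp_volume_interval (hβ : ContinuousOn β (Icc 0 δ)) {f : ℝ → ℂ}
    (hf : MemLp f 2 (intervalMeasure β δ)) : MemLp f 2 (volume.restrict (Ioo 0 δ)) := by
  obtain ⟨c, hc, hle⟩ := volume_le_intervalMeasure hβ
  exact hf.of_measure_le_smul hc hle

lemma integrableOn_of_memLp (hβ : ContinuousOn β (Icc 0 δ)) {f : ℝ → ℂ}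
    (hf : MemLp f 2 (intervalMeasure β δ)) : IntegrableOn f (Ioo 0 δ) :=
  (memLp_volume_interval hβ hf).integrable (by norm_num)

lemma intervalIntegrable_of_memLp (hβ : ContinuousOn β (Icc 0 δ)) {f : ℝ → ℂ}
    (hf : MemLp f 2 (intervalMeasure β δ)) {a b : ℝ} (ha : a ∈ Icc 0 δ) (hb : b ∈ Icc 0 δ) :
    IntervalIntegrable f volume a b := by
  rw [intervalIntegrable_iff, uIoc, integrableOn_Ioc_iff_integrableOn_Ioo]
  refine (integrableOn_of_memLp hβ hf).mono_set (Ioo_subset_Ioo ?_ ?_)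
  · exact le_min ha.1 hb.1
  · exact max_le ha.2 hb.2

/-- `|∫_a^b f| ≤ C √|b - a| ‖f‖`. -/
lemma exists_norm_integral_le (hβ : ContinuousOn β (Icc 0 δ)) :
    ∃ C : ℝ, 0 ≤ C ∧ ∀ (f : L2i β δ), ∀ a ∈ Icc 0 δ, ∀ b ∈ Icc 0 δ, a ≤ b →
      ‖∫ s in a..b, f s‖ ≤ C * √(b - a) * ‖f‖ := by
  obtain ⟨C, hC⟩ := isCompact_Icc.exists_bound_of_continuousOn (continuousOn_exp hβ)
  refine ⟨√|C|, Real.sqrt_nonneg _, fun f a ha b hb hab => ?_⟩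
  have hI : Ioo a b ⊆ Ioo 0 δ := Ioo_subset_Ioo ha.1 hb.2
  have hm : MemLp f 2 (volume.restrict (Ioo a b)) :=
    (memLp_volume_interval hβ (Lp.memLp f)).mono_measure (Measure.restrict_mono hI le_rfl)
  have hm0 : MemLp f 2 (volume.restrict (Ioo 0 δ)) := memLp_volume_interval hβ (Lp.memLp f)
  have h1 : ‖∫ s in a..b, f s‖ ≤ ∫ s in Ioo a b, 1 * ‖f s‖ := by
    refine (intervalIntegral.norm_integral_le_integral_norm hab).trans ?_
    rw [intervalIntegral.integral_of_le hab, integral_Ioc_eq_integral_Ioo]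
    simp
  have h2 := integral_mul_le_Lp_mul_Lq_of_nonneg (μ := volume.restrict (Ioo a b))
    (f := fun _ => (1 : ℝ)) (g := fun s => ‖f s‖) Real.HolderConjugate.two_two
    (ae_of_all _ fun _ => zero_le_one) (ae_of_all _ fun _ => norm_nonneg _)
    (by simpa using memLp_const (p := (2 : ℝ≥0∞)) (μ := volume.restrict (Ioo a b)) (1 : ℝ))
    (by simpa using hm.norm)
  have h3 : ∫ s in Ioo a b, ‖f s‖ ^ 2 ≤ |C| * ‖f‖ ^ 2 := by
    rw [norm_sq_L2i hβ, ← integral_const_mul]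
    have i0 : IntegrableOn (fun s => ‖f s‖ ^ 2) (Ioo 0 δ) := by
      have := hm0.integrable_norm_pow (p := 2) (by norm_num)
      exact this
    refine (setIntegral_mono_set i0 (ae_of_all _ fun _ => by positivity)
      (LE.le.eventuallyLE hI)).trans ?_
    obtain ⟨D, hD⟩ := isCompact_Icc.exists_bound_of_continuousOn (continuousOn_exp_neg hβ)
    refine setIntegral_mono_on i0 ?_ measurableSet_Ioo fun s hs => ?_
    · refine Integrable.const_mul (i0.bdd_mul (c := D) ?_ ?_) _
      · exact ((continuousOn_exp_neg hβ).mono Ioo_subset_Icc_self).aestronglyMeasurable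
          measurableSet_Ioo
      · filter_upwards [ae_restrict_mem measurableSet_Ioo] with η hη
        exact hD η ⟨hη.1.le, hη.2.le⟩
    · have h4 := (hC s ⟨hs.1.le, hs.2.le⟩).trans (le_abs_self C)
      rw [Real.norm_eq_abs, abs_of_pos (Real.exp_pos _)] at h4
      calc ‖f s‖ ^ 2 = Real.exp (β s) * (Real.exp (-β s) * ‖f s‖ ^ 2) := by
            rw [← mul_assoc, ← Real.exp_add]; simp
        _ ≤ _ := by gcongr
  refine h1.trans (h2.trans ?_)
  have h5 : ∫ _s in Ioo a b, (1 : ℝ) ^ (2 : ℝ) = b - a := by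
    simp [measureReal_restrict_apply MeasurableSet.univ, Real.volume_real_Ioo_of_le hab]
  rw [← Real.sqrt_eq_rpow, ← Real.sqrt_eq_rpow, h5, mul_comm √|C|, mul_assoc]
  simp only [Real.rpow_two]
  gcongr
  calc √(∫ s in Ioo a b, ‖f s‖ ^ 2) ≤ √(|C| * ‖f‖ ^ 2) := Real.sqrt_le_sqrt h3
    _ = _ := by rw [Real.sqrt_mul (abs_nonneg C), Real.sqrt_sq (norm_nonneg f)]

lemma continuousOn_primitive (hβ : ContinuousOn β (Icc 0 δ)) {f : ℝ → ℂ}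
    (hf : MemLp f 2 (intervalMeasure β δ)) :
    ContinuousOn (fun η => ∫ s in (0 : ℝ)..η, f s) (Icc 0 δ) := by
  rcases le_or_gt 0 δ with hδ | hδ
  · have := intervalIntegral.continuousOn_primitive_interval (μ := volume) (f := f) (a := 0)
      (b := δ) ?_
    · rwa [uIcc_of_le hδ] at this
    · rw [uIcc_of_le hδ, integrableOn_Icc_iff_integrableOn_Ioo]
      exact integrableOn_of_memLp hβ hf
  · rw [Icc_eq_empty hδ.not_ge]
    exact continuousOn_empty _

/-- Evaluation of the primitive at a point is a bounded functional; these functionals build the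
finite-rank approximations in `exists_volterra`. -/
lemma exists_primitive_clm (hβ : ContinuousOn β (Icc 0 δ)) {a : ℝ} (ha : a ∈ Icc 0 δ) :
    ∃ ℓ : L2i β δ →L[ℂ] ℂ, ∀ g, ℓ g = ∫ s in (0 : ℝ)..a, g s := by
  have h0 : (0 : ℝ) ∈ Icc 0 δ := left_mem_Icc.2 (ha.1.trans ha.2)
  obtain ⟨C, hC0, hC⟩ := exists_norm_integral_le hβ
  have hcongr : ∀ {u v : ℝ → ℂ}, u =ᵐ[intervalMeasure β δ] v →
      ∫ s in (0 : ℝ)..a, u s = ∫ s in (0 : ℝ)..a, v s := by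
    intro u v h
    rw [intervalIntegral.integral_of_le ha.1, intervalIntegral.integral_of_le ha.1,
      integral_Ioc_eq_integral_Ioo, integral_Ioc_eq_integral_Ioo]
    exact integral_congr_ae (ae_restrict_of_ae_restrict_of_subset (Ioo_subset_Ioo_right ha.2)
      ((volume_ac_intervalMeasure hβ).ae_le h))
  refine ⟨LinearMap.mkContinuous
      { toFun := fun g => ∫ s in (0 : ℝ)..a, g s
        map_add' := fun f g => ?_
        map_smul' := fun c f => ?_ } (C * √(a - 0)) (fun g => hC g 0 h0 a ha ha.1), fun g => rfl⟩
  · rw [← intervalIntegral.integral_add (intervalIntegrable_of_memLp hβ (Lp.memLp f) h0 ha)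
      (intervalIntegrable_of_memLp hβ (Lp.memLp g) h0 ha)]
    exact hcongr (Lp.coeFn_add f g)
  · rw [RingHom.id_apply, ← intervalIntegral.integral_smul]
    exact hcongr (Lp.coeFn_smul c f)

/-- The integration operator `g ↦ ∫_0^η g` is compact. -/
lemma exists_volterra (hδ : 0 < δ) (hβ : ContinuousOn β (Icc 0 δ)) :
    ∃ J : L2i β δ →L[ℂ] L2i β δ, IsCompactOperator J ∧
      ∀ g, J g =ᵐ[intervalMeasure β δ] fun η => ∫ s in (0 : ℝ)..η, g s := by
  have := Fact.mk hβ
  have h0 : (0 : ℝ) ∈ Icc 0 δ := left_mem_Icc.2 hδ.le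
  have hm : ∀ g : L2i β δ, MemLp (fun η => ∫ s in (0 : ℝ)..η, g s) 2 (intervalMeasure β δ) :=
    fun g => memLp_of_continuousOn hβ (continuousOn_primitive hβ (Lp.memLp g)) 2
  obtain ⟨C, hC0, hC⟩ := exists_norm_integral_le hβ
  choose! ℓ hℓ using fun a (ha : a ∈ Icc 0 δ) => exists_primitive_clm (β := β) hβ ha
  have hmem : ∀ᵐ η ∂(intervalMeasure β δ), η ∈ Ioo 0 δ :=
    (intervalMeasure_ac β δ).ae_le (ae_restrict_mem measurableSet_Ioo)
  set m : ℝ := ((intervalMeasure β δ).real univ) ^ ((2 : ℝ≥0∞).toReal)⁻¹ with hmdef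
  have hm0 : 0 ≤ m := by positivity
  have hnorm : ∀ (u : L2i β δ) (D : ℝ), 0 ≤ D →
      (∀ᵐ η ∂(intervalMeasure β δ), ‖u η‖ ≤ D) → ‖u‖ ≤ m * D := by
    intro u D hD h
    exact Lp.norm_le_of_ae_bound hD h
  let J₀ : L2i β δ →ₗ[ℂ] L2i β δ :=
    { toFun := fun g => (hm g).toLp
      map_add' := fun f g => by
        rw [← MemLp.toLp_add, MemLp.toLp_eq_toLp_iff]
        filter_upwards [hmem] with η hη
        have h := Ioo_subset_Icc_self hη
        rw [Pi.add_apply, ← hℓ η h, ← hℓ η h, ← hℓ η h, map_add]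
      map_smul' := fun c f => by
        rw [RingHom.id_apply, ← MemLp.toLp_const_smul, MemLp.toLp_eq_toLp_iff]
        filter_upwards [hmem] with η hη
        have h := Ioo_subset_Icc_self hη
        rw [Pi.smul_apply, ← hℓ η h, ← hℓ η h, map_smul] }
  have hJ₀ : ∀ g, ‖J₀ g‖ ≤ (m * (C * √δ)) * ‖g‖ := by
    intro g
    rw [mul_assoc]
    refine hnorm _ _ (by positivity) ?_
    filter_upwards [(hm g).coeFn_toLp, hmem] with η h1 hη
    change ‖((hm g).toLp _ : L2i β δ) η‖ ≤ _
    rw [h1]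
    refine (hC g 0 h0 η ⟨hη.1.le, hη.2.le⟩ hη.1.le).trans ?_
    gcongr
    linarith [hη.2]
  let J : L2i β δ →L[ℂ] L2i β δ := J₀.mkContinuous _ hJ₀
  have hJ : ∀ g, J g =ᵐ[intervalMeasure β δ] fun η => ∫ s in (0 : ℝ)..η, g s :=
    fun g => (hm g).coeFn_toLp
  refine ⟨J, ?_, hJ⟩
  -- approximation by operators of finite rank
  let t : ℕ → ℕ → ℝ := fun n j => j * (δ / (n + 1))
  let step : (n : ℕ) → (Fin (n + 1) → ℂ) → ℝ → ℂ := fun n c η =>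
    if h : ⌊η / (δ / (n + 1))⌋₊ < n + 1 then c ⟨_, h⟩ else 0
  have hstep : ∀ n c, MemLp (step n c) 2 (intervalMeasure β δ) := by
    intro n c
    refine MemLp.of_bound (C := ‖c‖) ?_ (ae_of_all _ fun η => ?_)
    · refine Measurable.aestronglyMeasurable ?_
      exact (measurable_from_top (f := fun j : ℕ => if h : j < n + 1 then c ⟨j, h⟩ else 0)).comp
        (Nat.measurable_floor.comp (measurable_id.div_const _))
    · simp only [step]
      split_ifs with h
      · exact norm_le_pi_norm c _
      · simp
  let S : (n : ℕ) → (Fin (n + 1) → ℂ) →ₗ[ℂ] L2i β δ := fun n =>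
    { toFun := fun c => (hstep n c).toLp
      map_add' := fun c d => by
        rw [← MemLp.toLp_add, MemLp.toLp_eq_toLp_iff]
        refine ae_of_all _ fun η => ?_
        simp only [step, Pi.add_apply]
        split_ifs <;> simp
      map_smul' := fun a c => by
        rw [RingHom.id_apply, ← MemLp.toLp_const_smul, MemLp.toLp_eq_toLp_iff]
        refine ae_of_all _ fun η => ?_
        simp only [step, Pi.smul_apply]
        split_ifs <;> simp }
  -- `F n g` takes, on each cell of length `δ / (n + 1)`, the value of the primitive at the left
  -- end. It factors through `ℂ^{n+1}`, and the Hölder bound with exponent `1/2` makes the error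
  -- tend to zero in operator norm.
  let F : ℕ → (L2i β δ →L[ℂ] L2i β δ) := fun n =>
    (LinearMap.toContinuousLinearMap (S n)).comp (ContinuousLinearMap.pi fun j => ℓ (t n j))
  have hF : ∀ n, IsCompactOperator (F n) := by
    intro n
    have hS : IsCompactOperator (LinearMap.toContinuousLinearMap (S n)) :=
      isCompactOperator_of_locallyCompactSpace_rng _
    exact hS.comp_clm _
  have hdiff : ∀ n, ‖J - F n‖ ≤ m * (C * √(δ / (n + 1))) := by
    intro n
    refine ContinuousLinearMap.opNorm_le_bound _ (by positivity) fun g => ?_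
    rw [mul_assoc]
    refine hnorm _ _ (by positivity) ?_
    have hFg : F n g =ᵐ[intervalMeasure β δ] step n fun j => ℓ (t n j) g :=
      (hstep n _).coeFn_toLp
    rw [sub_apply]
    filter_upwards [hJ g, hFg, Lp.coeFn_sub (J g) (F n g), hmem] with η h1 h2 h3 hη
    have hd : 0 < δ / (n + 1) := by positivity
    have hq : 0 ≤ η / (δ / (n + 1)) := div_nonneg hη.1.le hd.le
    have hfl : ⌊η / (δ / (n + 1))⌋₊ < n + 1 := by
      rw [Nat.floor_lt hq, div_lt_iff₀ hd]
      push_cast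
      rw [mul_div_cancel₀ _ (by positivity)]
      exact hη.2
    have ht1 : t n ⌊η / (δ / (n + 1))⌋₊ ≤ η := by
      have := Nat.floor_le hq
      rwa [le_div_iff₀ hd] at this
    have ht2 : η - t n ⌊η / (δ / (n + 1))⌋₊ ≤ δ / (n + 1) := by
      have := (Nat.lt_floor_add_one (η / (δ / (n + 1)))).le
      rw [div_le_iff₀ hd] at this
      simp only [t]
      linarith
    have ht0 : t n ⌊η / (δ / (n + 1))⌋₊ ∈ Icc 0 δ := ⟨by positivity, ht1.trans hη.2.le⟩
    rw [h3, Pi.sub_apply, h1, h2]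
    simp only [step, hfl, dif_pos]
    rw [hℓ _ ht0, intervalIntegral.integral_interval_sub_left
      (intervalIntegrable_of_memLp hβ (Lp.memLp g) h0 ⟨hη.1.le, hη.2.le⟩)
      (intervalIntegrable_of_memLp hβ (Lp.memLp g) h0 ht0)]
    refine (hC g _ ht0 η ⟨hη.1.le, hη.2.le⟩ ht1).trans ?_
    gcongr
  refine isCompactOperator_of_tendsto (l := atTop) (F := F) ?_ (Eventually.of_forall hF)
  rw [tendsto_iff_norm_sub_tendsto_zero]
  refine squeeze_zero (fun _ => norm_nonneg _) (fun n => (norm_sub_rev _ _).trans_le (hdiff n)) ?_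
  have h1 : Tendsto (fun n : ℕ => δ / ((n : ℝ) + 1)) atTop (𝓝 0) := by
    have := (tendsto_one_div_add_atTop_nhds_zero_nat (𝕜 := ℝ)).const_mul δ
    simpa [div_eq_mul_inv] using this
  have h2 := ((Real.continuous_sqrt.tendsto 0).comp h1).const_mul C
  have h3 := h2.const_mul m
  simpa using h3

end Interval

/-! ### The number `Ω_*` in terms of operators on the interval -/

section Omega

variable {β : ℝ → ℝ} {δ : ℝ}

lemma ae_mem_Ioo (β : ℝ → ℝ) (δ : ℝ) : ∀ᵐ η ∂(intervalMeasure β δ), η ∈ Ioo 0 δ :=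
  (intervalMeasure_ac β δ).ae_le (ae_restrict_mem measurableSet_Ioo)

/-- Nothing is assumed of `χ` at `0` itself. The fundamental theorem is used from a point `e > 0` to
the left of which `χ` and its derivative vanish. -/
lemma eq_integral_deriv_of_vanish {χ : ℝ → ℂ} (hχ : ContDiffOn ℝ (⊤ : ℕ∞) χ (Ioo 0 δ))
    (h0 : (0 : ℝ) ∉ closure (Function.support χ ∩ Ioo 0 δ))
    (hi : IntegrableOn (deriv χ) (Ioo 0 δ)) {η : ℝ} (hη : η ∈ Ioo 0 δ) :
    χ η = ∫ s in (0 : ℝ)..η, deriv χ s := by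
  obtain ⟨r, hr, hball⟩ := Metric.mem_nhds_iff.1 (isClosed_closure.isOpen_compl.mem_nhds h0)
  have hz : ∀ s ∈ Ioo 0 δ, s < r → χ s = 0 := by
    intro s hs hsr
    by_contra hne
    have : s ∈ Metric.ball (0 : ℝ) r := by
      rw [Metric.mem_ball, Real.dist_eq, sub_zero, abs_of_pos hs.1]
      exact hsr
    exact hball this (subset_closure ⟨hne, hs⟩)
  have hd : ∀ s ∈ Ioo 0 δ, s < r → deriv χ s = 0 := by
    intro s hs hsr
    have : χ =ᶠ[𝓝 s] fun _ => 0 := by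
      filter_upwards [(isOpen_Ioo (a := (0 : ℝ)) (b := min r δ)).mem_nhds
        ⟨hs.1, lt_min hsr hs.2⟩] with x hx
      exact hz x ⟨hx.1, hx.2.trans_le (min_le_right _ _)⟩ (hx.2.trans_le (min_le_left _ _))
    rw [this.deriv_eq, deriv_const]
  set e := min r η / 2 with he
  have he0 : 0 < e := by have := lt_min hr hη.1; positivity
  have heη : e < η := by have := min_le_right r η; have := hη.1; rw [he]; linarith
  have her : e < r := by have := min_le_left r η; rw [he]; linarith
  have hii : ∀ a b, 0 ≤ a → b < δ → a ≤ b → IntervalIntegrable (deriv χ) volume a b := by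
    intro a b ha hb hab
    rw [intervalIntegrable_iff_integrableOn_Ioo_of_le hab]
    exact hi.mono_set (Ioo_subset_Ioo ha hb.le)
  rw [← intervalIntegral.integral_add_adjacent_intervals
    (hii 0 e le_rfl (heη.trans hη.2) he0.le) (hii e η he0.le hη.2 heη.le)]
  have h1 : ∫ s in (0 : ℝ)..e, deriv χ s = 0 := by
    rw [intervalIntegral.integral_of_le he0.le, integral_Ioc_eq_integral_Ioo]
    refine setIntegral_eq_zero_of_forall_eq_zero fun s hs => ?_
    exact hd s ⟨hs.1, hs.2.trans (heη.trans hη.2)⟩ (hs.2.trans her)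
  have h2 : ∫ s in e..η, deriv χ s = χ η - χ e := by
    refine intervalIntegral.integral_eq_sub_of_hasDerivAt (fun s hs => ?_)
      (hii e η he0.le hη.2 heη.le)
    rw [uIcc_of_le heη.le] at hs
    exact ((hχ.contDiffAt (Ioo_mem_nhds (he0.trans_le hs.1) (hs.2.trans_lt hη.2))).differentiableAt
      (by simp)).hasDerivAt
  rw [h1, h2, hz e ⟨he0, heη.trans hη.2⟩ her]
  ring

variable {J : L2i β δ →L[ℂ] L2i β δ}

/-- The relation `χ = J χ'` holds for the approximating smooth functions and survives the limit
because `J` is bounded. -/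
lemma MemH10.toLp_eq (hβ : ContinuousOn β (Icc 0 δ))
    (hJ : ∀ g, J g =ᵐ[intervalMeasure β δ] fun η => ∫ s in (0 : ℝ)..η, g s)
    {φ φ' : ℝ → ℂ} (h : MemH10 β δ φ φ') : h.1.toLp = J h.2.1.toLp := by
  obtain ⟨h1, h2, h3⟩ := h
  change h1.toLp = J h2.toLp
  rw [← dist_le_zero]
  refine le_of_forall_pos_le_add fun ε hε => ?_
  set K : ℝ := 1 + ‖J‖ with hK
  have hKpos : 0 < K := by positivity
  obtain ⟨χ, hχ, hχ0, e1, e2⟩ := h3 (ENNReal.ofReal (ε / K)) (by simpa using by positivity)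
  have m1 : MemLp (φ - χ) 2 (intervalMeasure β δ) := by
    refine ⟨h1.aestronglyMeasurable.sub ?_, e1.trans ENNReal.ofReal_lt_top⟩
    exact (hχ.continuousOn.aestronglyMeasurable measurableSet_Ioo).mono_ac (intervalMeasure_ac β δ)
  have m2 : MemLp (φ' - deriv χ) 2 (intervalMeasure β δ) :=
    ⟨h2.aestronglyMeasurable.sub (measurable_deriv χ).aestronglyMeasurable,
      e2.trans ENNReal.ofReal_lt_top⟩
  have mχ : MemLp χ 2 (intervalMeasure β δ) := by simpa using h1.sub m1
  have mχ' : MemLp (deriv χ) 2 (intervalMeasure β δ) := by simpa using h2.sub m2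
  have hχJ : mχ.toLp = J mχ'.toLp := by
    refine Lp.ext ?_
    filter_upwards [mχ.coeFn_toLp, hJ mχ'.toLp, ae_mem_Ioo β δ] with η a1 a2 a3
    rw [a1, a2, eq_integral_deriv_of_vanish hχ hχ0 (integrableOn_of_memLp hβ mχ') a3,
      intervalIntegral.integral_of_le a3.1.le, intervalIntegral.integral_of_le a3.1.le,
      integral_Ioc_eq_integral_Ioo, integral_Ioc_eq_integral_Ioo]
    refine integral_congr_ae (ae_restrict_of_ae_restrict_of_subset
      (Ioo_subset_Ioo_right a3.2.le) ?_)
    exact (volume_ac_intervalMeasure hβ).ae_le mχ'.coeFn_toLp.symm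
  have d1 : ‖h1.toLp - mχ.toLp‖ ≤ ε / K := by
    rw [← MemLp.toLp_sub, Lp.norm_toLp]
    exact ENNReal.toReal_le_of_le_ofReal (by positivity) e1.le
  have d2 : ‖h2.toLp - mχ'.toLp‖ ≤ ε / K := by
    rw [← MemLp.toLp_sub, Lp.norm_toLp]
    exact ENNReal.toReal_le_of_le_ofReal (by positivity) e2.le
  rw [zero_add, dist_eq_norm]
  have e : h1.toLp - J h2.toLp = (h1.toLp - mχ.toLp) - J (h2.toLp - mχ'.toLp) := by
    rw [map_sub, ← hχJ]
    abel
  rw [e]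
  calc _ ≤ ‖h1.toLp - mχ.toLp‖ + ‖J‖ * ‖h2.toLp - mχ'.toLp‖ :=
        (norm_sub_le _ _).trans (by gcongr; exact J.le_opNorm _)
    _ ≤ ε / K + ‖J‖ * (ε / K) := by gcongr
    _ = ε := by field_simp; rw [hK]

/-- Smooth functions with compact support in `(0, δ)` are dense. -/
lemma exists_test_near (hβ : ContinuousOn β (Icc 0 δ)) (g : L2i β δ) {ε : ℝ} (hε : 0 < ε) :
    ∃ (ψ : ℝ → ℂ) (hψ : MemLp ψ 2 (intervalMeasure β δ)), ContDiff ℝ (⊤ : ℕ∞) ψ ∧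
      tsupport ψ ⊆ Ioo 0 δ ∧ HasCompactSupport ψ ∧ ‖g - hψ.toLp‖ < ε := by
  let M : Submodule ℂ (L2i β δ) :=
    { carrier := {x | ∃ ψ : ℝ → ℂ, ContDiff ℝ (⊤ : ℕ∞) ψ ∧ tsupport ψ ⊆ Ioo 0 δ ∧
        HasCompactSupport ψ ∧ x =ᵐ[intervalMeasure β δ] ψ}
      zero_mem' := ⟨0, contDiff_const, by simp, HasCompactSupport.zero, Lp.coeFn_zero ..⟩
      add_mem' := by
        rintro x y ⟨ψ, h1, h2, h3, h4⟩ ⟨ψ', h1', h2', h3', h4'⟩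
        refine ⟨ψ + ψ', h1.add h1', (tsupport_add ψ ψ').trans (union_subset h2 h2'), h3.add h3', ?_⟩
        filter_upwards [Lp.coeFn_add x y, h4, h4'] with η e1 e2 e3
        rw [e1, Pi.add_apply, e2, e3, Pi.add_apply]
      smul_mem' := by
        rintro c x ⟨ψ, h1, h2, h3, h4⟩
        refine ⟨fun η => c • ψ η, h1.const_smul c,
          (closure_mono fun η hη => ?_).trans h2, h3.smul_left (f := fun _ => c), ?_⟩
        · exact fun h => hη (by simp [h])
        · filter_upwards [Lp.coeFn_smul c x, h4] with η e1 e2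
          rw [e1, Pi.smul_apply, e2] }
  have hM : M.topologicalClosure = ⊤ := by
    rw [Submodule.topologicalClosure_eq_top_iff, Submodule.eq_bot_iff]
    intro r hr
    have mr := memLp_volume_interval hβ (Lp.memLp r)
    have hw := (continuousOn_exp_neg hβ)
    have hr0 : ∀ᵐ η ∂volume, η ∈ Ioo 0 δ → ((Real.exp (-β η) : ℝ) : ℂ) * r η = 0 := by
      refine isOpen_Ioo.ae_eq_zero_of_integral_contDiff_smul_eq_zero ?_ ?_
      · refine IntegrableOn.locallyIntegrableOn ?_
        obtain ⟨C, hC⟩ := isCompact_Icc.exists_bound_of_continuousOn hw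
        refine Integrable.bdd_mul (c := C) (mr.integrable (by norm_num)) ?_ ?_
        · exact (Complex.continuous_ofReal.comp_continuousOn
            (hw.mono Ioo_subset_Icc_self)).aestronglyMeasurable measurableSet_Ioo
        · filter_upwards [ae_restrict_mem measurableSet_Ioo] with η hη
          simpa only [Complex.norm_real] using hC η ⟨hη.1.le, hη.2.le⟩
      · intro ψ hψ hc hs
        have hψc : ContDiff ℝ (⊤ : ℕ∞) fun η => (ψ η : ℂ) := Complex.ofRealCLM.contDiff.comp hψ
        have mψ : MemLp (fun η => (ψ η : ℂ)) 2 (intervalMeasure β δ) :=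
          memLp_of_continuousOn hβ hψc.continuous.continuousOn 2
        have hin : mψ.toLp ∈ M := by
          refine ⟨fun η => (ψ η : ℂ), hψc, ?_, hc.comp_left (g := ((↑) : ℝ → ℂ)) (by simp),
            mψ.coeFn_toLp⟩
          exact (closure_mono fun η hη => by simpa using hη).trans hs
        have h1 := (Submodule.mem_orthogonal _ _).1 hr _ hin
        rw [inner_L2i hβ] at h1
        rw [← setIntegral_eq_integral_of_forall_compl_eq_zero (s := Ioo 0 δ), ← h1]
        · refine integral_congr_ae ?_
          filter_upwards [(volume_ac_intervalMeasure hβ).ae_le mψ.coeFn_toLp] with η hη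
          rw [hη, Complex.conj_ofReal, Complex.real_smul]
          ring
        · intro η hη
          rw [image_eq_zero_of_notMem_tsupport fun h => hη (hs h), zero_smul]
    refine Lp.ext ?_
    have h2 : ∀ᵐ η ∂(volume.restrict (Ioo 0 δ)), r η = 0 := by
      filter_upwards [ae_restrict_of_ae hr0, ae_restrict_mem measurableSet_Ioo] with η h1 h2
      simpa [Complex.exp_ne_zero] using h1 h2
    filter_upwards [(intervalMeasure_ac β δ).ae_le h2, Lp.coeFn_zero ℂ 2 (intervalMeasure β δ)]
      with η h3 h4
    rw [h3, h4, Pi.zero_apply]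
  have hg : g ∈ M.topologicalClosure := hM ▸ Submodule.mem_top
  rw [← SetLike.mem_coe, Submodule.topologicalClosure_coe, Metric.mem_closure_iff] at hg
  obtain ⟨x, ⟨ψ, h1, h2, h3, h4⟩, h5⟩ := hg ε hε
  have mψ : MemLp ψ 2 (intervalMeasure β δ) := memLp_of_continuousOn hβ h1.continuous.continuousOn 2
  refine ⟨ψ, mψ, h1, h2, h3, ?_⟩
  have : x = mψ.toLp := Lp.ext (h4.trans mψ.coeFn_toLp.symm)
  rwa [← this, ← dist_eq_norm]

lemma notMem_closure_of_tsupport_subset {χ : ℝ → ℂ} {a : ℝ} (ha : 0 < a)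
    (h : ∀ η, η < a → χ η = 0) : (0 : ℝ) ∉ closure (Function.support χ ∩ Ioo 0 δ) := by
  intro hmem
  have : closure (Function.support χ ∩ Ioo 0 δ) ⊆ Ici a :=
    closure_minimal (fun η hη => not_lt.1 fun hlt => hη.1 (h η hlt)) isClosed_Ici
  exact absurd (this hmem) (by simpa using ha)

/-- A smooth function that vanishes near `0` belongs to the space `H̃¹₀`. -/
lemma memH10_of_contDiff (hβ : ContinuousOn β (Icc 0 δ)) {χ : ℝ → ℂ}
    (hχ : ContDiff ℝ (⊤ : ℕ∞) χ) {a : ℝ} (ha : 0 < a) (h : ∀ η, η < a → χ η = 0) :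
    MemH10 β δ χ (deriv χ) :=
  ⟨memLp_of_continuousOn hβ hχ.continuous.continuousOn 2,
    memLp_of_continuousOn hβ (hχ.continuous_deriv (by simp)).continuousOn 2, fun ε hε =>
    ⟨χ, hχ.contDiffOn, notMem_closure_of_tsupport_subset ha h, by simpa using hε,
      by simpa using hε⟩⟩

/-- The converse of `MemH10.toLp_eq`: test functions with compact support in `(0, δ)` are dense, and
their primitives are smooth and vanish near `0`. -/
lemma memH10_volterra (hβ : ContinuousOn β (Icc 0 δ))
    (hJ : ∀ g, J g =ᵐ[intervalMeasure β δ] fun η => ∫ s in (0 : ℝ)..η, g s) (g : L2i β δ) :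
    MemH10 β δ (J g) g := by
  refine ⟨Lp.memLp _, Lp.memLp _, fun ε hε => ?_⟩
  obtain ⟨ε', hε', hlt⟩ : ∃ ε' : ℝ, 0 < ε' ∧ ENNReal.ofReal ε' ≤ ε := by
    rcases eq_or_ne ε ∞ with rfl | h
    · exact ⟨1, one_pos, le_top⟩
    · exact ⟨ε.toReal, ENNReal.toReal_pos hε.ne' h, by rw [ENNReal.ofReal_toReal h]⟩
  set K : ℝ := 1 + ‖J‖ with hK
  have hKpos : 0 < K := by positivity
  have hK1 : 1 ≤ K := by simp [hK]
  obtain ⟨ψ, mψ, h1, h2, h3, h4⟩ := exists_test_near hβ g (div_pos hε' hKpos)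
  have hder : ∀ η, HasDerivAt (fun η => ∫ s in (0 : ℝ)..η, ψ s) (ψ η) η := fun η =>
    (h1.continuous.integral_hasStrictDerivAt 0 η).hasDerivAt
  have hdd : deriv (fun η => ∫ s in (0 : ℝ)..η, ψ s) = ψ := funext fun η => (hder η).deriv
  have hsm : ContDiff ℝ (⊤ : ℕ∞) fun η => ∫ s in (0 : ℝ)..η, ψ s := by
    rw [contDiff_infty_iff_deriv, hdd]
    exact ⟨fun η => (hder η).differentiableAt, h1⟩
  -- The least point of the compact support is positive; if the support is empty any `a` will do.
  obtain ⟨a, ha, hza⟩ : ∃ a > 0, ∀ η, η < a → ψ η = 0 := by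
    rcases (tsupport ψ).eq_empty_or_nonempty with he | hne
    · refine ⟨1, one_pos, fun η _ => ?_⟩
      rw [tsupport_eq_empty_iff] at he
      simp [he]
    · obtain ⟨a, ha, hmin⟩ := h3.isCompact.exists_isMinOn hne continuousOn_id
      exact ⟨a, (h2 ha).1, fun η hη => image_eq_zero_of_notMem_tsupport fun hm =>
        absurd (hmin hm) (by simpa using hη)⟩
  have hJψ : J mψ.toLp =ᵐ[intervalMeasure β δ] fun η => ∫ s in (0 : ℝ)..η, ψ s := by
    filter_upwards [hJ mψ.toLp, ae_mem_Ioo β δ] with η a2 a3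
    rw [a2, intervalIntegral.integral_of_le a3.1.le, intervalIntegral.integral_of_le a3.1.le,
      integral_Ioc_eq_integral_Ioo, integral_Ioc_eq_integral_Ioo]
    refine integral_congr_ae (ae_restrict_of_ae_restrict_of_subset
      (Ioo_subset_Ioo_right a3.2.le) ?_)
    exact (volume_ac_intervalMeasure hβ).ae_le mψ.coeFn_toLp
  have conv : ∀ {x y : L2i β δ} {w : ℝ → ℂ}, y =ᵐ[intervalMeasure β δ] w → ‖x - y‖ < ε' →
      eLpNorm ((x : ℝ → ℂ) - w) 2 (intervalMeasure β δ) < ε := by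
    intro x y w hw hlt'
    refine lt_of_lt_of_le ?_ hlt
    rw [eLpNorm_congr_ae (g := ((x - y : L2i β δ) : ℝ → ℂ)), ← ENNReal.ofReal_toReal
      (Lp.eLpNorm_ne_top (x - y)), ← Lp.norm_def]
    · exact (ENNReal.ofReal_lt_ofReal_iff hε').2 hlt'
    · filter_upwards [Lp.coeFn_sub x y, hw] with η e1 e2
      rw [e1, Pi.sub_apply, Pi.sub_apply, e2]
  refine ⟨fun η => ∫ s in (0 : ℝ)..η, ψ s, hsm.contDiffOn,
    notMem_closure_of_tsupport_subset ha fun η hη => ?_, conv hJψ ?_, ?_⟩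
  · refine intervalIntegral.integral_zero_ae (ae_of_all _ fun s hs => hza s ?_)
    exact hs.2.trans_lt (max_lt ha hη)
  · rw [← map_sub]
    calc _ ≤ ‖J‖ * ‖g - mψ.toLp‖ := J.le_opNorm _
      _ ≤ ‖J‖ * (ε' / K) := by gcongr
      _ < ε' := by
        rw [mul_div_assoc', div_lt_iff₀ hKpos, hK]
        nlinarith [norm_nonneg J]
  · rw [hdd]
    exact conv mψ.coeFn_toLp (h4.trans_le (div_le_self hε'.le hK1))

end Omega

/-! ### The quotients as `⟨Jg, BJg⟩ / (2‖g‖‖Jg‖)` and their consequences. -/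

section Quotients

variable {β : ℝ → ℝ} {δ : ℝ} {J B : L2i β δ →L[ℂ] L2i β δ}

/-- Multiplication by `β'` on `L₂((0, δ); h)`. -/
lemma exists_mulDeriv_interval (hδ : 0 < δ) (hβ : ContDiffOn ℝ 1 β (Icc 0 δ)) :
    ∃ B : L2i β δ →L[ℂ] L2i β δ, ∀ f,
      B f =ᵐ[intervalMeasure β δ] fun η => ((derivWithin β (Icc 0 δ) η : ℝ) : ℂ) * f η := by
  have hm : MemLp (fun η : ℝ => ((derivWithin β (Icc 0 δ) η : ℝ) : ℂ)) ∞ (intervalMeasure β δ) :=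
    memLp_of_continuousOn hβ.continuousOn
      (Complex.continuous_ofReal.comp_continuousOn (continuousOn_derivWithin hδ hβ)) ∞
  refine ⟨(ContinuousLinearMap.mul ℂ ℂ).holderL (intervalMeasure β δ) ∞ 2 2 hm.toLp, fun f => ?_⟩
  have h := (ContinuousLinearMap.mul ℂ ℂ).coeFn_holder (r := 2) hm.toLp f
  filter_upwards [h, hm.coeFn_toLp] with z h1 h2
  exact h1.trans (by simp [h2])

lemma re_inner_mul (hβ : ContDiffOn ℝ 1 β (Icc 0 δ))
    (hB : ∀ f, B f =ᵐ[intervalMeasure β δ] fun η => ((derivWithin β (Icc 0 δ) η : ℝ) : ℂ) * f η)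
    (f : L2i β δ) : (inner ℂ f (B f)).re
      = ∫ η in Ioo 0 δ, deriv β η * Real.exp (-β η) * ‖f η‖ ^ 2 := by
  rw [inner_L2i hβ.continuousOn]
  have : ∫ η in Ioo 0 δ, ((Real.exp (-β η) : ℝ) : ℂ) * (conj (f η) * B f η)
      = ∫ η in Ioo 0 δ, ((deriv β η * Real.exp (-β η) * ‖f η‖ ^ 2 : ℝ) : ℂ) := by
    refine integral_congr_ae ?_
    filter_upwards [(volume_ac_intervalMeasure hβ.continuousOn).ae_le (hB f),
      ae_restrict_mem measurableSet_Ioo] with η h1 h2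
    rw [h1, derivWithin_eq_deriv h2, mul_left_comm (conj (f η)), mul_comm (conj (f η)),
      Complex.mul_conj, Complex.normSq_eq_norm_sq]
    push_cast
    ring
  rw [this, integral_complex_ofReal, Complex.ofReal_re]

lemma inner_mul_symm (hβ : ContDiffOn ℝ 1 β (Icc 0 δ))
    (hB : ∀ f, B f =ᵐ[intervalMeasure β δ] fun η => ((derivWithin β (Icc 0 δ) η : ℝ) : ℂ) * f η)
    (f g : L2i β δ) : inner ℂ (B f) g = inner ℂ f (B g) := by
  rw [inner_L2i hβ.continuousOn, inner_L2i hβ.continuousOn]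
  refine integral_congr_ae ?_
  filter_upwards [(volume_ac_intervalMeasure hβ.continuousOn).ae_le (hB f),
    (volume_ac_intervalMeasure hβ.continuousOn).ae_le (hB g)] with η h1 h2
  rw [h1, h2, map_mul, Complex.conj_ofReal]
  ring

lemma norm_sq_toLp (hβ : ContinuousOn β (Icc 0 δ)) {f : ℝ → ℂ}
    (hf : MemLp f 2 (intervalMeasure β δ)) :
    ‖hf.toLp‖ ^ 2 = ∫ η in Ioo 0 δ, Real.exp (-β η) * ‖f η‖ ^ 2 := by
  rw [norm_sq_L2i hβ]
  refine integral_congr_ae ?_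
  filter_upwards [(volume_ac_intervalMeasure hβ).ae_le hf.coeFn_toLp] with η h
  rw [h]

lemma re_inner_mul_toLp (hβ : ContDiffOn ℝ 1 β (Icc 0 δ))
    (hB : ∀ f, B f =ᵐ[intervalMeasure β δ] fun η => ((derivWithin β (Icc 0 δ) η : ℝ) : ℂ) * f η)
    {f : ℝ → ℂ} (hf : MemLp f 2 (intervalMeasure β δ)) : (inner ℂ hf.toLp (B hf.toLp)).re
      = ∫ η in Ioo 0 δ, deriv β η * Real.exp (-β η) * ‖f η‖ ^ 2 := by
  rw [re_inner_mul hβ hB]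
  refine integral_congr_ae ?_
  filter_upwards [(volume_ac_intervalMeasure hβ.continuousOn).ae_le hf.coeFn_toLp] with η h
  rw [h]

/-- The quotients in terms of the integration operator. -/
lemma quotients_eq (hβ : ContDiffOn ℝ 1 β (Icc 0 δ))
    (hJ : ∀ g, J g =ᵐ[intervalMeasure β δ] fun η => ∫ s in (0 : ℝ)..η, g s)
    (hB : ∀ f, B f =ᵐ[intervalMeasure β δ] fun η => ((derivWithin β (Icc 0 δ) η : ℝ) : ℂ) * f η) :
    quotients β δ = {r | ∃ g : L2i β δ, J g ≠ 0 ∧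
      r = 1 / 2 * (inner ℂ (J g) (B (J g))).re / (‖g‖ * ‖J g‖)} := by
  have hβc := hβ.continuousOn
  have key : ∀ {φ φ' : ℝ → ℂ} (h : MemH10 β δ φ φ'),
      ((1 / 2) * ∫ η in Ioo 0 δ, deriv β η * Real.exp (-β η) * ‖φ η‖ ^ 2) /
      √((∫ η in Ioo 0 δ, Real.exp (-β η) * ‖φ' η‖ ^ 2) *
        ∫ η in Ioo 0 δ, Real.exp (-β η) * ‖φ η‖ ^ 2)
      = 1 / 2 * (inner ℂ (h.1.toLp : L2i β δ) (B h.1.toLp)).re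
        / (‖(h.2.1.toLp : L2i β δ)‖ * ‖(h.1.toLp : L2i β δ)‖) := by
    intro φ φ' h
    rw [re_inner_mul_toLp hβ hB, ← norm_sq_toLp hβc h.1, ← norm_sq_toLp hβc h.2.1, ← mul_pow,
      Real.sqrt_sq (by positivity)]
  ext r
  constructor
  · rintro ⟨φ, φ', h, hne, rfl⟩
    refine ⟨h.2.1.toLp, ?_, ?_⟩
    · rw [← h.toLp_eq hβc hJ]
      intro h0
      refine hne ((volume_ac_intervalMeasure hβc).ae_le ?_)
      exact (MemLp.toLp_eq_toLp_iff h.1 MemLp.zero).1 (by rw [h0]; exact (MemLp.toLp_zero _).symm)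
    · rw [key h, h.toLp_eq hβc hJ]
  · rintro ⟨g, hne, rfl⟩
    have h := memH10_volterra hβc hJ g
    refine ⟨J g, g, h, ?_, ?_⟩
    · intro h0
      refine hne (Lp.ext ?_)
      filter_upwards [(intervalMeasure_ac β δ).ae_le h0,
        Lp.coeFn_zero ℂ 2 (intervalMeasure β δ)] with η h1 h2
      rw [h1, h2]
    · rw [key h, Lp.toLp_coeFn, Lp.toLp_coeFn]

/-- Cauchy-Schwarz together with the operator norms: `⟨Jg, BJg⟩ ≤ ‖B‖ ‖Jg‖²`, and one factor `‖Jg‖`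
is at most `‖J‖ ‖g‖`. -/
lemma bddAbove_quotients (hβ : ContDiffOn ℝ 1 β (Icc 0 δ))
    (hJ : ∀ g, J g =ᵐ[intervalMeasure β δ] fun η => ∫ s in (0 : ℝ)..η, g s)
    (hB : ∀ f, B f =ᵐ[intervalMeasure β δ] fun η => ((derivWithin β (Icc 0 δ) η : ℝ) : ℂ) * f η) :
    BddAbove (quotients β δ) := by
  rw [quotients_eq hβ hJ hB]
  refine ⟨1 / 2 * (‖B‖ * ‖J‖), ?_⟩
  rintro r ⟨g, -, rfl⟩
  refine div_le_of_le_mul₀ (by positivity) (by positivity) ?_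
  have h1 : (inner ℂ (J g) (B (J g))).re ≤ ‖J g‖ * ‖B (J g)‖ :=
    (Complex.re_le_norm _).trans (norm_inner_le_norm _ _)
  have h2 := B.le_opNorm (J g)
  have h3 := J.le_opNorm g
  have : (inner ℂ (J g) (B (J g))).re ≤ ‖B‖ * ‖J‖ * (‖g‖ * ‖J g‖) :=
    calc _ ≤ ‖J g‖ * (‖B‖ * (‖J‖ * ‖g‖)) := h1.trans (by gcongr; exact h2.trans (by gcongr))
      _ = _ := by ring
  linarith

lemma isLUB_omegaStar (hδ : 0 < δ) (hβ : ContDiffOn ℝ 1 β (Icc 0 δ))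
    (hβ' : ∀ η ∈ Ioo 0 δ, 0 < deriv β η) :
    IsLUB (quotients β δ) (omegaStar β δ) ∧ 0 < omegaStar β δ := by
  have hβc := hβ.continuousOn
  have := Fact.mk hβc
  obtain ⟨J, -, hJ⟩ := exists_volterra hδ hβc
  obtain ⟨B, hB⟩ := exists_mulDeriv_interval hδ hβ
  have hbdd := bddAbove_quotients hβ hJ hB
  -- Positivity is tested on `g = 1`, that is, on `φ(η) = η`.
  have m1 : MemLp (fun _ : ℝ => (1 : ℂ)) 2 (intervalMeasure β δ) := memLp_const 1
  set g : L2i β δ := m1.toLp with hg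
  have hJg : J g =ᵐ[intervalMeasure β δ] fun η => (η : ℂ) := by
    filter_upwards [hJ g, ae_mem_Ioo β δ] with η a2 a3
    rw [a2, intervalIntegral.integral_of_le a3.1.le, integral_Ioc_eq_integral_Ioo]
    have : ∫ s in Ioo 0 η, g s = ∫ s in Ioo 0 η, (1 : ℂ) :=
      integral_congr_ae (ae_restrict_of_ae_restrict_of_subset (Ioo_subset_Ioo_right a3.2.le)
        ((volume_ac_intervalMeasure hβc).ae_le m1.coeFn_toLp))
    rw [this]
    simp [measureReal_restrict_apply MeasurableSet.univ, Real.volume_real_Ioo_of_le a3.1.le]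
  have hpos : 0 < (inner ℂ (J g) (B (J g))).re := by
    rw [re_inner_mul hβ hB]
    have e : ∫ η in Ioo 0 δ, deriv β η * Real.exp (-β η) * ‖J g η‖ ^ 2
        = ∫ η in Ioo 0 δ, derivWithin β (Icc 0 δ) η * Real.exp (-β η) * η ^ 2 := by
      refine integral_congr_ae ?_
      filter_upwards [(volume_ac_intervalMeasure hβc).ae_le hJg,
        ae_restrict_mem measurableSet_Ioo] with η h1 h2
      rw [h1, derivWithin_eq_deriv h2]
      simp
    rw [e, ← integral_Ioc_eq_integral_Ioo, ← intervalIntegral.integral_of_le hδ.le]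
    have hc : ContinuousOn (fun η => derivWithin β (Icc 0 δ) η * Real.exp (-β η) * η ^ 2)
        (Icc 0 δ) :=
      ((continuousOn_derivWithin hδ hβ).mul (continuousOn_exp_neg hβc)).mul (by fun_prop)
    refine intervalIntegral.intervalIntegral_pos_of_pos_on ?_ (fun η hη => ?_) hδ
    · exact ContinuousOn.intervalIntegrable (by rwa [uIcc_of_le hδ.le])
    · rw [derivWithin_eq_deriv hη]
      have := hβ' η hη
      have := hη.1
      positivity
  have hne : J g ≠ 0 := by
    intro h
    rw [h, inner_zero_left] at hpos
    simp at hpos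
  have hg0 : g ≠ 0 := fun h => hne (by rw [h, map_zero])
  have hmem : 1 / 2 * (inner ℂ (J g) (B (J g))).re / (‖g‖ * ‖J g‖) ∈ quotients β δ := by
    rw [quotients_eq hβ hJ hB]
    exact ⟨g, hne, rfl⟩
  refine ⟨isLUB_csSup ⟨_, hmem⟩ hbdd, lt_of_lt_of_le ?_ (le_csSup hbdd hmem)⟩
  have := norm_pos_iff.2 hne
  have := norm_pos_iff.2 hg0
  positivity

lemma re_inner_le_omegaStar (hβ : ContDiffOn ℝ 1 β (Icc 0 δ))
    (hJ : ∀ g, J g =ᵐ[intervalMeasure β δ] fun η => ∫ s in (0 : ℝ)..η, g s)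
    (hB : ∀ f, B f =ᵐ[intervalMeasure β δ] fun η => ((derivWithin β (Icc 0 δ) η : ℝ) : ℂ) * f η)
    (g : L2i β δ) :
    (inner ℂ (J g) (B (J g))).re ≤ 2 * omegaStar β δ * (‖g‖ * ‖J g‖) := by
  rcases eq_or_ne (J g) 0 with h | h
  · simp [h]
  · have hg0 : g ≠ 0 := fun h' => h (by rw [h', map_zero])
    have h1 := norm_pos_iff.2 h
    have h2 := norm_pos_iff.2 hg0
    have h3 : 1 / 2 * (inner ℂ (J g) (B (J g))).re / (‖g‖ * ‖J g‖) ≤ omegaStar β δ := by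
      refine le_csSup (bddAbove_quotients hβ hJ hB) ?_
      rw [quotients_eq hβ hJ hB]
      exact ⟨g, h, rfl⟩
    rw [div_le_iff₀ (by positivity)] at h3
    linarith

/-- The variational inequality for smooth functions that vanish near `0`. -/
lemma integral_le_omegaStar (hδ : 0 < δ) (hβ : ContDiffOn ℝ 1 β (Icc 0 δ)) {φ φ' : ℝ → ℂ}
    (h : MemH10 β δ φ φ') (k : ℝ) (hΩ : 0 ≤ omegaStar β δ) :
    |k| * ∫ η in Ioo 0 δ, deriv β η * Real.exp (-β η) * ‖φ η‖ ^ 2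
      ≤ omegaStar β δ * ((∫ η in Ioo 0 δ, Real.exp (-β η) * ‖φ' η‖ ^ 2)
        + k ^ 2 * ∫ η in Ioo 0 δ, Real.exp (-β η) * ‖φ η‖ ^ 2) := by
  obtain ⟨J, -, hJ⟩ := exists_volterra hδ hβ.continuousOn
  obtain ⟨B, hB⟩ := exists_mulDeriv_interval hδ hβ
  have h1 := re_inner_le_omegaStar hβ hJ hB h.2.1.toLp
  rw [← h.toLp_eq hβ.continuousOn hJ, re_inner_mul_toLp hβ hB] at h1
  rw [← norm_sq_toLp hβ.continuousOn h.1, ← norm_sq_toLp hβ.continuousOn h.2.1]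
  set a := ‖(h.2.1.toLp : L2i β δ)‖
  set b := ‖(h.1.toLp : L2i β δ)‖
  calc _ ≤ |k| * (2 * omegaStar β δ * (a * b)) := by gcongr
    _ ≤ _ := by
      -- The inequality `2xy ≤ x² + y²` replaces the product in the quotient by the energy at wave
      -- number `k`.
      have : 2 * (a * (|k| * b)) ≤ a ^ 2 + k ^ 2 * b ^ 2 := by
        rw [← sq_abs k]
        nlinarith [sq_nonneg (a - |k| * b)]
      nlinarith [mul_le_mul_of_nonneg_left this hΩ]

/-- Poincaré inequality on the interval. -/
lemma exists_poincare (hδ : 0 < δ) (hβ : ContinuousOn β (Icc 0 δ)) :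
    ∃ C : ℝ, 0 < C ∧ ∀ φ φ' : ℝ → ℂ, MemH10 β δ φ φ' →
      ∫ η in Ioo 0 δ, Real.exp (-β η) * ‖φ η‖ ^ 2
        ≤ C * ∫ η in Ioo 0 δ, Real.exp (-β η) * ‖φ' η‖ ^ 2 := by
  obtain ⟨J, -, hJ⟩ := exists_volterra hδ hβ
  refine ⟨(‖J‖ + 1) ^ 2, by positivity, fun φ φ' h => ?_⟩
  rw [← norm_sq_toLp hβ h.1, ← norm_sq_toLp hβ h.2.1, ← mul_pow, h.toLp_eq hβ hJ]
  gcongr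
  refine (J.le_opNorm _).trans ?_
  gcongr
  linarith

end Quotients

/-! ### A quadratic eigenvalue problem with compact operators -/

section Pencil

variable {H : Type*} [NormedAddCommGroup H] [InnerProductSpace ℂ H]

/-- Positivity is applied to `g - Tg / ‖T‖`. The estimate makes near-minimizers of a nonnegative
form into approximate kernel vectors. -/
lemma norm_sq_le_of_nonneg {T : H →L[ℂ] H} (hT : ∀ x y, inner ℂ (T x) y = inner ℂ x (T y))
    (hpos : ∀ x, 0 ≤ (inner ℂ x (T x)).re) (g : H) :
    ‖T g‖ ^ 2 ≤ ‖T‖ * (inner ℂ g (T g)).re := by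
  rcases eq_or_ne T 0 with rfl | h
  · simp
  set n := ‖T‖ with hn
  have hn0 : 0 < n := norm_pos_iff.2 h
  have h1 := hpos (g - ((1 / n : ℝ) : ℂ) • T g)
  have h2 : (inner ℂ (T g) (T (T g))).re ≤ n * ‖T g‖ ^ 2 :=
    calc _ ≤ ‖T g‖ * ‖T (T g)‖ := (Complex.re_le_norm _).trans (norm_inner_le_norm _ _)
      _ ≤ ‖T g‖ * (n * ‖T g‖) := by gcongr; exact T.le_opNorm _
      _ = _ := by ring
  have h3 : (inner ℂ (T g) (T g)).re = ‖T g‖ ^ 2 := inner_self_eq_norm_sq (𝕜 := ℂ) (T g)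
  have h4 : (inner ℂ g (T (T g))).re = ‖T g‖ ^ 2 := by rw [← hT, h3]
  rw [map_sub, map_smul, inner_sub_left, inner_sub_right, inner_sub_right, inner_smul_left,
    inner_smul_left, inner_smul_right, inner_smul_right, Complex.conj_ofReal] at h1
  simp only [Complex.sub_re, Complex.re_ofReal_mul, h3, h4] at h1
  have h5 : (1 / n) * ((1 / n) * (inner ℂ (T g) (T (T g))).re) ≤ 1 / n * ‖T g‖ ^ 2 := by
    gcongr
    rw [one_div_mul_eq_div, div_le_iff₀ hn0]
    linarith
  have h6 : 1 / n * ‖T g‖ ^ 2 ≤ (inner ℂ g (T g)).re := by linarith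
  rw [one_div_mul_eq_div, div_le_iff₀ hn0] at h6
  linarith

variable [CompleteSpace H]

/-- The operator `ω + J*(ωk² - kB)J`. -/
def quadPencil (J B : H →L[ℂ] H) (ω k : ℝ) : H →L[ℂ] H :=
  (ω : ℂ) • 1 - (ContinuousLinearMap.adjoint J) ∘L
    (((k : ℂ) • B - ((ω * k ^ 2 : ℝ) : ℂ) • 1) ∘L J)

lemma inner_quadPencil (J B : H →L[ℂ] H) (ω k : ℝ) (x y : H) :
    inner ℂ x (quadPencil J B ω k y) = ω * inner ℂ x y + (ω * k ^ 2) * inner ℂ (J x) (J y)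
      - k * inner ℂ (J x) (B (J y)) := by
  change inner ℂ x ((ω : ℂ) • y - ContinuousLinearMap.adjoint J
    ((k : ℂ) • B (J y) - ((ω * k ^ 2 : ℝ) : ℂ) • J y)) = _
  rw [inner_sub_right, ContinuousLinearMap.adjoint_inner_right, inner_sub_right, inner_smul_right,
    inner_smul_right, inner_smul_right]
  push_cast
  ring

lemma quadPencil_symm {J B : H →L[ℂ] H} (hB : ∀ x y, inner ℂ (B x) y = inner ℂ x (B y))
    (ω k : ℝ) (x y : H) :
    inner ℂ (quadPencil J B ω k x) y = inner ℂ x (quadPencil J B ω k y) := by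
  rw [← inner_conj_symm, inner_quadPencil, inner_quadPencil]
  simp only [map_sub, map_add, map_mul, inner_conj_symm, Complex.conj_ofReal, hB, map_pow]

lemma re_inner_quadPencil (J B : H →L[ℂ] H) (ω k : ℝ) (x : H) :
    (inner ℂ x (quadPencil J B ω k x)).re = ω * ‖x‖ ^ 2 + ω * k ^ 2 * ‖J x‖ ^ 2
      - k * (inner ℂ (J x) (B (J x))).re := by
  have h1 : (inner ℂ x x).re = ‖x‖ ^ 2 := inner_self_eq_norm_sq (𝕜 := ℂ) x
  have h2 : (inner ℂ (J x) (J x)).re = ‖J x‖ ^ 2 := inner_self_eq_norm_sq (𝕜 := ℂ) (J x)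
  rw [inner_quadPencil, ← h1, ← h2, Complex.sub_re, Complex.add_re, Complex.re_ofReal_mul,
    Complex.re_ofReal_mul, show (ω : ℂ) * (k : ℂ) ^ 2 = ((ω * k ^ 2 : ℝ) : ℂ) by push_cast; ring,
    Complex.re_ofReal_mul]

/-- The bottom `Λ(k)` of the form moves continuously from a positive value at `k = 0` to a
nonpositive one, so it is zero at some `k`. Since the operator there is `ω` minus a compact one, a
zero bottom is attained. Allowing every `ε > 0` in the hypothesis includes the endpoint `ω = Ω_*`,
whether or not the supremum is attained. -/
theorem exists_quadPencil_eq_zero {J B : H →L[ℂ] H} (hJ : IsCompactOperator J)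
    (hB : ∀ x y, inner ℂ (B x) y = inner ℂ x (B y)) {ω : ℝ} (hω : 0 < ω)
    (h : ∀ ε > 0, ∃ g, J g ≠ 0 ∧
      2 * (ω - ε) * (‖g‖ * ‖J g‖) ≤ (inner ℂ (J g) (B (J g))).re) :
    ∃ (k : ℝ) (g : H), g ≠ 0 ∧ quadPencil J B ω k g = 0 := by
  set q : ℝ → H → ℝ := fun k g => (inner ℂ g (quadPencil J B ω k g)).re with hq
  set m : H → ℝ := fun g => (inner ℂ (J g) (B (J g))).re with hm
  have hqe : ∀ k g, q k g = ω * ‖g‖ ^ 2 + ω * k ^ 2 * ‖J g‖ ^ 2 - k * m g := fun k g =>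
    re_inner_quadPencil J B ω k g
  have hsmul : ∀ k (c : ℝ) g, q k ((c : ℂ) • g) = c ^ 2 * q k g := by
    intro k c g
    simp only [hq, map_smul, inner_smul_left, inner_smul_right, Complex.conj_ofReal,
      Complex.re_ofReal_mul]
    ring
  have hmb : ∀ g, |m g| ≤ ‖B‖ * ‖J g‖ ^ 2 := fun g =>
    calc |m g| ≤ ‖J g‖ * ‖B (J g)‖ := (Complex.abs_re_le_norm _).trans (norm_inner_le_norm _ _)
      _ ≤ ‖J g‖ * (‖B‖ * ‖J g‖) := by gcongr; exact B.le_opNorm _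
      _ = _ := by ring
  have hJb : ∀ g : H, ‖g‖ = 1 → ‖J g‖ ≤ ‖J‖ := fun g hg => by
    simpa [hg] using J.le_opNorm g
  obtain ⟨g₀, hg₀, -⟩ := h 1 one_pos
  have hg₀' : g₀ ≠ 0 := fun h' => hg₀ (by rw [h', map_zero])
  -- normalization
  have hunit : ∀ g : H, g ≠ 0 → ∀ k, ∃ u : H, ‖u‖ = 1 ∧ q k u * ‖g‖ ^ 2 = q k g := by
    intro g hg k
    have hn := norm_pos_iff.2 hg
    refine ⟨(((‖g‖⁻¹ : ℝ)) : ℂ) • g, ?_, ?_⟩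
    · rw [norm_smul, Complex.norm_real, Real.norm_eq_abs, abs_of_pos (inv_pos.2 hn),
        inv_mul_cancel₀ hn.ne']
    · rw [hsmul]
      field_simp
  set Λ : ℝ → ℝ := fun k => sInf (q k '' Metric.sphere 0 1) with hΛ
  have hne : ∀ k, (q k '' Metric.sphere 0 1).Nonempty := by
    intro k
    obtain ⟨u, hu, -⟩ := hunit g₀ hg₀' k
    exact ⟨_, u, by simpa using hu, rfl⟩
  have hbdd : ∀ k, BddBelow (q k '' Metric.sphere 0 1) := by
    intro k
    refine ⟨-(|k| * (‖B‖ * ‖J‖ ^ 2)), ?_⟩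
    rintro _ ⟨g, hg, rfl⟩
    have hg1 : ‖g‖ = 1 := by simpa using hg
    rw [hqe]
    have h1 : k * m g ≤ |k| * (‖B‖ * ‖J‖ ^ 2) :=
      calc k * m g ≤ |k| * |m g| := by rw [← abs_mul]; exact le_abs_self _
        _ ≤ |k| * (‖B‖ * ‖J g‖ ^ 2) := by gcongr; exact hmb g
        _ ≤ _ := by gcongr; exact hJb g hg1
    have h2 : 0 ≤ ω * ‖g‖ ^ 2 + ω * k ^ 2 * ‖J g‖ ^ 2 := by positivity
    linarith
  have hΛle : ∀ k g, ‖g‖ = 1 → Λ k ≤ q k g := fun k g hg =>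
    csInf_le (hbdd k) ⟨g, by simpa using hg, rfl⟩
  have hcont : Continuous Λ := by
    -- A modulus of continuity of `k ↦ q k g` that is uniform over the unit sphere passes to the
    -- infimum.
    set D : ℝ → ℝ → ℝ := fun k k' => ω * |k ^ 2 - k' ^ 2| * ‖J‖ ^ 2
      + |k - k'| * (‖B‖ * ‖J‖ ^ 2) with hD
    have h1 : ∀ k k', Λ k ≤ Λ k' + D k k' := by
      intro k k'
      rw [← sub_le_iff_le_add]
      refine le_csInf (hne k') ?_
      rintro _ ⟨g, hg, rfl⟩
      have hg1 : ‖g‖ = 1 := by simpa using hg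
      have h2 := hΛle k g hg1
      have e : q k g - q k' g = ω * (k ^ 2 - k' ^ 2) * ‖J g‖ ^ 2 - (k - k') * m g := by
        rw [hqe, hqe]; ring
      have h3 : ω * (k ^ 2 - k' ^ 2) * ‖J g‖ ^ 2 ≤ ω * |k ^ 2 - k' ^ 2| * ‖J‖ ^ 2 :=
        calc _ ≤ ω * |k ^ 2 - k' ^ 2| * ‖J g‖ ^ 2 := by gcongr; exact le_abs_self _
          _ ≤ _ := by gcongr; exact hJb g hg1
      have h4 : -((k - k') * m g) ≤ |k - k'| * (‖B‖ * ‖J‖ ^ 2) :=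
        calc _ ≤ |k - k'| * |m g| := by rw [← abs_mul]; exact neg_le_abs _
          _ ≤ |k - k'| * (‖B‖ * ‖J g‖ ^ 2) := by gcongr; exact hmb g
          _ ≤ _ := by gcongr; exact hJb g hg1
      simp only [hD]
      linarith
    have hDsymm : ∀ k k', D k k' = D k' k := by
      intro k k'
      simp only [hD, abs_sub_comm k k', abs_sub_comm (k ^ 2)]
    rw [continuous_iff_continuousAt]
    intro k
    have hD0 : Tendsto (fun k' => D k' k) (𝓝 k) (𝓝 0) := by
      have : Continuous fun k' => D k' k := by fun_prop
      have h5 := this.tendsto k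
      simpa [hD] using h5
    rw [ContinuousAt, tendsto_iff_norm_sub_tendsto_zero]
    refine squeeze_zero (fun _ => norm_nonneg _) (fun k' => ?_) hD0
    rw [Real.norm_eq_abs, abs_le]
    have := h1 k' k
    have := h1 k k'
    rw [hDsymm] at this
    constructor <;> linarith
  have hΛ0 : 0 < Λ 0 := by
    refine hω.trans_le (le_csInf (hne 0) ?_)
    rintro _ ⟨g, hg, rfl⟩
    have hg1 : ‖g‖ = 1 := by simpa using hg
    rw [hqe, hg1]
    simp
  -- the wave number stays in a bounded interval
  set K : ℝ := ‖B‖ / ω with hK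
  have hK0 : 0 ≤ K := by positivity
  have hlarge : ∀ k, K ≤ k → ∀ g, ‖g‖ = 1 → ω ≤ q k g := by
    intro k hk g hg
    have hk0 := hK0.trans hk
    rw [hqe, hg]
    have h1 : k * m g ≤ k * (‖B‖ * ‖J g‖ ^ 2) := by
      gcongr
      exact (le_abs_self _).trans (hmb g)
    rw [hK, div_le_iff₀ hω] at hk
    have h2 : k * (‖B‖ * ‖J g‖ ^ 2) ≤ k * (k * ω * ‖J g‖ ^ 2) := by gcongr
    linarith
  have hsmall : ∀ ε, 0 < ε → 2 * ε < ω → ∃ k ∈ Icc 0 K, Λ k ≤ 2 * ε := by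
    intro ε hε hεω
    obtain ⟨g, hg, hgm⟩ := h ε hε
    have hg' : g ≠ 0 := fun h' => hg (by rw [h', map_zero])
    have ha := norm_pos_iff.2 hg'
    have hb := norm_pos_iff.2 hg
    -- This wave number makes the two positive terms of the form equal, so `q k g = 2ω‖g‖² - k ⟨Jg,
    -- BJg⟩ ≤ 2ε‖g‖²`.
    set k := ‖g‖ / ‖J g‖ with hk
    have hk0 : 0 ≤ k := by positivity
    obtain ⟨u, hu1, hu2⟩ := hunit g hg' k
    have h1 : q k g ≤ 2 * ε * ‖g‖ ^ 2 := by
      rw [hqe]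
      have h2 : k * (2 * (ω - ε) * (‖g‖ * ‖J g‖)) ≤ k * m g := by gcongr
      have h3 : k * (2 * (ω - ε) * (‖g‖ * ‖J g‖)) = 2 * (ω - ε) * ‖g‖ ^ 2 := by
        rw [hk]; field_simp
      have h4 : ω * k ^ 2 * ‖J g‖ ^ 2 = ω * ‖g‖ ^ 2 := by
        rw [hk]; field_simp
      rw [h4]
      linarith
    rw [← hu2] at h1
    have h5 : q k u ≤ 2 * ε := le_of_mul_le_mul_right h1 (by positivity)
    refine ⟨k, ⟨hk0, ?_⟩, (hΛle k u hu1).trans h5⟩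
    by_contra hlt
    have := hlarge k (not_le.1 hlt).le u hu1
    linarith
  obtain ⟨k₁, hk₁, hmin⟩ := isCompact_Icc.exists_isMinOn (nonempty_Icc.2 hK0) hcont.continuousOn
  have hk₁0 : Λ k₁ ≤ 0 := by
    by_contra hlt
    rw [not_le] at hlt
    -- With this `ε` the number `2ε` lies below both `ω` and the supposed positive minimum `Λ k₁`.
    obtain ⟨k, hk, hle⟩ := hsmall (min (Λ k₁) ω / 4) (by have := lt_min hlt hω; positivity)
      (by have := min_le_right (Λ k₁) ω; linarith)
    have h1 : Λ k₁ ≤ Λ k := hmin hk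
    have := min_le_left (Λ k₁) ω
    linarith
  obtain ⟨k, -, hk⟩ := intermediate_value_Icc' hk₁.1 hcont.continuousOn
    (show (0 : ℝ) ∈ Icc (Λ k₁) (Λ 0) from ⟨hk₁0, hΛ0.le⟩)
  have hnonneg : ∀ g, 0 ≤ q k g := by
    intro g
    rcases eq_or_ne g 0 with rfl | hg
    · simp [hq]
    · obtain ⟨u, hu1, hu2⟩ := hunit g hg k
      rw [← hu2]
      have := hΛle k u hu1
      rw [hk] at this
      positivity
  set T := quadPencil J B ω k with hT
  set C : H →L[ℂ] H := (ContinuousLinearMap.adjoint J) ∘L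
    (((k : ℂ) • B - ((ω * k ^ 2 : ℝ) : ℂ) • 1) ∘L J) with hC
  have hTC : C - (ω : ℂ) • 1 = -T := by
    simp only [hT, quadPencil, hC]
    abel
  have hCc : IsCompactOperator C := by
    have := (hJ.clm_comp ((k : ℂ) • B - ((ω * k ^ 2 : ℝ) : ℂ) • 1)).clm_comp
      (ContinuousLinearMap.adjoint J)
    exact this
  have hev : Module.End.HasEigenvalue (C : Module.End ℂ H) (ω : ℂ) := by
    by_contra hcon
    -- Fredholm alternative: if `ω` were not an eigenvalue of the compact `C`, then `T = ω - C`
    -- would be bounded below. By `norm_sq_le_of_nonneg` its form would be too, against `Λ k = 0`.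
    obtain ⟨A, hA⟩ := hCc.antilipschitz_of_not_hasEigenvalue (by exact_mod_cast hω.ne') hcon
    rw [hTC] at hA
    have hlow : ∀ g, ‖g‖ = 1 → 1 ≤ A ^ 2 * (‖T‖ * q k g) := by
      intro g hg
      have h1 := hA.le_mul_dist g 0
      rw [dist_zero_right, map_zero, dist_zero_right, hg, neg_apply, norm_neg] at h1
      have h2 := norm_sq_le_of_nonneg (quadPencil_symm hB ω k) hnonneg g
      calc (1 : ℝ) = 1 ^ 2 := by norm_num
        _ ≤ (A * ‖T g‖) ^ 2 := by gcongr
        _ = A ^ 2 * ‖T g‖ ^ 2 := by ring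
        _ ≤ _ := by gcongr
    have hpos : 0 < (A : ℝ) ^ 2 * ‖T‖ + 1 := by positivity
    have : 1 / ((A : ℝ) ^ 2 * ‖T‖ + 1) ≤ Λ k := by
      refine le_csInf (hne k) ?_
      rintro _ ⟨g, hg, rfl⟩
      have h1 := hlow g (by simpa using hg)
      rw [div_le_iff₀ hpos]
      have := hnonneg g
      linarith
    rw [hk] at this
    have := (one_div_pos.2 hpos).trans_le this
    exact lt_irrefl _ this
  obtain ⟨g, hg⟩ := hev.exists_hasEigenvector
  refine ⟨k, g, hg.2, ?_⟩
  have h1 : C g = (ω : ℂ) • g := hg.apply_eq_smul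
  change (ω : ℂ) • g - C g = 0
  rw [h1, sub_self]

end Pencil

/-! ### Modes of the strip -/

section Modes

variable {β : ℝ → ℝ} {δ : ℝ}

/-- `e^{ikξ} φ₀(η)` solves the boundary value problem with spectral parameter `ω`, and
`φ₁ = φ₀'`, `φ₂ = φ₀''`. -/
structure IsMode (β : ℝ → ℝ) (δ ω k : ℝ) (φ₀ φ₁ φ₂ : ℝ → ℂ) : Prop where
  continuousOn₀ : ContinuousOn φ₀ (Icc 0 δ)
  continuousOn₁ : ContinuousOn φ₁ (Icc 0 δ)
  continuousOn₂ : ContinuousOn φ₂ (Icc 0 δ)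
  hasDerivAt₀ : ∀ η ∈ Ioo 0 δ, HasDerivAt φ₀ (φ₁ η) η
  hasDerivAt₁ : ∀ η ∈ Ioo 0 δ, HasDerivAt φ₁ (φ₂ η) η
  lower : φ₀ 0 = 0
  upper : φ₁ δ = 0
  ne_zero : ∃ η ∈ Ioo 0 δ, φ₀ η ≠ 0
  eqn : ∀ η ∈ Ioo 0 δ, (ω : ℂ) * ((k : ℂ) ^ 2 * φ₀ η - φ₂ η + ((deriv β η : ℝ) : ℂ) * φ₁ η)
    = (k : ℂ) * ((deriv β η : ℝ) : ℂ) * φ₀ η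

lemma hasDerivAt_primitive {f : ℝ → ℂ} (hf : ContinuousOn f (Icc 0 δ)) {η : ℝ}
    (hη : η ∈ Ioo 0 δ) : HasDerivAt (fun η => ∫ s in (0 : ℝ)..η, f s) (f η) η := by
  refine intervalIntegral.integral_hasDerivAt_right ?_ ?_
    (hf.continuousAt (Icc_mem_nhds hη.1 hη.2))
  · refine ContinuousOn.intervalIntegrable (hf.mono ?_)
    rw [uIcc_of_le hη.1.le]
    exact Icc_subset_Icc_right hη.2.le
  · exact (hf.mono Ioo_subset_Icc_self).stronglyMeasurableAtFilter isOpen_Ioo η hη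

lemma hasDerivAt_exp (hβ : ContDiffOn ℝ 1 β (Icc 0 δ)) {η : ℝ} (hη : η ∈ Ioo 0 δ) :
    HasDerivAt (fun η => Real.exp (β η)) (Real.exp (β η) * derivWithin β (Icc 0 δ) η) η :=
  (hasDerivAt_derivWithin hβ hη).exp

/-- A kernel vector `g` of the quadratic pencil is the derivative of the mode. Regularity comes from
the once-integrated equation, which expresses `g` through an integral of continuous functions. -/
lemma exists_isMode_of_pos (hδ : 0 < δ) (hβ : ContDiffOn ℝ 1 β (Icc 0 δ))
    (hβ' : ∀ η ∈ Ioo 0 δ, 0 < deriv β η) {ω : ℝ} (hω : 0 < ω) (hωΩ : ω ≤ omegaStar β δ) :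
    ∃ k φ₀ φ₁ φ₂, IsMode β δ ω k φ₀ φ₁ φ₂ := by
  have hβc := hβ.continuousOn
  obtain ⟨J, hJc, hJ⟩ := exists_volterra hδ hβc
  obtain ⟨B, hB⟩ := exists_mulDeriv_interval hδ hβ
  have hQne : (quotients β δ).Nonempty := by
    by_contra hcon
    have := (isLUB_omegaStar hδ hβ hβ').2
    rw [omegaStar, not_nonempty_iff_eq_empty.1 hcon, Real.sSup_empty] at this
    exact lt_irrefl _ this
  obtain ⟨k, g, hg, hT⟩ := exists_quadPencil_eq_zero hJc (inner_mul_symm hβ hB) hω (by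
    intro ε hε
    obtain ⟨r, hr, hlt⟩ := exists_lt_of_lt_csSup hQne
      (show omegaStar β δ - ε < sSup (quotients β δ) from sub_lt_self _ hε)
    rw [quotients_eq hβ hJ hB] at hr
    obtain ⟨g, hg, rfl⟩ := hr
    have hg' : g ≠ 0 := fun h' => hg (by rw [h', map_zero])
    have := norm_pos_iff.2 hg'
    have := norm_pos_iff.2 hg
    rw [lt_div_iff₀ (by positivity)] at hlt
    refine ⟨g, hg, ?_⟩
    have h2 : (ω - ε) * (‖g‖ * ‖J g‖) ≤ (omegaStar β δ - ε) * (‖g‖ * ‖J g‖) := by gcongr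
    linarith)
  -- the function and the right-hand side of its equation
  set φ₀ : ℝ → ℂ := fun η => ∫ s in (0 : ℝ)..η, g s with hφ₀
  have c0 : ContinuousOn φ₀ (Icc 0 δ) := continuousOn_primitive hβc (Lp.memLp g)
  have cβ := continuousOn_derivWithin hδ hβ
  set u : ℝ → ℂ := fun η =>
    ((ω * k ^ 2 - k * derivWithin β (Icc 0 δ) η : ℝ) : ℂ) * φ₀ η with hu
  have cu : ContinuousOn u (Icc 0 δ) :=
    (Complex.continuous_ofReal.comp_continuousOn
      (continuousOn_const.sub (continuousOn_const.mul cβ))).mul c0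
  have cw : ContinuousOn (fun η => ((Real.exp (-β η) : ℝ) : ℂ)) (Icc 0 δ) :=
    Complex.continuous_ofReal.comp_continuousOn (continuousOn_exp_neg hβc)
  have cE : ContinuousOn (fun η => ((Real.exp (β η) : ℝ) : ℂ)) (Icc 0 δ) :=
    Complex.continuous_ofReal.comp_continuousOn (continuousOn_exp hβc)
  set w : ℝ → ℂ := fun η => ((Real.exp (-β η) : ℝ) : ℂ) * u η with hw
  have cwu : ContinuousOn w (Icc 0 δ) := cw.mul cu
  have mw : MemLp w 2 (intervalMeasure β δ) := memLp_of_continuousOn hβc cwu 2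
  set V : ℝ → ℂ := fun η => ∫ s in (0 : ℝ)..η, w s with hV
  have cV : ContinuousOn V (Icc 0 δ) := continuousOn_primitive hβc mw
  -- The primitive of `-w` that vanishes at `δ`. This normalization encodes the natural boundary
  -- condition `φ' = 0` at the upper end.
  set U : ℝ → ℂ := fun η => V δ - V η with hU
  have cU : ContinuousOn U (Icc 0 δ) := continuousOn_const.sub cV
  have dU : ∀ η ∈ Ioo 0 δ, HasDerivAt U (-w η) η := fun η hη =>
    (hasDerivAt_primitive cwu hη).const_sub _
  -- the weak equation
  have hweak : ∀ᵐ η ∂volume, η ∈ Ioo 0 δ →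
      (ω : ℂ) * (((Real.exp (-β η) : ℝ) : ℂ) * g η) + U η = 0 := by
    have ig : IntegrableOn (fun η => ((Real.exp (-β η) : ℝ) : ℂ) * g η) (Ioo 0 δ) := by
      obtain ⟨C, hC⟩ := isCompact_Icc.exists_bound_of_continuousOn cw
      refine Integrable.bdd_mul (c := C) (integrableOn_of_memLp hβc (Lp.memLp g))
        ((cw.mono Ioo_subset_Icc_self).aestronglyMeasurable measurableSet_Ioo) ?_
      filter_upwards [ae_restrict_mem measurableSet_Ioo] with η hη
      exact hC η ⟨hη.1.le, hη.2.le⟩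
    have iU : IntegrableOn U (Ioo 0 δ) := (cU.integrableOn_Icc).mono_set Ioo_subset_Icc_self
    refine isOpen_Ioo.ae_eq_zero_of_integral_contDiff_smul_eq_zero
      (IntegrableOn.locallyIntegrableOn ((ig.const_mul _).add iU)) ?_
    intro ψ hψ hc hs
    have mψ : MemLp (fun η => (ψ η : ℂ)) 2 (intervalMeasure β δ) :=
      memLp_of_continuousOn hβc (Complex.continuous_ofReal.comp hψ.continuous).continuousOn 2
    -- The kernel equation is paired with an arbitrary `ψ`, the derivative of the admissible
    -- variation `Ψ = Jψ`.
    set Ψ : ℝ → ℝ := fun η => ∫ s in (0 : ℝ)..η, ψ s with hΨ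
    have dΨ : ∀ η, HasDerivAt Ψ (ψ η) η := fun η =>
      (hψ.continuous.integral_hasStrictDerivAt 0 η).hasDerivAt
    have cΨ : Continuous Ψ := continuous_iff_continuousAt.2 fun η => (dΨ η).continuousAt
    have hJψ : J mψ.toLp =ᵐ[volume.restrict (Ioo 0 δ)] fun η => (Ψ η : ℂ) := by
      filter_upwards [(volume_ac_intervalMeasure hβc).ae_le (hJ mψ.toLp),
        ae_restrict_mem measurableSet_Ioo] with η a2 a3
      rw [a2, hΨ]
      simp only
      rw [← intervalIntegral.integral_ofReal, intervalIntegral.integral_of_le a3.1.le,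
        intervalIntegral.integral_of_le a3.1.le,
        integral_Ioc_eq_integral_Ioo, integral_Ioc_eq_integral_Ioo]
      refine integral_congr_ae (ae_restrict_of_ae_restrict_of_subset
        (Ioo_subset_Ioo_right a3.2.le) ?_)
      exact (volume_ac_intervalMeasure hβc).ae_le mψ.coeFn_toLp
    have h1 := inner_quadPencil J B ω k mψ.toLp g
    rw [hT, inner_zero_right, inner_L2i hβc, inner_L2i hβc, inner_L2i hβc] at h1
    have e1 : ∫ η in Ioo 0 δ, ((Real.exp (-β η) : ℝ) : ℂ)
          * (conj ((mψ.toLp : L2i β δ) η) * g η)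
        = ∫ η in Ioo 0 δ, (ψ η : ℂ) * (((Real.exp (-β η) : ℝ) : ℂ) * g η) := by
      refine integral_congr_ae ?_
      filter_upwards [(volume_ac_intervalMeasure hβc).ae_le mψ.coeFn_toLp] with η b1
      rw [b1, Complex.conj_ofReal]
      ring
    have e2 : ∫ η in Ioo 0 δ, ((Real.exp (-β η) : ℝ) : ℂ) * (conj (J mψ.toLp η) * J g η)
        = ∫ η in Ioo 0 δ, (Ψ η : ℂ) * (((Real.exp (-β η) : ℝ) : ℂ) * φ₀ η) := by
      refine integral_congr_ae ?_
      filter_upwards [hJψ, (volume_ac_intervalMeasure hβc).ae_le (hJ g)] with η b1 b2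
      rw [b1, b2, Complex.conj_ofReal]
      ring
    have e3 : ∫ η in Ioo 0 δ, ((Real.exp (-β η) : ℝ) : ℂ) * (conj (J mψ.toLp η) * B (J g) η)
        = ∫ η in Ioo 0 δ, (Ψ η : ℂ) * (((Real.exp (-β η) : ℝ) : ℂ)
          * (((derivWithin β (Icc 0 δ) η : ℝ) : ℂ) * φ₀ η)) := by
      refine integral_congr_ae ?_
      filter_upwards [hJψ, (volume_ac_intervalMeasure hβc).ae_le (hJ g),
        (volume_ac_intervalMeasure hβc).ae_le (hB (J g))] with η b1 b2 b3
      rw [b1, b3, b2, Complex.conj_ofReal]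
      ring
    have cΨ' : ContinuousOn (fun η => (Ψ η : ℂ)) (Icc 0 δ) :=
      (Complex.continuous_ofReal.comp cΨ).continuousOn
    have i2 : IntegrableOn (fun η => (Ψ η : ℂ) * (((Real.exp (-β η) : ℝ) : ℂ) * φ₀ η)) (Ioo 0 δ) :=
      (cΨ'.mul (cw.mul c0)).integrableOn_Icc.mono_set Ioo_subset_Icc_self
    have i3 : IntegrableOn (fun η => (Ψ η : ℂ) * (((Real.exp (-β η) : ℝ) : ℂ)
        * (((derivWithin β (Icc 0 δ) η : ℝ) : ℂ) * φ₀ η))) (Ioo 0 δ) :=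
      (cΨ'.mul (cw.mul ((Complex.continuous_ofReal.comp_continuousOn
        cβ).mul c0))).integrableOn_Icc.mono_set Ioo_subset_Icc_self
    have e4 : (ω : ℂ) * (k : ℂ) ^ 2 * (∫ η in Ioo 0 δ, (Ψ η : ℂ)
          * (((Real.exp (-β η) : ℝ) : ℂ) * φ₀ η))
        - k * ∫ η in Ioo 0 δ, (Ψ η : ℂ) * (((Real.exp (-β η) : ℝ) : ℂ)
          * (((derivWithin β (Icc 0 δ) η : ℝ) : ℂ) * φ₀ η))
        = ∫ η in Ioo 0 δ, (Ψ η : ℂ) * w η := by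
      rw [← integral_const_mul, ← integral_const_mul,
        ← integral_sub (i2.const_mul _) (i3.const_mul _)]
      refine integral_congr_ae (ae_of_all _ fun η => ?_)
      simp only [hw, hu]
      push_cast
      ring
    have e5 : ∫ η in Ioo 0 δ, (Ψ η : ℂ) * w η = ∫ η in Ioo 0 δ, (ψ η : ℂ) * U η := by
      have h3 := intervalIntegral.integral_mul_deriv_eq_deriv_mul_of_hasDerivAt
        (a := 0) (b := δ) (u := fun η => (Ψ η : ℂ)) (v := U) (u' := fun η => (ψ η : ℂ))
        (v' := fun η => -w η) (by rw [uIcc_of_le hδ.le]; exact cΨ')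
        (by rw [uIcc_of_le hδ.le]; exact cU)
        (fun η _ => (dΨ η).ofReal_comp)
        (fun η hη => dU η (by simpa [hδ.le] using hη))
        ((Complex.continuous_ofReal.comp hψ.continuous).intervalIntegrable _ _)
        (ContinuousOn.intervalIntegrable (by rw [uIcc_of_le hδ.le]; exact cwu.neg))
      -- Both boundary terms vanish: the variation at `0` and `U` at `δ`.
      have hΨ0 : Ψ 0 = 0 := intervalIntegral.integral_same
      have hUδ : U δ = 0 := sub_self _
      simp only [hΨ0, hUδ, Complex.ofReal_zero, zero_mul, mul_zero, sub_zero, zero_sub, mul_neg,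
        intervalIntegral.integral_neg, neg_inj] at h3
      rw [intervalIntegral.integral_of_le hδ.le, intervalIntegral.integral_of_le hδ.le,
        integral_Ioc_eq_integral_Ioo, integral_Ioc_eq_integral_Ioo] at h3
      exact h3
    rw [e1, e2, e3, add_sub_assoc, e4, e5] at h1
    have iψ1 : IntegrableOn (fun η => (ψ η : ℂ) * (((Real.exp (-β η) : ℝ) : ℂ) * g η))
        (Ioo 0 δ) := by
      obtain ⟨C, hC⟩ := hψ.continuous.bounded_above_of_compact_support hc
      refine Integrable.bdd_mul (c := C) ig
        (Complex.continuous_ofReal.comp hψ.continuous).aestronglyMeasurable (ae_of_all _ fun η => ?_)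
      simpa using hC η
    have iψ2 : IntegrableOn (fun η => (ψ η : ℂ) * U η) (Ioo 0 δ) :=
      ((Complex.continuous_ofReal.comp hψ.continuous).continuousOn.mul
        cU).integrableOn_Icc.mono_set Ioo_subset_Icc_self
    rw [← integral_const_mul, ← integral_add (iψ1.const_mul _) iψ2] at h1
    rw [← setIntegral_eq_integral_of_forall_compl_eq_zero (s := Ioo 0 δ), h1]
    · refine integral_congr_ae (ae_of_all _ fun η => ?_)
      simp only [Complex.real_smul]
      ring
    · intro η hη
      rw [image_eq_zero_of_notMem_tsupport fun h => hη (hs h), zero_smul]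
  -- The weak equation solved for `g`: the continuous representative, which is even differentiable
  -- inside the interval.
  set φ₁ : ℝ → ℂ := fun η => -((ω : ℂ)⁻¹ * ((Real.exp (β η) : ℝ) : ℂ) * U η) with hφ₁
  have c1 : ContinuousOn φ₁ (Icc 0 δ) := ((continuousOn_const.mul cE).mul cU).neg
  have hω' : (ω : ℂ) ≠ 0 := by exact_mod_cast hω.ne'
  have hexp : ∀ η, ((Real.exp (β η) : ℝ) : ℂ) * ((Real.exp (-β η) : ℝ) : ℂ) = 1 := by
    intro η
    rw [← Complex.ofReal_mul, ← Real.exp_add]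
    simp
  have hgφ : ∀ᵐ η ∂(volume.restrict (Ioo 0 δ)), g η = φ₁ η := by
    filter_upwards [ae_restrict_of_ae hweak, ae_restrict_mem measurableSet_Ioo] with η h1 h2
    have h3 := h1 h2
    have h4 : U η = -((ω : ℂ) * (((Real.exp (-β η) : ℝ) : ℂ) * g η)) :=
      eq_neg_of_add_eq_zero_right h3
    simp only [hφ₁]
    rw [h4]
    have := hexp η
    calc g η = (ω : ℂ)⁻¹ * ω * 1 * g η := by rw [inv_mul_cancel₀ hω']; ring
      _ = _ := by rw [← this]; ring
  have h01 : ∀ η ∈ Icc 0 δ, φ₀ η = ∫ s in (0 : ℝ)..η, φ₁ s := by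
    intro η hη
    simp only [hφ₀]
    rw [intervalIntegral.integral_of_le hη.1, intervalIntegral.integral_of_le hη.1,
      integral_Ioc_eq_integral_Ioo, integral_Ioc_eq_integral_Ioo]
    exact integral_congr_ae (ae_restrict_of_ae_restrict_of_subset
      (Ioo_subset_Ioo_right hη.2) hgφ)
  have d0 : ∀ η ∈ Ioo 0 δ, HasDerivAt φ₀ (φ₁ η) η := by
    intro η hη
    refine (hasDerivAt_primitive c1 hη).congr_of_eventuallyEq ?_
    filter_upwards [Ioo_mem_nhds hη.1 hη.2] with s hs
    exact h01 s ⟨hs.1.le, hs.2.le⟩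
  set φ₂ : ℝ → ℂ := fun η => ((derivWithin β (Icc 0 δ) η : ℝ) : ℂ) * φ₁ η + (ω : ℂ)⁻¹ * u η
    with hφ₂
  refine ⟨k, φ₀, φ₁, φ₂, c0, c1, ((Complex.continuous_ofReal.comp_continuousOn cβ).mul c1).add
    (continuousOn_const.mul cu), d0, ?_, intervalIntegral.integral_same, ?_, ?_, ?_⟩
  · intro η hη
    have h1 := (((hasDerivAt_exp hβ hη).ofReal_comp.const_mul (ω : ℂ)⁻¹).mul (dU η hη)).neg
    refine (h1.congr_deriv ?_)
    have := hexp η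
    simp only [hφ₂, hφ₁, hw]
    push_cast at this ⊢
    linear_combination (u η * (ω : ℂ)⁻¹) * this
  · simp [hφ₁, hU]
  · by_contra! hcon
    refine hg (Lp.ext ?_)
    have h2 : ∀ᵐ η ∂(volume.restrict (Ioo 0 δ)), g η = 0 := by
      filter_upwards [hgφ, ae_restrict_mem measurableSet_Ioo] with η h1 hη
      rw [h1]
      have h3 : φ₀ =ᶠ[𝓝 η] fun _ => 0 := by
        filter_upwards [Ioo_mem_nhds hη.1 hη.2] with s hs
        exact hcon s hs
      exact (d0 η hη).unique ((hasDerivAt_const η (0 : ℂ)).congr_of_eventuallyEq h3)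
    filter_upwards [(intervalMeasure_ac β δ).ae_le h2, Lp.coeFn_zero ℂ 2 (intervalMeasure β δ)]
      with η h3 h4
    rw [h3, h4, Pi.zero_apply]
  · intro η hη
    simp only [hφ₂, hu, derivWithin_eq_deriv hη]
    push_cast
    field_simp
    ring

lemma exists_isMode (hδ : 0 < δ) (hβ : ContDiffOn ℝ 1 β (Icc 0 δ))
    (hβ' : ∀ η ∈ Ioo 0 δ, 0 < deriv β η) {ω : ℝ} (hω : |ω| ≤ omegaStar β δ) :
    ∃ k φ₀ φ₁ φ₂, IsMode β δ ω k φ₀ φ₁ φ₂ := by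
  rcases lt_trichotomy ω 0 with h | rfl | h
  · obtain ⟨k, φ₀, φ₁, φ₂, hm⟩ := exists_isMode_of_pos hδ hβ hβ' (ω := -ω) (by linarith)
      (by rwa [abs_of_neg h] at hω)
    -- The mode equation is unchanged when `ω` and `k` both change sign.
    refine ⟨-k, φ₀, φ₁, φ₂, { hm with eqn := fun η hη => ?_ }⟩
    have := hm.eqn η hη
    push_cast at this ⊢
    linear_combination -this
  -- For `ω = k = 0` both sides of the mode equation vanish, so any smooth function with the right
  -- boundary values serves.
  · refine ⟨0, fun η => (η : ℂ) ^ 2 - 2 * δ * η, fun η => 2 * (η : ℂ) - 2 * δ, fun _ => 2,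
      by fun_prop, by fun_prop, by fun_prop, fun η _ => ?_, fun η _ => ?_, by simp, by simp, ?_,
      by simp⟩
    · have h1 : HasDerivAt (fun η : ℝ => (η : ℂ)) 1 η := (hasDerivAt_id η).ofReal_comp
      have := (h1.pow 2).sub (h1.const_mul (2 * (δ : ℂ)))
      refine this.congr_deriv ?_
      simp
    · have h1 : HasDerivAt (fun η : ℝ => (η : ℂ)) 1 η := (hasDerivAt_id η).ofReal_comp
      refine ((h1.const_mul 2).sub_const _).congr_deriv ?_
      simp
    · refine ⟨δ / 2, ⟨by linarith, by linarith⟩, ?_⟩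
      have : ((δ / 2 : ℝ) : ℂ) ^ 2 - 2 * δ * ((δ / 2 : ℝ) : ℂ) = ((-(3 / 4) * δ ^ 2 : ℝ) : ℂ) := by
        push_cast
        ring
      simp only [this]
      have h2 : -(3 / 4) * δ ^ 2 ≠ 0 := by
        have := pow_pos hδ 2
        nlinarith
      exact_mod_cast h2
  · exact exists_isMode_of_pos hδ hβ hβ' h (by rwa [abs_of_pos h] at hω)

end Modes

/-! ### Singular sequences -/

section Singular

/-- An operator with a bounded separated sequence that it maps to a null sequence is not
Fredholm. -/
theorem not_isFredholm_of_seq {E F : Type*} [NormedAddCommGroup E] [NormedSpace ℂ E]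
    [CompleteSpace E] [NormedAddCommGroup F] [NormedSpace ℂ F] [CompleteSpace F]
    {u : E →L[ℂ] F} {x : ℕ → E} {M c : ℝ} (hM : ∀ n, ‖x n‖ ≤ M) (hc : 0 < c)
    (hsep : ∀ n m, n ≠ m → c ≤ ‖x n - x m‖) (hu : Tendsto (fun n => u (x n)) atTop (𝓝 0)) :
    ¬ u.IsFredholm := by
  intro h
  obtain ⟨v, hv⟩ := h.exists_isQuasiInverse
  have hv1 := hv.1
  rw [LinearMap.IsLeftQuasiInverse, LinearMap.FiniteRangeSetoid.equiv_iff_hasFiniteRange] at hv1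
  -- With a quasi-inverse `v`, the operator `K = vu - 1` has finite rank. Hence `x n = v (u (x n)) -
  -- K (x n)` has a convergent subsequence, which contradicts separation.
  set K : E →L[ℂ] E := v ∘L u - ContinuousLinearMap.id ℂ E with hK
  have hfin : FiniteDimensional ℂ K.range := Module.Finite.iff_fg.2 hv1
  have hmem : ∀ n, K.rangeRestrict (x n) ∈ Metric.closedBall (0 : K.range) (‖K‖ * M) := by
    intro n
    rw [mem_closedBall_zero_iff]
    exact (K.le_opNorm _).trans (mul_le_mul_of_nonneg_left (hM n) (norm_nonneg _))
  have : ProperSpace K.range := FiniteDimensional.proper ℂ _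
  obtain ⟨y, -, φ, hφ, hy⟩ := (isCompact_closedBall (0 : K.range) (‖K‖ * M)).tendsto_subseq hmem
  have h1 : Tendsto (fun n => K (x (φ n))) atTop (𝓝 (y : E)) :=
    (continuous_subtype_val.tendsto y).comp hy
  have h2 : Tendsto (fun n => v (u (x (φ n)))) atTop (𝓝 0) := by
    simpa [Function.comp_def] using (v.continuous.tendsto 0).comp (hu.comp hφ.tendsto_atTop)
  have h3 : Tendsto (fun n => x (φ n)) atTop (𝓝 (0 - (y : E))) := by
    refine (h2.sub h1).congr fun n => ?_
    simp [hK]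
  obtain ⟨N, hN⟩ := Metric.cauchySeq_iff.1 h3.cauchySeq c hc
  have h4 := hN N le_rfl (N + 1) (Nat.le_succ N)
  rw [dist_eq_norm] at h4
  exact absurd (hsep (φ N) (φ (N + 1)) (hφ.injective.ne (Nat.succ_ne_self N).symm)) (not_le.2 h4)

end Singular

/-! ### Products of functions of `ξ` and of `η` -/

section Tensor

variable {β : ℝ → ℝ} {δ : ℝ}

lemma volume_restrict_strip (δ : ℝ) : (volume : Measure (ℝ × ℝ)).restrict (strip δ)
    = (volume : Measure ℝ).prod (volume.restrict (Ioo 0 δ)) := by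
  have : strip δ = univ ×ˢ Ioo 0 δ := by
    ext z
    simp [strip]
  rw [this, Measure.volume_eq_prod, ← Measure.prod_restrict, Measure.restrict_univ]

lemma memLp_tensor {A b : ℝ → ℂ} (hA : Continuous A) (hAc : HasCompactSupport A)
    (hb : ContinuousOn b (Icc 0 δ)) :
    MemLp (fun z : ℝ × ℝ => A z.1 * b z.2) 2 (volume.restrict (strip δ)) := by
  have hm : AEStronglyMeasurable (fun z : ℝ × ℝ => A z.1 * b z.2) (volume.restrict (strip δ)) := by
    refine ContinuousOn.aestronglyMeasurable ?_ (measurableSet_strip δ)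
    exact (hA.comp continuous_fst).continuousOn.mul
      (hb.comp continuous_snd.continuousOn fun z hz => ⟨hz.1.le, hz.2.le⟩)
  rw [memLp_two_iff_integrable_sq_norm hm, volume_restrict_strip]
  have h1 : Integrable (fun ξ => ‖A ξ‖ ^ 2) volume :=
    (by fun_prop : Continuous fun ξ => ‖A ξ‖ ^ 2).integrable_of_hasCompactSupport
      (hAc.comp_left (g := fun w : ℂ => ‖w‖ ^ 2) (by simp))
  have h2 : Integrable (fun η => ‖b η‖ ^ 2) (volume.restrict (Ioo 0 δ)) :=
    ((hb.norm.pow 2).integrableOn_compact isCompact_Icc).mono_set Ioo_subset_Icc_self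
  simpa only [norm_mul, mul_pow] using h1.mul_prod h2

/-- The function `A(ξ) b(η)` as an element of the weighted space. -/
def tensorLp (hβ : ContinuousOn β (Icc 0 δ)) {A b : ℝ → ℂ} (hA : Continuous A)
    (hAc : HasCompactSupport A) (hb : ContinuousOn b (Icc 0 δ)) : L2h β δ :=
  (memLp_stripMeasure hβ (memLp_tensor hA hAc hb)).toLp

variable {A A' b b' : ℝ → ℂ}

lemma tensorLp_coeFn (hβ : ContinuousOn β (Icc 0 δ)) (hA : Continuous A)
    (hAc : HasCompactSupport A) (hb : ContinuousOn b (Icc 0 δ)) :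
    tensorLp hβ hA hAc hb =ᵐ[volume.restrict (strip δ)] fun z => A z.1 * b z.2 :=
  (volume_ac_stripMeasure hβ).ae_le (MemLp.coeFn_toLp _)

lemma inner_tensorLp (hβ : ContinuousOn β (Icc 0 δ)) (hA : Continuous A)
    (hAc : HasCompactSupport A) (hb : ContinuousOn b (Icc 0 δ)) (hA' : Continuous A')
    (hAc' : HasCompactSupport A') (hb' : ContinuousOn b' (Icc 0 δ)) :
    inner ℂ (tensorLp hβ hA hAc hb) (tensorLp hβ hA' hAc' hb')
      = (∫ ξ, conj (A ξ) * A' ξ) *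
        ∫ η in Ioo 0 δ, ((Real.exp (-β η) : ℝ) : ℂ) * (conj (b η) * b' η) := by
  rw [inner_L2h hβ, ← integral_prod_mul, ← volume_restrict_strip]
  refine integral_congr_ae ?_
  filter_upwards [tensorLp_coeFn hβ hA hAc hb, tensorLp_coeFn hβ hA' hAc' hb'] with z h1 h2
  rw [h1, h2, map_mul]
  ring

lemma norm_sq_tensorLp (hβ : ContinuousOn β (Icc 0 δ)) (hA : Continuous A)
    (hAc : HasCompactSupport A) (hb : ContinuousOn b (Icc 0 δ)) :
    ‖tensorLp hβ hA hAc hb‖ ^ 2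
      = (∫ ξ, ‖A ξ‖ ^ 2) * ∫ η in Ioo 0 δ, Real.exp (-β η) * ‖b η‖ ^ 2 := by
  have h := inner_tensorLp hβ hA hAc hb hA hAc hb
  rw [inner_self_eq_norm_sq_to_K] at h
  simp only [← Complex.normSq_eq_conj_mul_self, Complex.normSq_eq_norm_sq] at h
  have e : ∀ η, ((Real.exp (-β η) : ℝ) : ℂ) * ((‖b η‖ ^ 2 : ℝ) : ℂ)
      = ((Real.exp (-β η) * ‖b η‖ ^ 2 : ℝ) : ℂ) := fun η => by push_cast; ring
  simp only [e, integral_complex_ofReal] at h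
  refine Complex.ofReal_injective ?_
  rw [Complex.ofReal_mul, ← h, Complex.ofReal_pow]
  rfl

lemma hasWeakPartial_tensor (hA : ∀ ξ, HasDerivAt A (A' ξ) ξ) (hAc : HasCompactSupport A)
    (hA' : Continuous A') (hAc' : HasCompactSupport A') (hb : ContinuousOn b (Icc 0 δ)) :
    HasWeakPartial δ (1, 0) (fun z => A z.1 * b z.2) (fun z => A' z.1 * b z.2) := by
  intro ψ hψ hc _
  have cA : Continuous A := continuous_iff_continuousAt.2 fun ξ => (hA ξ).continuousAt
  have m1 := (memLp_tensor cA hAc hb).locallyIntegrable (by norm_num)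
  have m2 := (memLp_tensor hA' hAc' hb).locallyIntegrable (by norm_num)
  have hd : Continuous fun z => fderiv ℝ ψ z (1, 0) :=
    (hψ.continuous_fderiv (by simp)).clm_apply continuous_const
  have hdc : HasCompactSupport fun z => fderiv ℝ ψ z (1, 0) := hc.fderiv_apply (𝕜 := ℝ) _
  have i1 : Integrable (fun z => (fderiv ℝ ψ z (1, 0)) • (A z.1 * b z.2))
      (volume.restrict (strip δ)) :=
    LocallyIntegrable.integrable_smul_left_of_hasCompactSupport m1 hd hdc
  have i2 : Integrable (fun z => ψ z • (A' z.1 * b z.2)) (volume.restrict (strip δ)) :=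
    LocallyIntegrable.integrable_smul_left_of_hasCompactSupport m2 hψ.continuous hc
  rw [volume_restrict_strip] at i1 i2 ⊢
  rw [integral_prod_symm _ i1, integral_prod_symm _ i2, ← integral_neg]
  refine integral_congr_ae (ae_of_all _ fun η => ?_)
  have hder : ∀ ξ, HasDerivAt (fun ξ => (ψ (ξ, η) : ℂ)) ((fderiv ℝ ψ (ξ, η) (1, 0) : ℝ) : ℂ) ξ := by
    intro ξ
    have h1 : HasDerivAt (fun ξ : ℝ => (ξ, η)) ((1 : ℝ), (0 : ℝ)) ξ :=
      (hasDerivAt_id ξ).prodMk (hasDerivAt_const ξ η)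
    exact (((hψ.differentiable (by simp)) (ξ, η)).hasFDerivAt.comp_hasDerivAt ξ h1).ofReal_comp
  have cψ : Continuous fun ξ => (ψ (ξ, η) : ℂ) := by have := hψ.continuous; fun_prop
  have cd : Continuous fun ξ => ((fderiv ℝ ψ (ξ, η) (1, 0) : ℝ) : ℂ) := by fun_prop
  have key := integral_mul_deriv_eq_deriv_mul_of_integrable (u := fun ξ => A ξ)
    (v := fun ξ => (ψ (ξ, η) : ℂ)) (fun ξ _ => hA ξ) (fun ξ _ => hder ξ) ?_ ?_ ?_
  · simp only [Complex.real_smul]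
    have e1 : ∀ ξ, ((fderiv ℝ ψ (ξ, η) (1, 0) : ℝ) : ℂ) * (A ξ * b η)
        = b η * (A ξ * ((fderiv ℝ ψ (ξ, η) (1, 0) : ℝ) : ℂ)) := fun ξ => by ring
    have e2 : ∀ ξ, (ψ (ξ, η) : ℂ) * (A' ξ * b η) = b η * (A' ξ * (ψ (ξ, η) : ℂ)) :=
      fun ξ => by ring
    simp only [e1, e2]
    rw [integral_const_mul, integral_const_mul, key, mul_neg]
  · exact (cA.mul cd).integrable_of_hasCompactSupport hAc.mul_right
  · exact (hA'.mul cψ).integrable_of_hasCompactSupport hAc'.mul_right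
  · exact (cA.mul cψ).integrable_of_hasCompactSupport hAc.mul_right

/-- Fubini and integration by parts on `[0, δ]`. At each end the boundary term is removed either by
`b` or by the support of the test function, which covers the weak derivative and both trace
conditions at once. -/
lemma byParts_tensor (hδ : 0 < δ) {U : Set (ℝ × ℝ)} (hA : Continuous A) (hAc : HasCompactSupport A)
    (hb : ContinuousOn b (Icc 0 δ)) (hb' : ContinuousOn b' (Icc 0 δ))
    (hd : ∀ η ∈ Ioo 0 δ, HasDerivAt b (b' η) η)
    (h0 : b 0 = 0 ∨ ∀ ξ, (ξ, 0) ∉ U) (h1 : b δ = 0 ∨ ∀ ξ, (ξ, δ) ∉ U) :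
    ByParts δ U (0, 1) (fun z => A z.1 * b z.2) (fun z => A z.1 * b' z.2) := by
  intro ψ hψ hc hs
  have m1 := (memLp_tensor hA hAc hb).locallyIntegrable (by norm_num)
  have m2 := (memLp_tensor hA hAc hb').locallyIntegrable (by norm_num)
  have hd' : Continuous fun z => fderiv ℝ ψ z (0, 1) :=
    (hψ.continuous_fderiv (by simp)).clm_apply continuous_const
  have hdc : HasCompactSupport fun z => fderiv ℝ ψ z (0, 1) := hc.fderiv_apply (𝕜 := ℝ) _
  have i1 : Integrable (fun z => (fderiv ℝ ψ z (0, 1)) • (A z.1 * b z.2))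
      (volume.restrict (strip δ)) :=
    LocallyIntegrable.integrable_smul_left_of_hasCompactSupport m1 hd' hdc
  have i2 : Integrable (fun z => ψ z • (A z.1 * b' z.2)) (volume.restrict (strip δ)) :=
    LocallyIntegrable.integrable_smul_left_of_hasCompactSupport m2 hψ.continuous hc
  rw [volume_restrict_strip] at i1 i2 ⊢
  rw [integral_prod _ i1, integral_prod _ i2, ← integral_neg]
  refine integral_congr_ae (ae_of_all _ fun ξ => ?_)
  have hder : ∀ η, HasDerivAt (fun η => (ψ (ξ, η) : ℂ)) ((fderiv ℝ ψ (ξ, η) (0, 1) : ℝ) : ℂ) η := by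
    intro η
    have h1 : HasDerivAt (fun η : ℝ => (ξ, η)) ((0 : ℝ), (1 : ℝ)) η :=
      (hasDerivAt_const η ξ).prodMk (hasDerivAt_id η)
    exact (((hψ.differentiable (by simp)) (ξ, η)).hasFDerivAt.comp_hasDerivAt η h1).ofReal_comp
  have cψ : Continuous fun η => (ψ (ξ, η) : ℂ) := by have := hψ.continuous; fun_prop
  have cd : Continuous fun η => ((fderiv ℝ ψ (ξ, η) (0, 1) : ℝ) : ℂ) := by fun_prop
  have hz : ∀ η, (b η = 0 ∨ ∀ ξ, (ξ, η) ∉ U) → b η * (ψ (ξ, η) : ℂ) = 0 := by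
    rintro η (h | h)
    · rw [h, zero_mul]
    · rw [image_eq_zero_of_notMem_tsupport fun hm => h ξ (hs hm)]
      simp
  have key := intervalIntegral.integral_mul_deriv_eq_deriv_mul_of_hasDerivAt (a := 0) (b := δ)
    (u := b) (v := fun η => (ψ (ξ, η) : ℂ)) (u' := b')
    (v' := fun η => ((fderiv ℝ ψ (ξ, η) (0, 1) : ℝ) : ℂ))
    (by rwa [uIcc_of_le hδ.le]) cψ.continuousOn
    (by rwa [min_eq_left hδ.le, max_eq_right hδ.le]) (fun η _ => hder η)
    (ContinuousOn.intervalIntegrable (by rwa [uIcc_of_le hδ.le])) (cd.intervalIntegrable _ _)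
  rw [hz 0 h0, hz δ h1, sub_zero, zero_sub, intervalIntegral.integral_of_le hδ.le,
    intervalIntegral.integral_of_le hδ.le, integral_Ioc_eq_integral_Ioo,
    integral_Ioc_eq_integral_Ioo] at key
  simp only [Complex.real_smul]
  have e1 : ∀ η, ((fderiv ℝ ψ (ξ, η) (0, 1) : ℝ) : ℂ) * (A ξ * b η)
      = A ξ * (b η * ((fderiv ℝ ψ (ξ, η) (0, 1) : ℝ) : ℂ)) := fun η => by ring
  have e2 : ∀ η, (ψ (ξ, η) : ℂ) * (A ξ * b' η) = A ξ * (b' η * (ψ (ξ, η) : ℂ)) :=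
    fun η => by ring
  simp only [e1, e2]
  rw [integral_const_mul, integral_const_mul, key, mul_neg]

end Tensor

/-! ### Wave packets -/

section Packets

variable {β : ℝ → ℝ} {δ : ℝ}

/-- The wave packet `R^{-1/2} w((ξ - c) / R) e^{ikξ}`. -/
def packet (k R c : ℝ) (w : ℝ → ℝ) (ξ : ℝ) : ℂ :=
  (((√R)⁻¹ * w ((ξ - c) / R) : ℝ) : ℂ) * Complex.exp (Complex.I * k * ξ)

lemma continuous_packet (k R c : ℝ) {w : ℝ → ℝ} (hw : Continuous w) :
    Continuous (packet k R c w) := by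
  unfold packet
  fun_prop

lemma norm_packet (k R c : ℝ) (w : ℝ → ℝ) (ξ : ℝ) :
    ‖packet k R c w ξ‖ = (√R)⁻¹ * |w ((ξ - c) / R)| := by
  rw [packet, norm_mul, Complex.norm_real, Real.norm_eq_abs, abs_mul,
    abs_of_nonneg (by positivity : 0 ≤ (√R)⁻¹),
    show Complex.I * k * ξ = ((k * ξ : ℝ) : ℂ) * Complex.I by push_cast; ring,
    Complex.norm_exp_ofReal_mul_I, mul_one]

lemma hasCompactSupport_packet (k : ℝ) {R : ℝ} (hR : 0 < R) (c : ℝ) {w : ℝ → ℝ}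
    (hw : HasCompactSupport w) : HasCompactSupport (packet k R c w) := by
  have h1 : HasCompactSupport fun ξ => w ((ξ - c) / R) := by
    have := hw.comp_homeomorph ((Homeomorph.addRight (-c)).trans (Homeomorph.mulRight₀ R⁻¹ (by positivity)))
    simpa [Function.comp_def, div_eq_mul_inv, sub_eq_add_neg] using this
  refine h1.mono fun ξ hξ h0 => hξ ?_
  simp only at h0
  simp [packet, h0]

lemma integral_norm_sq_packet (k : ℝ) {R : ℝ} (hR : 0 < R) (c : ℝ) (w : ℝ → ℝ) :
    ∫ ξ, ‖packet k R c w ξ‖ ^ 2 = ∫ s, w s ^ 2 := by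
  simp only [norm_packet, mul_pow, sq_abs, inv_pow, Real.sq_sqrt hR.le]
  rw [integral_const_mul, integral_sub_right_eq_self (fun ξ => w (ξ / R) ^ 2) c,
    Measure.integral_comp_div (fun s => w s ^ 2) R, abs_of_pos hR, smul_eq_mul, ← mul_assoc,
    inv_mul_cancel₀ hR.ne', one_mul]

lemma hasDerivAt_packet (k : ℝ) {R : ℝ} (c : ℝ) {w : ℝ → ℝ} (hw : Differentiable ℝ w) (ξ : ℝ) :
    HasDerivAt (packet k R c w) ((R : ℂ)⁻¹ * packet k R c (deriv w) ξ
      + Complex.I * k * packet k R c w ξ) ξ := by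
  have h1 : HasDerivAt (fun ξ : ℝ => (ξ - c) / R) (1 / R) ξ :=
    ((hasDerivAt_id ξ).sub_const c).div_const R
  have h2 : HasDerivAt (fun ξ : ℝ => (√R)⁻¹ * w ((ξ - c) / R))
      ((√R)⁻¹ * (deriv w ((ξ - c) / R) * (1 / R))) ξ :=
    ((hw ((ξ - c) / R)).hasDerivAt.comp ξ h1).const_mul _
  have h3 : HasDerivAt (fun ξ : ℝ => Complex.exp (Complex.I * k * ξ))
      (Complex.exp (Complex.I * k * ξ) * (Complex.I * k * 1)) ξ :=
    ((Complex.ofRealCLM.hasDerivAt (x := ξ)).const_mul (Complex.I * k)).cexp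
  refine (h2.ofReal_comp.mul h3).congr_deriv ?_
  simp only [packet]
  push_cast
  ring

/-- Packet `n` lives in `(n², n² + n + 1)`, and `n² + n + 1 ≤ (n + 1)²`. So the widths grow without
bound while the supports stay disjoint. -/
lemma packet_mul_eq_zero (k : ℝ) {w : ℝ → ℝ} (hw : ∀ s, s ∉ Ioo (0 : ℝ) 1 → w s = 0)
    {n m : ℕ} (hnm : n < m) (ξ : ℝ) :
    packet k (n + 1) ((n : ℝ) ^ 2) w ξ = 0 ∨ packet k (m + 1) ((m : ℝ) ^ 2) w ξ = 0 := by
  by_cases hs : (ξ - (n : ℝ) ^ 2) / (n + 1) ∈ Ioo (0 : ℝ) 1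
  · right
    have h1 := hs.2
    rw [div_lt_one (by positivity)] at h1
    have hnm' : (n : ℝ) + 1 ≤ m := by exact_mod_cast hnm
    rw [packet, hw, mul_zero, Complex.ofReal_zero, zero_mul]
    intro h2
    have h3 := h2.1
    rw [lt_div_iff₀ (by positivity), zero_mul] at h3
    nlinarith
  · left
    rw [packet, hw _ hs, mul_zero, Complex.ofReal_zero, zero_mul]

end Packets

/-! ### The singular sequence built from a mode. -/

section Weyl

variable {β : ℝ → ℝ} {δ : ℝ} {w : ℝ → ℝ} {b : ℝ → ℂ}

/-- The product of the wave packet with number `n` and of `b(η)`. -/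
def packetLp (hβ : ContinuousOn β (Icc 0 δ)) (k : ℝ) (n : ℕ) (hw : ContDiff ℝ (⊤ : ℕ∞) w)
    (hc : HasCompactSupport w) (hb : ContinuousOn b (Icc 0 δ)) : L2h β δ :=
  tensorLp hβ (continuous_packet k (n + 1) ((n : ℝ) ^ 2) hw.continuous)
    (hasCompactSupport_packet k (by positivity) _ hc) hb

lemma norm_packetLp (hβ : ContinuousOn β (Icc 0 δ)) (k : ℝ) (n : ℕ)
    (hw : ContDiff ℝ (⊤ : ℕ∞) w) (hc : HasCompactSupport w) (hb : ContinuousOn b (Icc 0 δ)) :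
    ‖packetLp hβ k n hw hc hb‖
      = √((∫ s, w s ^ 2) * ∫ η in Ioo 0 δ, Real.exp (-β η) * ‖b η‖ ^ 2) := by
  rw [← integral_norm_sq_packet k (by positivity : (0 : ℝ) < n + 1) ((n : ℝ) ^ 2) w,
    ← norm_sq_tensorLp hβ (continuous_packet k (n + 1) ((n : ℝ) ^ 2) hw.continuous)
    (hasCompactSupport_packet k (by positivity) _ hc) hb, Real.sqrt_sq (norm_nonneg _)]
  rfl

lemma hasWeakPartial_packetLp (hβ : ContinuousOn β (Icc 0 δ)) (k : ℝ) (n : ℕ)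
    (hw : ContDiff ℝ (⊤ : ℕ∞) w) (hc : HasCompactSupport w)
    (hw' : ContDiff ℝ (⊤ : ℕ∞) (deriv w)) (hc' : HasCompactSupport (deriv w))
    (hb : ContinuousOn b (Icc 0 δ)) :
    HasWeakPartial δ (1, 0) (packetLp hβ k n hw hc hb)
      (((((n : ℝ) + 1 : ℝ) : ℂ)⁻¹ • packetLp hβ k n hw' hc' hb
        + (Complex.I * k) • packetLp hβ k n hw hc hb : L2h β δ)) := by
  have hR : (0 : ℝ) < n + 1 := by positivity
  have h := hasWeakPartial_tensor (δ := δ)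
    (hasDerivAt_packet k (R := n + 1) ((n : ℝ) ^ 2) (hw.differentiable (by simp)))
    (hasCompactSupport_packet k hR _ hc)
    (by have := continuous_packet k (n + 1) ((n : ℝ) ^ 2) hw.continuous
        have := continuous_packet k (n + 1) ((n : ℝ) ^ 2) hw'.continuous
        fun_prop)
    ((hasCompactSupport_packet k hR _ hc').mul_left.add
      (hasCompactSupport_packet k hR _ hc).mul_left) hb
  refine h.congr (tensorLp_coeFn _ _ _ _).symm ?_
  have a := volume_ac_stripMeasure hβ
  filter_upwards [a.ae_le (Lp.coeFn_add ((((n : ℝ) + 1 : ℝ) : ℂ)⁻¹ • packetLp hβ k n hw' hc' hb)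
      ((Complex.I * k) • packetLp hβ k n hw hc hb)),
    a.ae_le (Lp.coeFn_smul (((n : ℝ) + 1 : ℝ) : ℂ)⁻¹ (packetLp hβ k n hw' hc' hb)),
    a.ae_le (Lp.coeFn_smul (Complex.I * k) (packetLp hβ k n hw hc hb)),
    tensorLp_coeFn hβ (continuous_packet k (n + 1) ((n : ℝ) ^ 2) hw.continuous)
      (hasCompactSupport_packet k hR _ hc) hb,
    tensorLp_coeFn hβ (continuous_packet k (n + 1) ((n : ℝ) ^ 2) hw'.continuous)
      (hasCompactSupport_packet k hR _ hc') hb] with z h1 h2 h3 h4 h5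
  rw [h1, Pi.add_apply, h2, h3, Pi.smul_apply, Pi.smul_apply, packetLp, packetLp, h4, h5,
    smul_eq_mul, smul_eq_mul]
  ring

lemma byParts_packetLp (hδ : 0 < δ) (hβ : ContinuousOn β (Icc 0 δ)) (k : ℝ) (n : ℕ)
    (hw : ContDiff ℝ (⊤ : ℕ∞) w) (hc : HasCompactSupport w) {b' : ℝ → ℂ}
    (hb : ContinuousOn b (Icc 0 δ)) (hb' : ContinuousOn b' (Icc 0 δ))
    (hd : ∀ η ∈ Ioo 0 δ, HasDerivAt b (b' η) η) {U : Set (ℝ × ℝ)}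
    (h0 : b 0 = 0 ∨ ∀ ξ, (ξ, 0) ∉ U) (h1 : b δ = 0 ∨ ∀ ξ, (ξ, δ) ∉ U) :
    ByParts δ U (0, 1) (packetLp hβ k n hw hc hb) (packetLp hβ k n hw hc hb') :=
  (byParts_tensor hδ (continuous_packet k (n + 1) ((n : ℝ) ^ 2) hw.continuous)
    (hasCompactSupport_packet k (by positivity) _ hc) hb hb' hd h0 h1).congr
    (tensorLp_coeFn _ _ _ _).symm (tensorLp_coeFn _ _ _ _).symm

/-- Disjoint packets are orthogonal, so Pythagoras separates them. -/
lemma le_norm_packetLp_sub (hβ : ContinuousOn β (Icc 0 δ)) (k : ℝ)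
    (hw : ContDiff ℝ (⊤ : ℕ∞) w) (hc : HasCompactSupport w) (hb : ContinuousOn b (Icc 0 δ))
    (hs : ∀ s, s ∉ Ioo (0 : ℝ) 1 → w s = 0) {n m : ℕ} (hnm : n ≠ m) :
    ‖packetLp hβ k n hw hc hb‖ ≤ ‖packetLp hβ k n hw hc hb - packetLp hβ k m hw hc hb‖ := by
  have h0 : inner ℂ (packetLp hβ k n hw hc hb) (packetLp hβ k m hw hc hb) = 0 := by
    rw [packetLp, packetLp, inner_tensorLp, integral_eq_zero_of_ae, zero_mul]
    refine ae_of_all _ fun ξ => ?_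
    rcases lt_or_gt_of_ne hnm with h | h
    · rcases packet_mul_eq_zero k hs h ξ with h | h <;> simp [h]
    · rcases packet_mul_eq_zero k hs h ξ with h | h <;> simp [h]
  have h1 := norm_sub_sq (𝕜 := ℂ) (packetLp hβ k n hw hc hb) (packetLp hβ k m hw hc hb)
  rw [h0, map_zero, mul_zero, sub_zero] at h1
  refine abs_le_of_sq_le_sq' ?_ (norm_nonneg _) |>.2
  rw [h1]
  exact le_add_of_nonneg_right (sq_nonneg _)

lemma mulDeriv_packetLp (hδ : 0 < δ) (hβ : ContDiffOn ℝ 1 β (Icc 0 δ)) (k : ℝ) (n : ℕ)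
    (hw : ContDiff ℝ (⊤ : ℕ∞) w) (hc : HasCompactSupport w) (hb : ContinuousOn b (Icc 0 δ))
    (hb' : ContinuousOn (fun η => ((derivWithin β (Icc 0 δ) η : ℝ) : ℂ) * b η) (Icc 0 δ)) :
    mulDeriv hδ hβ (packetLp hβ.continuousOn k n hw hc hb)
      = packetLp hβ.continuousOn k n hw hc hb' := by
  refine Lp.ext ((stripMeasure_ac β δ).ae_le ?_)
  filter_upwards [mulDeriv_coeFn hδ hβ (packetLp hβ.continuousOn k n hw hc hb),
    tensorLp_coeFn hβ.continuousOn (continuous_packet k (n + 1) ((n : ℝ) ^ 2) hw.continuous)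
      (hasCompactSupport_packet k (by positivity) _ hc) hb,
    tensorLp_coeFn hβ.continuousOn (continuous_packet k (n + 1) ((n : ℝ) ^ 2) hw.continuous)
      (hasCompactSupport_packet k (by positivity) _ hc) hb'] with z h1 h2 h3
  rw [h1, packetLp, packetLp, h2, h3]
  ring

/-- The `j`-th derivative of a bump function supported in `[0, 1]`. -/
def bumpDeriv (j : ℕ) : ℝ → ℝ :=
  deriv^[j] (⟨1 / 4, 1 / 2, by norm_num, by norm_num⟩ : ContDiffBump (1 / 2 : ℝ))

lemma deriv_bumpDeriv (j : ℕ) : deriv (bumpDeriv j) = bumpDeriv (j + 1) :=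
  (Function.iterate_succ_apply' deriv j _).symm

lemma contDiff_bumpDeriv (j : ℕ) : ContDiff ℝ (⊤ : ℕ∞) (bumpDeriv j) := by
  induction j with
  | zero => exact ContDiffBump.contDiff _
  | succ j ih => rw [← deriv_bumpDeriv]; exact (contDiff_infty_iff_deriv.1 ih).2

lemma hasCompactSupport_bumpDeriv (j : ℕ) : HasCompactSupport (bumpDeriv j) := by
  induction j with
  | zero => exact ContDiffBump.hasCompactSupport _
  | succ j ih => rw [← deriv_bumpDeriv]; exact ih.deriv

lemma bumpDeriv_zero_eq_zero {s : ℝ} (hs : s ∉ Ioo (0 : ℝ) 1) : bumpDeriv 0 s = 0 := by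
  refine ContDiffBump.zero_of_le_dist _ ?_
  by_contra hcon
  rw [not_le, Real.dist_eq, abs_lt] at hcon
  exact hs ⟨by linarith [hcon.1], by linarith [hcon.2]⟩

lemma bumpDeriv_zero_ne_zero : bumpDeriv 0 (1 / 2) ≠ 0 := by
  have : bumpDeriv 0 (1 / 2) = 1 :=
    ContDiffBump.one_of_mem_closedBall _ (Metric.mem_closedBall_self (by norm_num))
  rw [this]
  exact one_ne_zero

/-- The product of a wave packet and `b(η)`. -/
def wave (hβ : ContinuousOn β (Icc 0 δ)) (k : ℝ) (j n : ℕ) (hb : ContinuousOn b (Icc 0 δ)) :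
    L2h β δ :=
  packetLp hβ k n (contDiff_bumpDeriv j) (hasCompactSupport_bumpDeriv j) hb

lemma hasWeakPartial_wave (hβ : ContinuousOn β (Icc 0 δ)) (k : ℝ) (j n : ℕ)
    (hb : ContinuousOn b (Icc 0 δ)) :
    HasWeakPartial δ (1, 0) (wave hβ k j n hb)
      (((((n : ℝ) + 1 : ℝ) : ℂ)⁻¹ • wave hβ k (j + 1) n hb
        + (Complex.I * k) • wave hβ k j n hb : L2h β δ)) := by
  have h := hasWeakPartial_packetLp hβ k n (contDiff_bumpDeriv j) (hasCompactSupport_bumpDeriv j)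
    (deriv_bumpDeriv j ▸ contDiff_bumpDeriv (j + 1))
    (deriv_bumpDeriv j ▸ hasCompactSupport_bumpDeriv (j + 1)) hb
  simp only [deriv_bumpDeriv] at h
  exact h

lemma wave_coeFn (hβ : ContinuousOn β (Icc 0 δ)) (k : ℝ) (j n : ℕ)
    (hb : ContinuousOn b (Icc 0 δ)) : wave hβ k j n hb =ᵐ[volume.restrict (strip δ)]
      fun z => packet k (n + 1) ((n : ℝ) ^ 2) (bumpDeriv j) z.1 * b z.2 :=
  tensorLp_coeFn hβ (continuous_packet k (n + 1) ((n : ℝ) ^ 2) (contDiff_bumpDeriv j).continuous)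
    (hasCompactSupport_packet k (by positivity) _ (hasCompactSupport_bumpDeriv j)) hb

lemma byParts_wave (hδ : 0 < δ) (hβ : ContinuousOn β (Icc 0 δ)) (k : ℝ) (j n : ℕ) {b' : ℝ → ℂ}
    (hb : ContinuousOn b (Icc 0 δ)) (hb' : ContinuousOn b' (Icc 0 δ))
    (hd : ∀ η ∈ Ioo 0 δ, HasDerivAt b (b' η) η) {U : Set (ℝ × ℝ)}
    (h0 : b 0 = 0 ∨ ∀ ξ, (ξ, 0) ∉ U) (h1 : b δ = 0 ∨ ∀ ξ, (ξ, δ) ∉ U) :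
    ByParts δ U (0, 1) (wave hβ k j n hb) (wave hβ k j n hb') :=
  byParts_packetLp hδ hβ k n (contDiff_bumpDeriv j) (hasCompactSupport_bumpDeriv j) hb hb' hd h0 h1

lemma mulDeriv_wave (hδ : 0 < δ) (hβ : ContDiffOn ℝ 1 β (Icc 0 δ)) (k : ℝ) (j n : ℕ)
    (hb : ContinuousOn b (Icc 0 δ))
    (hb' : ContinuousOn (fun η => ((derivWithin β (Icc 0 δ) η : ℝ) : ℂ) * b η) (Icc 0 δ)) :
    mulDeriv hδ hβ (wave hβ.continuousOn k j n hb) = wave hβ.continuousOn k j n hb' :=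
  mulDeriv_packetLp hδ hβ k n (contDiff_bumpDeriv j) (hasCompactSupport_bumpDeriv j) hb hb'

/-- The approximate solution with number `n`, with its derivatives. -/
def waveTuple (hβ : ContinuousOn β (Icc 0 δ)) (k : ℝ) {φ₀ φ₁ φ₂ : ℝ → ℂ}
    (c0 : ContinuousOn φ₀ (Icc 0 δ)) (c1 : ContinuousOn φ₁ (Icc 0 δ))
    (c2 : ContinuousOn φ₂ (Icc 0 δ)) (n : ℕ) : Fin 6 → L2h β δ :=
  let r : ℂ := (((n : ℝ) + 1 : ℝ) : ℂ)⁻¹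
  let q : ℂ := Complex.I * k
  ![wave hβ k 0 n c0, r • wave hβ k 1 n c0 + q • wave hβ k 0 n c0, wave hβ k 0 n c1,
    r • (r • wave hβ k 2 n c0 + q • wave hβ k 1 n c0)
      + q • (r • wave hβ k 1 n c0 + q • wave hβ k 0 n c0),
    r • wave hβ k 1 n c1 + q • wave hβ k 0 n c1, wave hβ k 0 n c2]

lemma ByParts.linear_comb (hβ : ContinuousOn β (Icc 0 δ)) {U : Set (ℝ × ℝ)} {v : ℝ × ℝ}
    {f g f' g' : L2h β δ} (h : ByParts δ U v f g) (h' : ByParts δ U v f' g') (x y : ℂ) :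
    ByParts δ U v (x • f + y • f' : L2h β δ) (x • g + y • g' : L2h β δ) := by
  have a : (f, g) ∈ byPartsSubmodule hβ U v := h
  have a' : (f', g') ∈ byPartsSubmodule hβ U v := h'
  have := (byPartsSubmodule hβ U v).add_mem (x := (x • f, x • g)) (y := (y • f', y • g'))
    ((byPartsSubmodule hβ U v).smul_mem x a) ((byPartsSubmodule hβ U v).smul_mem y a')
  exact this

variable {ω k : ℝ} {φ₀ φ₁ φ₂ : ℝ → ℂ}

lemma IsMode.waveTuple_mem (hδ : 0 < δ) (hβ : ContDiffOn ℝ 1 β (Icc 0 δ))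
    (h : IsMode β δ ω k φ₀ φ₁ φ₂) (n : ℕ) :
    waveTuple hβ.continuousOn k h.continuousOn₀ h.continuousOn₁ h.continuousOn₂ n ∈ domain hβ := by
  have hβc := hβ.continuousOn
  have hlow : ∀ ξ : ℝ, (ξ, δ) ∉ {z : ℝ × ℝ | z.2 < δ} := fun ξ => by simp
  have hupp : ∀ ξ : ℝ, (ξ, (0 : ℝ)) ∉ {z : ℝ × ℝ | 0 < z.2} := fun ξ => by simp
  have hst0 : ∀ ξ : ℝ, (ξ, (0 : ℝ)) ∉ strip δ := fun ξ => by simp [strip]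
  have hst1 : ∀ ξ : ℝ, (ξ, δ) ∉ strip δ := fun ξ => by simp [strip]
  have c0 := h.continuousOn₀
  have c1 := h.continuousOn₁
  have c2 := h.continuousOn₂
  have e0 : ∀ j, ByParts δ (strip δ) (0, 1) (wave hβc k j n c0) (wave hβc k j n c1) := fun j =>
    byParts_wave hδ hβc k j n c0 c1 h.hasDerivAt₀ (Or.inr hst0) (Or.inr hst1)
  have w0 := hasWeakPartial_wave hβc k 0 n c0
  have w1 := hasWeakPartial_wave hβc k 1 n c0
  have f3 := ByParts.linear_comb hβc w1 w0 (((n : ℝ) + 1 : ℝ) : ℂ)⁻¹ (Complex.I * k)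
  have f4 := ByParts.linear_comb hβc (e0 1) (e0 0) (((n : ℝ) + 1 : ℝ) : ℂ)⁻¹ (Complex.I * k)
  have f5 := byParts_wave hδ hβc k 0 n c1 c2 h.hasDerivAt₁ (Or.inr hst0) (Or.inr hst1)
  have f6 := byParts_wave hδ hβc k 0 n c0 c1 h.hasDerivAt₀ (Or.inl h.lower) (Or.inr hlow)
  have f7 := byParts_wave hδ hβc k 0 n c1 c2 h.hasDerivAt₁ (Or.inr hupp) (Or.inl h.upper)
  exact ⟨w0, e0 0, f3, f4, f5, f6, f7⟩

/-- The terms in which no derivative falls on the envelope cancel by the mode equation. Every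
remaining term carries a factor `1 / (n + 1)` from the width of the packet. -/
lemma IsMode.pencil_waveTuple (hδ : 0 < δ) (hβ : ContDiffOn ℝ 1 β (Icc 0 δ))
    (h : IsMode β δ ω k φ₀ φ₁ φ₂)
    (cB : ContinuousOn (fun η => ((derivWithin β (Icc 0 δ) η : ℝ) : ℂ) * φ₀ η) (Icc 0 δ)) (n : ℕ) :
    pencil hδ hβ ω ⟨_, h.waveTuple_mem hδ hβ n⟩
      = (((n : ℝ) + 1 : ℝ) : ℂ)⁻¹ • (-(ω : ℂ) • ((((n : ℝ) + 1 : ℝ) : ℂ)⁻¹ •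
          wave hβ.continuousOn k 2 n h.continuousOn₀
          + (2 * Complex.I * k) • wave hβ.continuousOn k 1 n h.continuousOn₀)
        + Complex.I • wave hβ.continuousOn k 1 n cB) := by
  have hβc := hβ.continuousOn
  rw [pencil_apply]
  have cB1 : ContinuousOn (fun η => ((derivWithin β (Icc 0 δ) η : ℝ) : ℂ) * φ₁ η) (Icc 0 δ) :=
    (Complex.continuous_ofReal.comp_continuousOn (continuousOn_derivWithin hδ hβ)).mul
      h.continuousOn₁
  set r : ℂ := (((n : ℝ) + 1 : ℝ) : ℂ)⁻¹ with hr
  change (ω : ℂ) • (-(r • (r • wave hβc k 2 n h.continuousOn₀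
      + (Complex.I * k) • wave hβc k 1 n h.continuousOn₀)
      + (Complex.I * k) • (r • wave hβc k 1 n h.continuousOn₀
      + (Complex.I * k) • wave hβc k 0 n h.continuousOn₀))
      + (-wave hβc k 0 n h.continuousOn₂ + mulDeriv hδ hβ (wave hβc k 0 n h.continuousOn₁)))
    + Complex.I • mulDeriv hδ hβ (r • wave hβc k 1 n h.continuousOn₀
      + (Complex.I * k) • wave hβc k 0 n h.continuousOn₀) = _
  have m0 : ∀ j, mulDeriv hδ hβ (wave hβc k j n h.continuousOn₀) = wave hβc k j n cB :=
    fun j => mulDeriv_wave hδ hβ k j n h.continuousOn₀ cB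
  have m1 : mulDeriv hδ hβ (wave hβc k 0 n h.continuousOn₁) = wave hβc k 0 n cB1 :=
    mulDeriv_wave hδ hβ k 0 n h.continuousOn₁ cB1
  rw [map_add, map_smul, map_smul, m0, m0, m1]
  have key : (ω : ℂ) • ((k : ℂ) ^ 2 • wave hβc k 0 n h.continuousOn₀
      + (-wave hβc k 0 n h.continuousOn₂ + wave hβc k 0 n cB1))
      = (k : ℂ) • wave hβc k 0 n cB := by
    have a := volume_ac_stripMeasure hβc
    refine Lp.ext ((stripMeasure_ac β δ).ae_le ?_)
    filter_upwards [wave_coeFn hβc k 0 n h.continuousOn₀, wave_coeFn hβc k 0 n h.continuousOn₂, wave_coeFn hβc k 0 n cB1, wave_coeFn hβc k 0 n cB,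
      a.ae_le (Lp.coeFn_smul (ω : ℂ) ((k : ℂ) ^ 2 • wave hβc k 0 n h.continuousOn₀
      + (-wave hβc k 0 n h.continuousOn₂ + wave hβc k 0 n cB1))),
      a.ae_le (Lp.coeFn_add ((k : ℂ) ^ 2 • wave hβc k 0 n h.continuousOn₀)
        (-wave hβc k 0 n h.continuousOn₂ + wave hβc k 0 n cB1)),
      a.ae_le (Lp.coeFn_add (-wave hβc k 0 n h.continuousOn₂) (wave hβc k 0 n cB1)),
      a.ae_le (Lp.coeFn_neg (wave hβc k 0 n h.continuousOn₂)),
      a.ae_le (Lp.coeFn_smul ((k : ℂ) ^ 2) (wave hβc k 0 n h.continuousOn₀)),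
      a.ae_le (Lp.coeFn_smul (k : ℂ) (wave hβc k 0 n cB)),
      ae_restrict_mem (measurableSet_strip δ)] with z t1 t2 t3 t4 a1 a2 a3 a4 a5 a6 hz
    rw [a1, Pi.smul_apply, a2, Pi.add_apply, a3, Pi.add_apply, a4, Pi.neg_apply, a5,
      Pi.smul_apply, a6, Pi.smul_apply, t1, t2, t3, t4]
    have e := h.eqn z.2 hz
    rw [← derivWithin_eq_deriv hz] at e
    simp only [smul_eq_mul]
    linear_combination packet k (n + 1) ((n : ℝ) ^ 2) (bumpDeriv 0) z.1 * e
  have hI : Complex.I * Complex.I = -1 := Complex.I_mul_I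
  have key' : (ω : ℂ) • (-wave hβc k 0 n h.continuousOn₂ + wave hβc k 0 n cB1)
      = (k : ℂ) • wave hβc k 0 n cB - ((ω : ℂ) * (k : ℂ) ^ 2) • wave hβc k 0 n h.continuousOn₀ := by
    rw [← key, ← smul_smul, smul_add (ω : ℂ) ((k : ℂ) ^ 2 • wave hβc k 0 n h.continuousOn₀)]
    abel
  rw [smul_add, key']
  match_scalars
  · ring
  · ring
  · linear_combination (-(ω : ℂ) * k ^ 2) * hI
  · linear_combination (k : ℂ) * hI
  · ring

lemma norm_wave (hβ : ContinuousOn β (Icc 0 δ)) (k : ℝ) (j n : ℕ)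
    (hb : ContinuousOn b (Icc 0 δ)) : ‖wave hβ k j n hb‖ = ‖wave hβ k j 0 hb‖ := by
  rw [wave, wave, norm_packetLp, norm_packetLp]

lemma integral_exp_mul_norm_sq_pos (hβ : ContinuousOn β (Icc 0 δ)) (hb : ContinuousOn b (Icc 0 δ))
    {η₀ : ℝ} (hη₀ : η₀ ∈ Ioo 0 δ) (hne : b η₀ ≠ 0) :
    0 < ∫ η in Ioo 0 δ, Real.exp (-β η) * ‖b η‖ ^ 2 := by
  have hc : ContinuousOn (fun η => Real.exp (-β η) * ‖b η‖ ^ 2) (Icc 0 δ) :=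
    (continuousOn_exp_neg hβ).mul (hb.norm.pow 2)
  rw [setIntegral_pos_iff_support_of_nonneg_ae (ae_of_all _ fun η => by positivity)
    ((hc.integrableOn_compact isCompact_Icc).mono_set Ioo_subset_Icc_self)]
  have hopen : IsOpen (Ioo 0 δ ∩ (fun η => Real.exp (-β η) * ‖b η‖ ^ 2) ⁻¹' {0}ᶜ) :=
    (hc.mono Ioo_subset_Icc_self).isOpen_inter_preimage isOpen_Ioo isOpen_compl_singleton
  rw [inter_comm]
  exact hopen.measure_pos volume ⟨η₀, hη₀, by simp [hne]⟩

lemma norm_wave_pos (hβ : ContinuousOn β (Icc 0 δ)) (k : ℝ) (n : ℕ)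
    (hb : ContinuousOn b (Icc 0 δ)) {η₀ : ℝ} (hη₀ : η₀ ∈ Ioo 0 δ) (hne : b η₀ ≠ 0) :
    0 < ‖wave hβ k 0 n hb‖ := by
  rw [wave, norm_packetLp, Real.sqrt_pos]
  refine mul_pos ?_ (integral_exp_mul_norm_sq_pos hβ hb hη₀ hne)
  have hc : Continuous fun s => bumpDeriv 0 s ^ 2 := (contDiff_bumpDeriv 0).continuous.pow 2
  refine hc.integral_pos_of_hasCompactSupport_nonneg_nonzero (x := 1 / 2)
    ((hasCompactSupport_bumpDeriv 0).comp_left (g := fun s : ℝ => s ^ 2) (by simp))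
    (fun s => sq_nonneg _) (pow_ne_zero 2 bumpDeriv_zero_ne_zero)

lemma norm_smul_add_smul_le {E : Type*} [NormedAddCommGroup E] [NormedSpace ℂ E] {r : ℂ}
    (hr : ‖r‖ ≤ 1) (q : ℂ) {x y : E} {X Y : ℝ} (hx : ‖x‖ ≤ X) (hy : ‖y‖ ≤ Y) :
    ‖r • x + q • y‖ ≤ X + ‖q‖ * Y := by
  refine (norm_add_le _ _).trans (add_le_add ?_ ?_)
  · rw [norm_smul]
    exact (mul_le_of_le_one_left (norm_nonneg _) hr).trans hx
  · rw [norm_smul]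
    gcongr

/-- Inside the spectral interval the pencil has a singular sequence. -/
theorem IsMode.not_isFredholm (hδ : 0 < δ) (hβ : ContDiffOn ℝ 1 β (Icc 0 δ))
    (h : IsMode β δ ω k φ₀ φ₁ φ₂) : ¬ (pencil hδ hβ ω).IsFredholm := by
  have hβc := hβ.continuousOn
  obtain ⟨η₀, hη₀, hne⟩ := h.ne_zero
  have c0 := h.continuousOn₀
  have c1 := h.continuousOn₁
  have c2 := h.continuousOn₂
  have cB : ContinuousOn (fun η => ((derivWithin β (Icc 0 δ) η : ℝ) : ℂ) * φ₀ η) (Icc 0 δ) :=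
    (Complex.continuous_ofReal.comp_continuousOn (continuousOn_derivWithin hδ hβ)).mul c0
  have hr : ∀ n : ℕ, ‖(((n : ℝ) + 1 : ℝ) : ℂ)⁻¹‖ = 1 / ((n : ℝ) + 1) := by
    intro n
    rw [norm_inv, Complex.norm_real, Real.norm_of_nonneg (by positivity), one_div]
  have hr1 : ∀ n : ℕ, ‖(((n : ℝ) + 1 : ℝ) : ℂ)⁻¹‖ ≤ 1 := by
    intro n
    rw [hr, div_le_one (by positivity)]
    linarith [(Nat.cast_nonneg n : (0 : ℝ) ≤ n)]
  have hN : ∀ {b : ℝ → ℂ} (hb : ContinuousOn b (Icc 0 δ)) (j n : ℕ),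
      ‖wave hβc k j n hb‖ ≤ ‖wave hβc k j 0 hb‖ := fun hb j n => (norm_wave hβc k j n hb).le
  set q : ℂ := Complex.I * k
  have b1 := fun n => norm_smul_add_smul_le (hr1 n) q (hN c0 1 n) (hN c0 0 n)
  have b3 := fun n => norm_smul_add_smul_le (hr1 n) q
    (norm_smul_add_smul_le (hr1 n) q (hN c0 2 n) (hN c0 1 n)) (b1 n)
  have b4 := fun n => norm_smul_add_smul_le (hr1 n) q (hN c1 1 n) (hN c1 0 n)
  have hb : ∀ i : Fin 6, ∃ M, ∀ n, ‖waveTuple hβc k c0 c1 c2 n i‖ ≤ M := by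
    intro i
    fin_cases i
    exacts [⟨_, hN c0 0⟩, ⟨_, b1⟩, ⟨_, hN c1 0⟩, ⟨_, b3⟩, ⟨_, b4⟩, ⟨_, hN c2 0⟩]
  choose M hM using hb
  -- Every entry is bounded independently of `n`; separation is read off from entry `0` alone, whose
  -- norm does not depend on `n`.
  refine not_isFredholm_of_seq (x := fun n => ⟨_, h.waveTuple_mem hδ hβ n⟩) (M := ∑ i, |M i|)
    (c := ‖wave hβc k 0 0 c0‖) ?_ (norm_wave_pos hβc k 0 c0 hη₀ hne) ?_ ?_
  · intro n
    refine (pi_norm_le_iff_of_nonneg (by positivity)).2 fun i => (hM i n).trans ?_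
    exact (le_abs_self _).trans
      (Finset.single_le_sum (f := fun i => |M i|) (fun i _ => abs_nonneg _) (Finset.mem_univ i))
  · intro n m hnm
    refine (norm_wave hβc k 0 n c0).ge.trans ((le_norm_packetLp_sub hβc k (contDiff_bumpDeriv 0)
      (hasCompactSupport_bumpDeriv 0) c0 (fun s hs => bumpDeriv_zero_eq_zero hs) hnm).trans ?_)
    exact norm_le_pi_norm (waveTuple hβc k c0 c1 c2 n - waveTuple hβc k c0 c1 c2 m) 0
  · simp only [h.pencil_waveTuple hδ hβ cB]
    refine squeeze_zero_norm (a := fun n : ℕ => 1 / ((n : ℝ) + 1) *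
      (‖-(ω : ℂ)‖ * (‖wave hβc k 2 0 c0‖ + ‖2 * Complex.I * k‖ * ‖wave hβc k 1 0 c0‖)
        + ‖Complex.I‖ * ‖wave hβc k 1 0 cB‖)) (fun n => ?_) ?_
    · rw [norm_smul, hr]
      gcongr
      refine (norm_add_le _ _).trans ?_
      rw [norm_smul, norm_smul]
      gcongr
      · exact norm_smul_add_smul_le (hr1 n) _ (hN c0 2 n) (hN c0 1 n)
      · exact hN cB 1 n
    · have t := fun K : ℝ => (tendsto_one_div_add_atTop_nhds_zero_nat (𝕜 := ℝ)).mul_const K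
      simp only [zero_mul] at t
      exact t _

end Weyl

/-! ### The partial Fourier transform of a test function -/

section PartialFourier

open FourierTransform

variable {β : ℝ → ℝ} {δ : ℝ} {φ ψ : ℝ × ℝ → ℂ}

/-- The Fourier transform in the variable `ξ`. -/
def pfourier (ψ : ℝ × ℝ → ℂ) (k η : ℝ) : ℂ := 𝓕 (fun ξ => ψ (ξ, η)) k

lemma pfourier_eq (ψ : ℝ × ℝ → ℂ) (k η : ℝ) :
    pfourier ψ k η = ∫ ξ, Complex.exp (↑(-2 * Real.pi * ξ * k) * Complex.I) * ψ (ξ, η) :=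
  Real.fourier_real_eq_integral_exp_smul _ _

lemma hasCompactSupport_slice_fst (hc : HasCompactSupport ψ) (η : ℝ) :
    HasCompactSupport fun ξ => ψ (ξ, η) := by
  refine HasCompactSupport.intro (hc.isCompact.image continuous_fst) (K := Prod.fst '' tsupport ψ)
    fun ξ hξ => ?_
  exact image_eq_zero_of_notMem_tsupport fun h => hξ ⟨(ξ, η), h, rfl⟩

lemma hasDerivAt_slice_fst (hψ : ContDiff ℝ (⊤ : ℕ∞) ψ) (ξ η : ℝ) :
    HasDerivAt (fun ξ => ψ (ξ, η)) (fderiv ℝ ψ (ξ, η) (1, 0)) ξ :=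
  ((hψ.differentiable (by simp)) (ξ, η)).hasFDerivAt.comp_hasDerivAt ξ
    ((hasDerivAt_id ξ).prodMk (hasDerivAt_const ξ η))

lemma hasDerivAt_slice_snd (hψ : ContDiff ℝ (⊤ : ℕ∞) ψ) (ξ η : ℝ) :
    HasDerivAt (fun η => ψ (ξ, η)) (fderiv ℝ ψ (ξ, η) (0, 1)) η :=
  ((hψ.differentiable (by simp)) (ξ, η)).hasFDerivAt.comp_hasDerivAt η
    ((hasDerivAt_const η ξ).prodMk (hasDerivAt_id η))

lemma contDiff_fderiv_apply (hψ : ContDiff ℝ (⊤ : ℕ∞) ψ) (v : ℝ × ℝ) :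
    ContDiff ℝ (⊤ : ℕ∞) fun z => fderiv ℝ ψ z v :=
  (hψ.fderiv_right (m := (⊤ : ℕ∞)) (by simp)).clm_apply contDiff_const

lemma continuous_pfourier (hψ : Continuous ψ) (hc : HasCompactSupport ψ) :
    Continuous fun p : ℝ × ℝ => pfourier ψ p.1 p.2 := by
  have h := continuous_parametric_integral_of_continuous (μ := volume)
    (f := fun (p : ℝ × ℝ) (ξ : ℝ) =>
      Complex.exp (↑(-2 * Real.pi * ξ * p.1) * Complex.I) * ψ (ξ, p.2))
    (by simp only [Function.uncurry_def]; fun_prop) (hc.isCompact.image continuous_fst)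
  convert h using 2 with p
  rw [pfourier_eq, setIntegral_eq_integral_of_forall_compl_eq_zero]
  intro ξ hξ
  rw [image_eq_zero_of_notMem_tsupport fun hm => hξ ⟨(ξ, p.2), hm, rfl⟩, mul_zero]

lemma hasDerivAt_pfourier (hψ : ContDiff ℝ (⊤ : ℕ∞) ψ) (hc : HasCompactSupport ψ) (k η : ℝ) :
    HasDerivAt (pfourier ψ k) (pfourier (fun z => fderiv ℝ ψ z (0, 1)) k η) η := by
  have hd := (contDiff_fderiv_apply hψ (0, 1)).continuous
  have hdc : HasCompactSupport fun z => fderiv ℝ ψ z (0, 1) := hc.fderiv_apply (𝕜 := ℝ) _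
  have hψc := hψ.continuous
  obtain ⟨C, hC⟩ := hd.bounded_above_of_compact_support hdc
  have hK : IsCompact (Prod.fst '' tsupport ψ) := hc.isCompact.image continuous_fst
  rw [funext (pfourier_eq ψ k), pfourier_eq]
  refine (hasDerivAt_integral_of_dominated_loc_of_deriv_le
    (F := fun η ξ => Complex.exp (↑(-2 * Real.pi * ξ * k) * Complex.I) * ψ (ξ, η))
    (F' := fun η ξ => Complex.exp (↑(-2 * Real.pi * ξ * k) * Complex.I)
      * fderiv ℝ ψ (ξ, η) (0, 1))
    (bound := (Prod.fst '' tsupport ψ).indicator fun _ => C) univ_mem ?_ ?_ ?_ ?_ ?_ ?_).2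
  · exact Eventually.of_forall fun η => Continuous.aestronglyMeasurable (by fun_prop)
  · exact Continuous.integrable_of_hasCompactSupport (by fun_prop)
      (hasCompactSupport_slice_fst hc η).mul_left
  · exact Continuous.aestronglyMeasurable (by fun_prop)
  · refine ae_of_all _ fun ξ t _ => ?_
    rw [norm_mul, Complex.norm_exp_ofReal_mul_I, one_mul]
    by_cases hξ : ξ ∈ Prod.fst '' tsupport ψ
    · rw [indicator_of_mem hξ]
      exact hC _
    · rw [indicator_of_notMem hξ, image_eq_zero_of_notMem_tsupport
        (f := fun z => fderiv ℝ ψ z (0, 1)), norm_zero]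
      exact fun hm => hξ ⟨(ξ, t), tsupport_fderiv_apply_subset ℝ _ hm, rfl⟩
  · exact (integrable_indicator_iff hK.measurableSet).2 (integrableOn_const hK.measure_lt_top.ne)
  · exact ae_of_all _ fun ξ t _ => (hasDerivAt_slice_snd hψ ξ t).const_mul _

lemma contDiff_pfourier (hψ : ContDiff ℝ (⊤ : ℕ∞) ψ) (hc : HasCompactSupport ψ) (k : ℝ) :
    ContDiff ℝ (⊤ : ℕ∞) (pfourier ψ k) := by
  rw [contDiff_infty]
  intro n
  induction n generalizing ψ with
  | zero =>
    rw [Nat.cast_zero, contDiff_zero]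
    exact (continuous_pfourier hψ.continuous hc).comp (by fun_prop : Continuous fun η => (k, η))
  | succ n ih =>
    rw [Nat.cast_succ, contDiff_succ_iff_deriv]
    refine ⟨fun η => (hasDerivAt_pfourier hψ hc k η).differentiableAt, by simp, ?_⟩
    rw [funext fun η => (hasDerivAt_pfourier hψ hc k η).deriv]
    exact ih (contDiff_fderiv_apply hψ _) (hc.fderiv_apply (𝕜 := ℝ) _)

lemma pfourier_fderiv_fst (hψ : ContDiff ℝ (⊤ : ℕ∞) ψ) (hc : HasCompactSupport ψ) (k η : ℝ) :
    pfourier (fun z => fderiv ℝ ψ z (1, 0)) k η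
      = (2 * Real.pi * Complex.I * k) * pfourier ψ k η := by
  have hψc := hψ.continuous
  have hd := (contDiff_fderiv_apply hψ (1, 0)).continuous
  have e : deriv (fun ξ => ψ (ξ, η)) = fun ξ => fderiv ℝ ψ (ξ, η) (1, 0) :=
    funext fun ξ => (hasDerivAt_slice_fst hψ ξ η).deriv
  have h := Real.fourier_deriv (f := fun ξ => ψ (ξ, η))
    (Continuous.integrable_of_hasCompactSupport (by fun_prop) (hasCompactSupport_slice_fst hc η))
    (fun ξ => (hasDerivAt_slice_fst hψ ξ η).differentiableAt) (by
      rw [e]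
      exact Continuous.integrable_of_hasCompactSupport (by fun_prop)
        (hasCompactSupport_slice_fst (ψ := fun z => fderiv ℝ ψ z (1, 0))
          (hc.fderiv_apply (𝕜 := ℝ) _) η))
  rw [e] at h
  exact congrFun h k

/-- The slice of a test function as a Schwartz function. -/
def sliceSchwartz (hψ : ContDiff ℝ (⊤ : ℕ∞) ψ) (hc : HasCompactSupport ψ) (η : ℝ) :
    SchwartzMap ℝ ℂ :=
  (hasCompactSupport_slice_fst hc η).toSchwartzMap (hψ.comp (contDiff_id.prodMk contDiff_const))

lemma pfourier_eq_sliceSchwartz (hψ : ContDiff ℝ (⊤ : ℕ∞) ψ) (hc : HasCompactSupport ψ)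
    (k η : ℝ) : pfourier ψ k η = 𝓕 (sliceSchwartz hψ hc η) k := rfl

lemma integral_conj_pfourier_mul (hφ : ContDiff ℝ (⊤ : ℕ∞) φ) (hφc : HasCompactSupport φ)
    (hψ : ContDiff ℝ (⊤ : ℕ∞) ψ) (hc : HasCompactSupport ψ) (η : ℝ) :
    ∫ k, conj (pfourier φ k η) * pfourier ψ k η = ∫ ξ, conj (φ (ξ, η)) * ψ (ξ, η) := by
  have h := SchwartzMap.integral_inner_fourier_fourier (sliceSchwartz hφ hφc η)
    (sliceSchwartz hψ hc η)
  simp only [RCLike.inner_apply, ← pfourier_eq_sliceSchwartz] at h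
  simp only [mul_comm (conj _)]
  exact h

lemma integrable_norm_sq_pfourier (hψ : ContDiff ℝ (⊤ : ℕ∞) ψ) (hc : HasCompactSupport ψ)
    (η : ℝ) : Integrable fun k => ‖pfourier ψ k η‖ ^ 2 := by
  simp only [pfourier_eq_sliceSchwartz hψ hc]
  have h := (𝓕 (sliceSchwartz hψ hc η)).memLp 2 volume
  exact (memLp_two_iff_integrable_sq_norm h.aestronglyMeasurable).1 h

lemma integral_norm_sq_pfourier (hψ : ContDiff ℝ (⊤ : ℕ∞) ψ) (hc : HasCompactSupport ψ)
    (η : ℝ) : ∫ k, ‖pfourier ψ k η‖ ^ 2 = ∫ ξ, ‖ψ (ξ, η)‖ ^ 2 :=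
  SchwartzMap.integral_norm_sq_fourier (sliceSchwartz hψ hc η)

lemma integrable_mul_test {f : ℝ × ℝ → ℂ} {σ : ℝ → ℝ} (hσ : ContinuousOn σ (Icc 0 δ))
    (hf : Continuous f) (hc : HasCompactSupport f) :
    Integrable (fun z => (σ z.2 : ℂ) * f z) (volume.prod (volume.restrict (Ioo 0 δ))) := by
  rw [← volume_restrict_strip]
  obtain ⟨C, hC⟩ := isCompact_Icc.exists_bound_of_continuousOn hσ
  refine (hf.integrable_of_hasCompactSupport hc).restrict.bdd_mul (c := C)
    (aestronglyMeasurable_of_continuousOn hσ) ?_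
  filter_upwards [ae_restrict_mem (measurableSet_strip δ)] with z hz
  simpa using hC z.2 ⟨hz.1.le, hz.2.le⟩

lemma aestronglyMeasurable_weight_snd {σ : ℝ → ℝ} (hσ : ContinuousOn σ (Icc 0 δ)) :
    AEStronglyMeasurable (fun p : ℝ × ℝ => (σ p.2 : ℂ))
      (volume.prod (volume.restrict (Ioo 0 δ))) := by
  rw [← volume_restrict_strip]
  exact aestronglyMeasurable_of_continuousOn hσ

/-- Plancherel on each slice turns the inner integral into that of `‖ψ(·, η)‖²`, which is integrable
in `η`; Tonelli then gives joint integrability. -/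
lemma integrable_norm_sq_pfourier_prod {σ : ℝ → ℝ} (hσ : ContinuousOn σ (Icc 0 δ))
    (hψ : ContDiff ℝ (⊤ : ℕ∞) ψ) (hc : HasCompactSupport ψ) :
    Integrable (fun p : ℝ × ℝ => (σ p.2 : ℂ) * ((‖pfourier ψ p.1 p.2‖ ^ 2 : ℝ) : ℂ))
      (volume.prod (volume.restrict (Ioo 0 δ))) := by
  have hF := continuous_pfourier hψ.continuous hc
  have hψc := hψ.continuous
  have hm : AEStronglyMeasurable
      (fun p : ℝ × ℝ => (σ p.2 : ℂ) * ((‖pfourier ψ p.1 p.2‖ ^ 2 : ℝ) : ℂ))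
      (volume.prod (volume.restrict (Ioo 0 δ))) :=
    (aestronglyMeasurable_weight_snd hσ).mul (by fun_prop : Continuous fun p : ℝ × ℝ =>
      ((‖pfourier ψ p.1 p.2‖ ^ 2 : ℝ) : ℂ)).aestronglyMeasurable
  refine (integrable_prod_iff' hm).2 ⟨ae_of_all _ fun η => (integrable_norm_sq_pfourier hψ hc η).ofReal.const_mul (σ η : ℂ), ?_⟩
  have h := (integrable_mul_test hσ
    (by fun_prop : Continuous fun z : ℝ × ℝ => ((‖ψ z‖ ^ 2 : ℝ) : ℂ))
    (hc.comp_left (g := fun w : ℂ => ((‖w‖ ^ 2 : ℝ) : ℂ)) (by simp))).swap.norm.integral_prod_left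
  refine h.congr (ae_of_all _ fun η => ?_)
  simp only [Function.comp_def, Prod.swap, norm_mul, Complex.norm_real, norm_pow, norm_norm]
  rw [integral_const_mul, integral_const_mul, integral_norm_sq_pfourier hψ hc]

/-- Plancherel's formula on the strip. -/
lemma integral_strip_conj_mul {σ : ℝ → ℝ} (hσ : ContinuousOn σ (Icc 0 δ))
    (hφ : ContDiff ℝ (⊤ : ℕ∞) φ) (hφc : HasCompactSupport φ)
    (hψ : ContDiff ℝ (⊤ : ℕ∞) ψ) (hc : HasCompactSupport ψ) :
    Integrable (fun p : ℝ × ℝ => (σ p.2 : ℂ) * (conj (pfourier φ p.1 p.2) * pfourier ψ p.1 p.2))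
      (volume.prod (volume.restrict (Ioo 0 δ))) ∧
    ∫ z in strip δ, (σ z.2 : ℂ) * (conj (φ z) * ψ z)
      = ∫ k, ∫ η in Ioo 0 δ, (σ η : ℂ) * (conj (pfourier φ k η) * pfourier ψ k η) := by
  have c1 := continuous_pfourier hφ.continuous hφc
  have c2 := continuous_pfourier hψ.continuous hc
  have hi : Integrable (fun p : ℝ × ℝ =>
      (σ p.2 : ℂ) * (conj (pfourier φ p.1 p.2) * pfourier ψ p.1 p.2))
      (volume.prod (volume.restrict (Ioo 0 δ))) := by
    refine Integrable.mono ((integrable_norm_sq_pfourier_prod hσ hφ hφc).norm.add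
      (integrable_norm_sq_pfourier_prod hσ hψ hc).norm) ((aestronglyMeasurable_weight_snd hσ).mul
      (by fun_prop : Continuous fun p : ℝ × ℝ =>
        conj (pfourier φ p.1 p.2) * pfourier ψ p.1 p.2).aestronglyMeasurable)
      (ae_of_all _ fun p => le_trans ?_ (Real.le_norm_self _))
    simp only [Pi.add_apply, norm_mul, Complex.norm_real, norm_pow, norm_norm, RCLike.norm_conj]
    rw [← mul_add]
    gcongr
    nlinarith [sq_nonneg (‖pfourier φ p.1 p.2‖ - ‖pfourier ψ p.1 p.2‖),
      sq_nonneg ‖pfourier φ p.1 p.2‖, sq_nonneg ‖pfourier ψ p.1 p.2‖]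
  refine ⟨hi, ?_⟩
  have hφc' := hφ.continuous
  have hψc' := hψ.continuous
  have hj := integrable_mul_test hσ (by fun_prop : Continuous fun z : ℝ × ℝ => conj (φ z) * ψ z)
    hc.mul_left
  rw [← integral_prod _ hi, integral_prod_symm _ hi, volume_restrict_strip,
    integral_prod_symm _ hj]
  refine integral_congr_ae (ae_of_all _ fun η => ?_)
  simp only
  rw [integral_const_mul, integral_const_mul, integral_conj_pfourier_mul hφ hφc hψ hc]

end PartialFourier

/-! ### Inequalities for test functions on the strip -/

section TestInequalities

variable {β : ℝ → ℝ} {δ : ℝ} {φ ψ : ℝ × ℝ → ℂ}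

lemma integral_strip_norm_sq {σ : ℝ → ℝ} (hσ : ContinuousOn σ (Icc 0 δ))
    (hψ : ContDiff ℝ (⊤ : ℕ∞) ψ) (hc : HasCompactSupport ψ) :
    Integrable (fun k => ∫ η in Ioo 0 δ, σ η * ‖pfourier ψ k η‖ ^ 2) ∧
    ∫ z in strip δ, σ z.2 * ‖ψ z‖ ^ 2
      = ∫ k, ∫ η in Ioo 0 δ, σ η * ‖pfourier ψ k η‖ ^ 2 := by
  obtain ⟨h1, h2⟩ := integral_strip_conj_mul hσ hψ hc hψ hc
  have e : ∀ (s : ℝ) (w : ℂ), (s : ℂ) * (conj w * w) = ((s * ‖w‖ ^ 2 : ℝ) : ℂ) := by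
    intro s w
    rw [← Complex.normSq_eq_conj_mul_self, Complex.normSq_eq_norm_sq, Complex.ofReal_mul]
  simp only [e, integral_complex_ofReal] at h1 h2
  refine ⟨?_, Complex.ofReal_injective h2⟩
  have h3 := h1.re.integral_prod_left
  refine h3.congr (ae_of_all _ fun k => ?_)
  simp only [RCLike.re_to_complex, Complex.ofReal_re]

lemma exists_pos_vanish (hc : HasCompactSupport ψ) (hs : tsupport ψ ⊆ {z | 0 < z.2}) :
    ∃ a > 0, ∀ ξ η, η < a → ψ (ξ, η) = 0 := by
  rcases (tsupport ψ).eq_empty_or_nonempty with h | h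
  · exact ⟨1, one_pos, fun ξ η _ => image_eq_zero_of_notMem_tsupport (by simp [h])⟩
  · obtain ⟨z, hz, hmin⟩ := hc.isCompact.exists_isMinOn h continuous_snd.continuousOn
    refine ⟨z.2, hs hz, fun ξ η hη => image_eq_zero_of_notMem_tsupport fun hm => ?_⟩
    exact absurd (hmin hm) (not_le.2 hη)

/-- The transform acts in `ξ` only, so vanishing near `η = 0` is inherited at every frequency and
the one-dimensional inequalities apply. -/
lemma memH10_pfourier (hβ : ContinuousOn β (Icc 0 δ)) (hψ : ContDiff ℝ (⊤ : ℕ∞) ψ)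
    (hc : HasCompactSupport ψ) (hs : tsupport ψ ⊆ {z | 0 < z.2}) (k : ℝ) :
    MemH10 β δ (pfourier ψ k) (pfourier (fun z => fderiv ℝ ψ z (0, 1)) k) := by
  obtain ⟨a, ha, h0⟩ := exists_pos_vanish hc hs
  have h := memH10_of_contDiff hβ (contDiff_pfourier hψ hc k) ha fun η hη => by
    simp [pfourier_eq, h0 _ η hη]
  rwa [funext fun η => (hasDerivAt_pfourier hψ hc k η).deriv] at h

lemma continuousOn_exp_neg_mul_derivWithin (hδ : 0 < δ) (hβ : ContDiffOn ℝ 1 β (Icc 0 δ)) :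
    ContinuousOn (fun η => Real.exp (-β η) * derivWithin β (Icc 0 δ) η) (Icc 0 δ) :=
  (continuousOn_exp_neg hβ.continuousOn).mul (continuousOn_derivWithin hδ hβ)

/-- The fundamental inequality for test functions that vanish near the lower boundary. -/
lemma norm_integral_test_le (hδ : 0 < δ) (hβ : ContDiffOn ℝ 1 β (Icc 0 δ))
    (hβ' : ∀ η ∈ Ioo 0 δ, 0 < deriv β η) (hψ : ContDiff ℝ (⊤ : ℕ∞) ψ)
    (hc : HasCompactSupport ψ) (hs : tsupport ψ ⊆ {z | 0 < z.2}) :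
    ‖∫ z in strip δ, ((Real.exp (-β z.2) * derivWithin β (Icc 0 δ) z.2 : ℝ) : ℂ)
        * (conj (ψ z) * fderiv ℝ ψ z (1, 0))‖
      ≤ omegaStar β δ * ((∫ z in strip δ, Real.exp (-β z.2) * ‖fderiv ℝ ψ z (0, 1)‖ ^ 2)
        + ∫ z in strip δ, Real.exp (-β z.2) * ‖fderiv ℝ ψ z (1, 0)‖ ^ 2) := by
  have hw := continuousOn_exp_neg hβ.continuousOn
  have hσ := continuousOn_exp_neg_mul_derivWithin hδ hβ
  have hψ1 := contDiff_fderiv_apply hψ (1, 0)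
  have hψ2 := contDiff_fderiv_apply hψ (0, 1)
  have hc1 : HasCompactSupport fun z => fderiv ℝ ψ z (1, 0) := hc.fderiv_apply (𝕜 := ℝ) _
  have hc2 : HasCompactSupport fun z => fderiv ℝ ψ z (0, 1) := hc.fderiv_apply (𝕜 := ℝ) _
  obtain ⟨i1, e1⟩ := integral_strip_norm_sq hw hψ1 hc1
  obtain ⟨i2, e2⟩ := integral_strip_norm_sq hw hψ2 hc2
  rw [(integral_strip_conj_mul hσ hψ hc hψ1 hc1).2, e1, e2, ← integral_add i2 i1,
    ← integral_const_mul]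
  refine norm_integral_le_of_norm_le ((i2.add i1).const_mul _) (ae_of_all _ fun k => ?_)
  -- The Fourier normalization `e^{-2πikξ}` makes `2πk` the wave number.
  have key := integral_le_omegaStar hδ hβ (memH10_pfourier hβ.continuousOn hψ hc hs k)
    (2 * Real.pi * k) (isLUB_omegaStar hδ hβ hβ').2.le
  have a1 : ∫ η in Ioo 0 δ, ((Real.exp (-β η) * derivWithin β (Icc 0 δ) η : ℝ) : ℂ)
      * (conj (pfourier ψ k η) * pfourier (fun z => fderiv ℝ ψ z (1, 0)) k η)
      = (2 * Real.pi * k : ℝ) * Complex.I *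
        ((∫ η in Ioo 0 δ, deriv β η * Real.exp (-β η) * ‖pfourier ψ k η‖ ^ 2 : ℝ) : ℂ) := by
    rw [← integral_complex_ofReal, ← integral_const_mul]
    refine setIntegral_congr_fun measurableSet_Ioo fun η hη => ?_
    rw [pfourier_fderiv_fst hψ hc, derivWithin_eq_deriv hη, Complex.ofReal_mul (_ * _),
      ← Complex.normSq_eq_norm_sq]
    have hq := Complex.normSq_eq_conj_mul_self (z := pfourier ψ k η)
    push_cast
    rw [hq]
    ring
  have a2 : ∫ η in Ioo 0 δ, Real.exp (-β η) * ‖pfourier (fun z => fderiv ℝ ψ z (1, 0)) k η‖ ^ 2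
      = (2 * Real.pi * k) ^ 2 * ∫ η in Ioo 0 δ, Real.exp (-β η) * ‖pfourier ψ k η‖ ^ 2 := by
    rw [← integral_const_mul]
    refine setIntegral_congr_fun measurableSet_Ioo fun η hη => ?_
    rw [pfourier_fderiv_fst hψ hc, norm_mul, mul_pow]
    have : ‖2 * (Real.pi : ℂ) * Complex.I * k‖ ^ 2 = (2 * Real.pi * k) ^ 2 := by
      rw [show 2 * (Real.pi : ℂ) * Complex.I * k = ((2 * Real.pi * k : ℝ) : ℂ) * Complex.I by
        push_cast; ring, norm_mul, Complex.norm_I, mul_one, Complex.norm_real, Real.norm_eq_abs,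
        sq_abs]
    rw [this]
    ring
  have hnn : 0 ≤ ∫ η in Ioo 0 δ, deriv β η * Real.exp (-β η) * ‖pfourier ψ k η‖ ^ 2 :=
    setIntegral_nonneg measurableSet_Ioo fun η hη => by
      have := hβ' η hη
      positivity
  rw [a1, norm_mul, norm_mul, Complex.norm_I, mul_one, Complex.norm_real, Complex.norm_real,
    Real.norm_of_nonneg hnn, Real.norm_eq_abs, a2]
  exact key

/-- Poincaré's inequality for test functions that vanish near the lower boundary. -/
lemma integral_test_le (hβ : ContinuousOn β (Icc 0 δ)) {C : ℝ}
    (hC : ∀ φ φ' : ℝ → ℂ, MemH10 β δ φ φ' → ∫ η in Ioo 0 δ, Real.exp (-β η) * ‖φ η‖ ^ 2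
        ≤ C * ∫ η in Ioo 0 δ, Real.exp (-β η) * ‖φ' η‖ ^ 2)
    (hψ : ContDiff ℝ (⊤ : ℕ∞) ψ) (hc : HasCompactSupport ψ) (hs : tsupport ψ ⊆ {z | 0 < z.2}) :
    ∫ z in strip δ, Real.exp (-β z.2) * ‖ψ z‖ ^ 2
      ≤ C * ∫ z in strip δ, Real.exp (-β z.2) * ‖fderiv ℝ ψ z (0, 1)‖ ^ 2 := by
  have hw := continuousOn_exp_neg hβ
  obtain ⟨i1, e1⟩ := integral_strip_norm_sq hw hψ hc
  obtain ⟨i2, e2⟩ := integral_strip_norm_sq hw (contDiff_fderiv_apply hψ (0, 1))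
    (hc.fderiv_apply (𝕜 := ℝ) _)
  rw [e1, e2, ← integral_const_mul]
  exact integral_mono i1 (i2.const_mul C) fun k => hC _ _ (memH10_pfourier hβ hψ hc hs k)

end TestInequalities

/-! ### The form domain -/

section FormDomain

variable {β : ℝ → ℝ} {δ : ℝ}

/-- Triples of functions in the weighted space, as a Hilbert space. -/
abbrev L2h3 (β : ℝ → ℝ) (δ : ℝ) : Type := PiLp 2 fun _ : Fin 3 => L2h β δ

/-- The triples `(ψ, ψ_ξ, ψ_η)` for test functions `ψ` that vanish near the lower boundary. -/
def testTriples (hβ : ContinuousOn β (Icc 0 δ)) : Submodule ℂ (L2h3 β δ) where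
  carrier := {x | ∃ ψ : ℝ × ℝ → ℂ, ContDiff ℝ (⊤ : ℕ∞) ψ ∧ HasCompactSupport ψ ∧
    tsupport ψ ⊆ {z | 0 < z.2} ∧ x 0 =ᵐ[volume.restrict (strip δ)] ψ ∧
    x 1 =ᵐ[volume.restrict (strip δ)] (fun z => fderiv ℝ ψ z (1, 0)) ∧
    x 2 =ᵐ[volume.restrict (strip δ)] fun z => fderiv ℝ ψ z (0, 1)}
  zero_mem' := by
    have h0 : ((0 : L2h β δ) : ℝ × ℝ → ℂ) =ᵐ[volume.restrict (strip δ)] 0 :=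
      (volume_ac_stripMeasure hβ).ae_le (Lp.coeFn_zero ..)
    refine ⟨0, contDiff_const, HasCompactSupport.zero, by simp, h0, ?_, ?_⟩ <;>
    · filter_upwards [h0] with z hz
      rw [PiLp.zero_apply, hz]
      simp
  add_mem' := by
    rintro x y ⟨ψ, h1, h2, h3, h4, h5, h6⟩ ⟨φ, g1, g2, g3, g4, g5, g6⟩
    have a := volume_ac_stripMeasure hβ
    have hf : ∀ z v, fderiv ℝ (ψ + φ) z v = fderiv ℝ ψ z v + fderiv ℝ φ z v := fun z v => by
      rw [fderiv_add ((h1.differentiable (by simp)) z) ((g1.differentiable (by simp)) z)]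
      rfl
    refine ⟨ψ + φ, h1.add g1, h2.add g2, (tsupport_add ψ φ).trans (union_subset h3 g3), ?_, ?_, ?_⟩
    · filter_upwards [a.ae_le (Lp.coeFn_add (x 0) (y 0)), h4, g4] with z e1 e2 e3
      rw [PiLp.add_apply, e1, Pi.add_apply, e2, e3, Pi.add_apply]
    · filter_upwards [a.ae_le (Lp.coeFn_add (x 1) (y 1)), h5, g5] with z e1 e2 e3
      rw [PiLp.add_apply, e1, Pi.add_apply, e2, e3, hf]
    · filter_upwards [a.ae_le (Lp.coeFn_add (x 2) (y 2)), h6, g6] with z e1 e2 e3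
      rw [PiLp.add_apply, e1, Pi.add_apply, e2, e3, hf]
  smul_mem' := by
    rintro c x ⟨ψ, h1, h2, h3, h4, h5, h6⟩
    have a := volume_ac_stripMeasure hβ
    have hf : ∀ z v, fderiv ℝ (c • ψ) z v = c • fderiv ℝ ψ z v := fun z v => by
      rw [fderiv_const_smul ((h1.differentiable (by simp)) z)]
      rfl
    refine ⟨c • ψ, h1.const_smul c, h2.smul_left (f := fun _ => c),
      (closure_mono fun z hz => ?_).trans h3, ?_, ?_, ?_⟩
    · exact fun h => hz (by simp [h])
    · filter_upwards [a.ae_le (Lp.coeFn_smul c (x 0)), h4] with z e1 e2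
      rw [PiLp.smul_apply, e1, Pi.smul_apply, e2, Pi.smul_apply]
    · filter_upwards [a.ae_le (Lp.coeFn_smul c (x 1)), h5] with z e1 e2
      rw [PiLp.smul_apply, e1, Pi.smul_apply, e2, hf]
    · filter_upwards [a.ae_le (Lp.coeFn_smul c (x 2)), h6] with z e1 e2
      rw [PiLp.smul_apply, e1, Pi.smul_apply, e2, hf]

/-- The closure of the test triples. -/
def formDomain (hβ : ContinuousOn β (Icc 0 δ)) : Submodule ℂ (L2h3 β δ) :=
  (testTriples hβ).topologicalClosure

lemma norm_sq_L2h (hβ : ContinuousOn β (Icc 0 δ)) {f : L2h β δ} {φ : ℝ × ℝ → ℂ}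
    (h : f =ᵐ[volume.restrict (strip δ)] φ) :
    ‖f‖ ^ 2 = ∫ z in strip δ, Real.exp (-β z.2) * ‖φ z‖ ^ 2 := by
  refine Complex.ofReal_injective ?_
  have h1 := inner_L2h hβ f f
  rw [inner_self_eq_norm_sq_to_K] at h1
  rw [← integral_complex_ofReal, Complex.ofReal_pow]
  refine h1.trans (integral_congr_ae ?_)
  filter_upwards [h] with z hz
  rw [hz, ← Complex.normSq_eq_conj_mul_self, Complex.normSq_eq_norm_sq, Complex.ofReal_mul]

/-- By `hU` the products with an admissible test function vanish outside the strip, so the integrals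
extend to the plane, where no boundary occurs. -/
lemma byParts_test {U : Set (ℝ × ℝ)} {ψ : ℝ × ℝ → ℂ} {v : ℝ × ℝ} (hψ : ContDiff ℝ (⊤ : ℕ∞) ψ)
    (hc : HasCompactSupport ψ) (hU : ∀ z ∈ tsupport ψ, z ∈ U → z ∈ strip δ) :
    ByParts δ U v ψ (fun z => fderiv ℝ ψ z v) := by
  intro χ hχ hχc hs
  have hψd := contDiff_fderiv_apply hψ v
  have hχd : Continuous fun z => fderiv ℝ χ z v :=
    (hχ.continuous_fderiv (by simp)).clm_apply continuous_const
  have c1 := hψ.continuous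
  have c2 := hχ.continuous
  have c3 := hψd.continuous
  have out : ∀ z, z ∉ strip δ → ψ z = 0 ∨ z ∉ tsupport χ := by
    intro z hz
    by_cases h : z ∈ tsupport ψ
    · exact Or.inr fun h' => hz (hU z h (hs h'))
    · exact Or.inl (image_eq_zero_of_notMem_tsupport h)
  have out' : ∀ z, z ∉ strip δ → fderiv ℝ ψ z v = 0 ∨ z ∉ tsupport χ := by
    intro z hz
    by_cases h : z ∈ tsupport ψ
    · exact Or.inr fun h' => hz (hU z h (hs h'))
    · exact Or.inl (image_eq_zero_of_notMem_tsupport (f := fun z => fderiv ℝ ψ z v)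
        fun hm => h (tsupport_fderiv_apply_subset ℝ v hm))
  rw [setIntegral_eq_integral_of_forall_compl_eq_zero, setIntegral_eq_integral_of_forall_compl_eq_zero]
  · have h1 : Integrable (fun z => fderiv ℝ χ z v • ψ z) volume :=
      (hχd.smul c1).integrable_of_hasCompactSupport hc.smul_left
    have h2 : Integrable (fun z => χ z • fderiv ℝ ψ z v) volume :=
      (c2.smul c3).integrable_of_hasCompactSupport hχc.smul_right
    have h3 : Integrable (fun z => χ z • ψ z) volume :=
      (c2.smul c1).integrable_of_hasCompactSupport hc.smul_left
    rw [integral_smul_fderiv_eq_neg_fderiv_smul_of_integrable h1 h2 h3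
      (fun z _ => (hχ.differentiable (by simp)) z) (fun z _ => (hψ.differentiable (by simp)) z),
      neg_neg]
  · intro z hz
    rcases out' z hz with h | h
    · exact (congrArg (χ z • ·) h).trans (smul_zero _)
    · rw [image_eq_zero_of_notMem_tsupport h, zero_smul]
  · intro z hz
    rcases out z hz with h | h
    · rw [h, smul_zero]
    · rw [image_eq_zero_of_notMem_tsupport (f := fun z => fderiv ℝ χ z v)
        fun hm => h (tsupport_fderiv_apply_subset ℝ v hm), zero_smul]

lemma formDomain_byParts (hβ : ContinuousOn β (Icc 0 δ)) {x : L2h3 β δ} (hx : x ∈ formDomain hβ) :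
    HasWeakPartial δ (1, 0) (x 0) (x 1) ∧ ZeroTraceLower δ (x 0) (x 2) := by
  have hcl : IsClosed {x : L2h3 β δ | ByParts δ (strip δ) (1, 0) (x 0) (x 1) ∧
      ByParts δ {z | z.2 < δ} (0, 1) (x 0) (x 2)} :=
    ((isClosed_byPartsSubmodule hβ (strip δ) (1, 0)).preimage
      (f := fun x : L2h3 β δ => (x 0, x 1)) (by fun_prop)).and
    ((isClosed_byPartsSubmodule hβ {z | z.2 < δ} (0, 1)).preimage
      (f := fun x : L2h3 β δ => (x 0, x 2)) (by fun_prop))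
  refine closure_minimal ?_ hcl hx
  rintro x ⟨ψ, h1, h2, h3, h4, h5, h6⟩
  exact ⟨(byParts_test h1 h2 fun z _ hz => hz).congr h4.symm h5.symm,
    (byParts_test h1 h2 fun z hz hz' => ⟨h3 hz, hz'⟩).congr h4.symm h6.symm⟩

/-- Both sides are continuous in the triple, so the inequality passes from test functions to their
closure. This bound on the first-order term yields coercivity. -/
lemma formDomain_norm_inner_le (hδ : 0 < δ) (hβ : ContDiffOn ℝ 1 β (Icc 0 δ))
    (hβ' : ∀ η ∈ Ioo 0 δ, 0 < deriv β η) {x : L2h3 β δ} (hx : x ∈ formDomain hβ.continuousOn) :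
    ‖inner ℂ (x 0) (mulDeriv hδ hβ (x 1))‖ ≤ omegaStar β δ * (‖x 2‖ ^ 2 + ‖x 1‖ ^ 2) := by
  have hcl : IsClosed {x : L2h3 β δ | ‖inner ℂ (x 0) (mulDeriv hδ hβ (x 1))‖
      ≤ omegaStar β δ * (‖x 2‖ ^ 2 + ‖x 1‖ ^ 2)} := isClosed_le (by fun_prop) (by fun_prop)
  refine closure_minimal ?_ hcl hx
  rintro x ⟨ψ, h1, h2, h3, h4, h5, h6⟩
  have h := norm_integral_test_le hδ hβ hβ' h1 h2 h3
  change ‖inner ℂ (x 0) (mulDeriv hδ hβ (x 1))‖ ≤ _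
  rw [norm_sq_L2h hβ.continuousOn h5, norm_sq_L2h hβ.continuousOn h6, inner_L2h hβ.continuousOn]
  refine (congrArg norm (integral_congr_ae ?_)).trans_le h
  filter_upwards [h4, h5, mulDeriv_coeFn hδ hβ (x 1)] with z e1 e2 e3
  rw [e1, e3, e2]
  push_cast
  ring

lemma exists_formDomain_norm_le (hδ : 0 < δ) (hβ : ContinuousOn β (Icc 0 δ)) :
    ∃ C : ℝ, 0 < C ∧ ∀ x ∈ formDomain hβ, ‖x 0‖ ^ 2 ≤ C * ‖x 2‖ ^ 2 := by
  obtain ⟨C, hC, h⟩ := exists_poincare hδ hβ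
  refine ⟨C, hC, fun x hx => ?_⟩
  have hcl : IsClosed {x : L2h3 β δ | ‖x 0‖ ^ 2 ≤ C * ‖x 2‖ ^ 2} :=
    isClosed_le (by fun_prop) (by fun_prop)
  refine closure_minimal ?_ hcl hx
  rintro x ⟨ψ, h1, h2, h3, h4, h5, h6⟩
  change ‖x 0‖ ^ 2 ≤ C * ‖x 2‖ ^ 2
  rw [norm_sq_L2h hβ h4, norm_sq_L2h hβ h6]
  exact integral_test_le hβ h h1 h2 h3

end FormDomain

/-! ### Translations along the strip -/

section Translation

variable {β : ℝ → ℝ} {δ : ℝ}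

/-- Both the strip and the weight are invariant under translation in `ξ`. -/
lemma measurePreserving_strip (β : ℝ → ℝ) (δ s : ℝ) :
    MeasurePreserving (fun z : ℝ × ℝ => z + (s, 0)) (stripMeasure β δ) (stripMeasure β δ) := by
  have hpre : (fun z : ℝ × ℝ => z + (s, 0)) ⁻¹' strip δ = strip δ := by
    ext z
    simp [strip]
  have h := (measurePreserving_add_right (volume : Measure (ℝ × ℝ)) (s, 0)).restrict_preimage
    (measurableSet_strip δ)
  rw [hpre] at h
  refine ⟨h.measurable, Measure.ext fun A hA => ?_⟩
  rw [Measure.map_apply h.measurable hA, stripMeasure, withDensity_apply _ hA,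
    withDensity_apply _ (h.measurable hA)]
  refine Eq.trans ?_ (h.setLIntegral_comp_preimage_emb (measurableEmbedding_addRight _) _ A)
  simp

/-- The translation `f ↦ f(· + (s, 0))` on the weighted space. -/
def translate (s : ℝ) : L2h β δ →ₗᵢ[ℂ] L2h β δ :=
  Lp.compMeasurePreservingₗᵢ ℂ (fun z => z + (s, 0)) (measurePreserving_strip β δ s)

lemma translate_coeFn (s : ℝ) (f : L2h β δ) :
    translate s f =ᵐ[stripMeasure β δ] fun z => f (z + (s, 0)) :=
  Lp.coeFn_compMeasurePreserving f (measurePreserving_strip β δ s)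

lemma ae_comp_translate {p : ℝ × ℝ → Prop} (h : ∀ᵐ z ∂(stripMeasure β δ), p z) (s : ℝ) :
    ∀ᵐ z ∂(stripMeasure β δ), p (z + (s, 0)) :=
  (measurePreserving_strip β δ s).quasiMeasurePreserving.ae h

lemma translate_translate (s t : ℝ) (f : L2h β δ) :
    translate s (translate t f) = translate (s + t) f := by
  refine Lp.ext ?_
  filter_upwards [translate_coeFn s (translate t f), translate_coeFn (s + t) f,
    ae_comp_translate (translate_coeFn t f) s] with z h1 h2 h3
  rw [h1, h2, h3, add_assoc]
  simp

lemma translate_zero (f : L2h β δ) : translate 0 f = f := by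
  refine Lp.ext ?_
  filter_upwards [translate_coeFn 0 f] with z h1
  rw [h1, show ((0 : ℝ), (0 : ℝ)) = 0 from rfl, add_zero]

lemma inner_translate_right (s : ℝ) (f g : L2h β δ) :
    inner ℂ f (translate s g) = inner ℂ (translate (-s) f) g := by
  rw [← (translate (-s)).inner_map_map f, translate_translate, neg_add_cancel, translate_zero]

lemma translate_mulDeriv (hδ : 0 < δ) (hβ : ContDiffOn ℝ 1 β (Icc 0 δ)) (s : ℝ) (f : L2h β δ) :
    mulDeriv hδ hβ (translate s f) = translate s (mulDeriv hδ hβ f) := by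
  refine Lp.ext ?_
  filter_upwards [translate_coeFn s f, translate_coeFn s (mulDeriv hδ hβ f),
    mulDeriv_apply hδ hβ (translate s f), ae_comp_translate (mulDeriv_apply hδ hβ f) s]
    with z h1 h2 h3 h4
  rw [h3, h2, h4, h1]
  simp

lemma inner_translate_eq (hβ : ContinuousOn β (Icc 0 δ)) (s : ℝ) (φ f : L2h β δ) :
    inner ℂ φ (translate s f) = inner ℂ
      (zext (memLp_mul (continuousOn_exp_neg hβ) (memLp_volume hβ φ)))
      (shift (s • ((1 : ℝ), (0 : ℝ))) (zext (memLp_volume hβ f))) := by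
  rw [inner_L2h hβ, inner_zext]
  refine integral_congr_ae ?_
  have h := (measurePreserving_add_right volume
    (s • ((1 : ℝ), (0 : ℝ)))).quasiMeasurePreserving.ae (zext_coeFn (memLp_volume hβ f))
  filter_upwards [(volume_ac_stripMeasure hβ).ae_le (translate_coeFn s f),
    ae_restrict_of_ae (shift_coeFn (s • ((1 : ℝ), (0 : ℝ))) (zext (memLp_volume hβ f))),
    ae_restrict_of_ae h, ae_restrict_mem (measurableSet_strip δ)] with z h1 h2 h3 hz
  have hm : z + s • ((1 : ℝ), (0 : ℝ)) ∈ strip δ := by simpa [strip] using hz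
  rw [h1, h2, h3, indicator_of_mem hm, smul_e1, map_mul, Complex.conj_ofReal]
  ring

lemma HasWeakPartial.inner_translate_sub (hβ : ContinuousOn β (Icc 0 δ)) {f g : L2h β δ}
    (h : HasWeakPartial δ (1, 0) f g) (φ : L2h β δ) {T : ℝ} (hT : 0 ≤ T) :
    inner ℂ φ (translate T f) - inner ℂ φ f
      = ∫ s in (0 : ℝ)..T, inner ℂ φ (translate s g) := by
  have h1 := shift_inner_sub (memLp_volume hβ f) (memLp_volume hβ g) h hT
    (fun s _ z hz => by simpa [strip, smul_e1] using hz)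
    (memLp_mul (continuousOn_exp_neg hβ) (memLp_volume hβ φ))
  have h0 := inner_translate_eq hβ 0 φ f
  rw [translate_zero, zero_smul, shift_zero] at h0
  simp only [inner_translate_eq hβ, h0]
  exact h1

lemma continuous_inner_translate (hβ : ContinuousOn β (Icc 0 δ)) (φ f : L2h β δ) :
    Continuous fun s : ℝ => inner ℂ φ (translate s f) := by
  simp only [inner_translate_eq hβ]
  exact continuous_const.inner ((continuous_shift _).comp (by fun_prop))

/-- If the translates of `f` and the backward translates of `F` pair in the same way, so do the
weak derivatives. -/
lemma inner_eq_neg_of_translate (hβ : ContinuousOn β (Icc 0 δ)) {f g F G φ Φ : L2h β δ}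
    (h : HasWeakPartial δ (1, 0) f g) (H : HasWeakPartial δ (1, 0) F G)
    (heq : ∀ s : ℝ, inner ℂ φ (translate s f) = inner ℂ (translate (-s) F) Φ) :
    inner ℂ φ g = -inner ℂ G Φ := by
  have hc1 := continuous_inner_translate hβ φ g
  have hc2 := continuous_inner_translate hβ Φ G
  have hc3 : Continuous fun s : ℝ => conj (inner ℂ Φ (translate (-s) G)) :=
    Complex.continuous_conj.comp (hc2.comp continuous_neg)
  have key := eq_zero_of_integral_eq_zero
    (k := fun s : ℝ => inner ℂ φ (translate s g) + conj (inner ℂ Φ (translate (-s) G)))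
    (hc1.add hc3) ?_
  · simp only [neg_zero, translate_zero, inner_conj_symm] at key
    exact eq_neg_of_add_eq_zero_left key
  · intro T hT
    rw [intervalIntegral.integral_add (hc1.intervalIntegrable _ _) (hc3.intervalIntegrable _ _),
      ← h.inner_translate_sub hβ φ hT, intervalIntegral_conj]
    have h1 : ∫ s in (0 : ℝ)..T, inner ℂ Φ (translate (-s) G)
        = inner ℂ Φ F - inner ℂ Φ (translate (-T) F) := by
      have h2 := h.inner_translate_sub hβ φ hT
      -- Backward translates are reached from the identity for `T ≥ 0` by first translating `Φ`
      -- forward by `T`.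
      have h3 := H.inner_translate_sub hβ (translate T Φ) hT
      rw [intervalIntegral.integral_comp_neg fun s => inner ℂ Φ (translate s G), neg_zero]
      have h4 : ∀ (u : ℝ) (a : L2h β δ),
          inner ℂ (translate T Φ) (translate u a) = inner ℂ Φ (translate (u - T) a) := by
        intro u a
        rw [← (translate T).inner_map_map Φ, translate_translate, add_sub_cancel]
      have h5 := h4 0 F
      rw [translate_zero, zero_sub] at h5
      simp only [h4, h5] at h3
      rw [sub_self, translate_zero] at h3
      rw [h3, intervalIntegral.integral_comp_sub_right fun s => inner ℂ Φ (translate s G)]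
      simp
    rw [h1, heq T]
    have h0 := heq 0
    rw [neg_zero, translate_zero, translate_zero] at h0
    rw [h0, map_sub, inner_conj_symm, inner_conj_symm]
    ring

/-- Translation of triples. -/
def translate3 (s : ℝ) (x : L2h3 β δ) : L2h3 β δ := WithLp.toLp 2 fun i => translate s (x i)

lemma translate3_apply (s : ℝ) (x : L2h3 β δ) (i : Fin 3) :
    translate3 s x i = translate s (x i) := rfl

lemma continuous_translate3 (s : ℝ) : Continuous (translate3 (β := β) (δ := δ) s) := by
  refine (PiLp.continuous_toLp 2 _).comp (continuous_pi fun i => ?_)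
  exact (translate s).continuous.comp (PiLp.continuous_apply 2 _ i)

lemma translate_ae_eq (hβ : ContinuousOn β (Icc 0 δ)) (s : ℝ) {f : L2h β δ} {u : ℝ × ℝ → ℂ}
    (hu : f =ᵐ[volume.restrict (strip δ)] u) :
    translate s f =ᵐ[volume.restrict (strip δ)] fun z => u (z + (s, 0)) := by
  refine (volume_ac_stripMeasure hβ).ae_le ?_
  filter_upwards [translate_coeFn s f, ae_comp_translate ((stripMeasure_ac β δ).ae_le hu) s]
    with z e1 e2
  rw [e1, e2]

lemma translate3_mem_testTriples (hβ : ContinuousOn β (Icc 0 δ)) (s : ℝ) {x : L2h3 β δ}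
    (hx : x ∈ testTriples hβ) : translate3 s x ∈ testTriples hβ := by
  obtain ⟨ψ, h1, h2, h3, h4, h5, h6⟩ := hx
  have hd : ∀ v, (fun z => fderiv ℝ (fun z => ψ (z + (s, 0))) z v)
      = fun z => fderiv ℝ ψ (z + (s, 0)) v :=
    fun v => funext fun z => by rw [fderiv_comp_add_right]
  refine ⟨fun z => ψ (z + (s, 0)), h1.comp (contDiff_id.add contDiff_const),
    h2.comp_homeomorph (Homeomorph.addRight (s, 0)), fun z hz => ?_,
    translate_ae_eq hβ s h4, ?_, ?_⟩
  · have : z + (s, 0) ∈ tsupport ψ :=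
      tsupport_comp_subset_preimage ψ (f := fun z => z + (s, 0)) (by fun_prop) hz
    simpa using h3 this
  · rw [hd]
    exact translate_ae_eq hβ s h5
  · rw [hd]
    exact translate_ae_eq hβ s h6

lemma translate3_mem (hβ : ContinuousOn β (Icc 0 δ)) (s : ℝ) {x : L2h3 β δ}
    (hx : x ∈ formDomain hβ) : translate3 s x ∈ formDomain hβ :=
  map_mem_closure (continuous_translate3 s) hx fun _ h => translate3_mem_testTriples hβ s h

end Translation

/-! ### Surjectivity outside the spectral interval -/

section LaxMilgram

variable {E : Type*} [NormedAddCommGroup E] [InnerProductSpace ℂ E] [CompleteSpace E]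

/-- The Lax-Milgram lemma on a closed subspace. -/
lemma exists_inner_eq_of_coercive (S : E →L[ℂ] E) {V : Submodule ℂ E} (hV : IsClosed (V : Set E))
    {c : ℝ} (hc : 0 < c) (h : ∀ x ∈ V, c * ‖x‖ ^ 2 ≤ ‖inner ℂ x (S x)‖) (g : E) :
    ∃ x ∈ V, ∀ y ∈ V, inner ℂ y (S x) = inner ℂ y g := by
  have : CompleteSpace V := hV.completeSpace_coe
  let A : V →L[ℂ] V := V.orthogonalProjectionOnto ∘L S ∘L V.subtypeL
  have hA : ∀ x y : V, inner ℂ y (A x) = inner ℂ (y : E) (S x) := fun x y =>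
    Submodule.inner_orthogonalProjectionOnto_eq_of_mem_left y (S x)
  have hunit : IsUnit A := by
    refine A.isUnit_of_forall_le_norm_inner_map (c := ⟨c, hc.le⟩) hc fun x => ?_
    rw [norm_inner_symm, hA, mul_comm]
    exact h x x.2
  obtain ⟨x, hx⟩ := ((ContinuousLinearMap.isUnit_iff_bijective).1 hunit).2
    (V.orthogonalProjectionOnto g)
  refine ⟨x, x.2, fun y hy => ?_⟩
  rw [← hA x ⟨y, hy⟩, hx]
  exact Submodule.inner_orthogonalProjectionOnto_eq_of_mem_left (⟨y, hy⟩ : V) g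

end LaxMilgram

/-! ### Weak solutions and their regularity. -/

section Surjective

variable {β : ℝ → ℝ} {δ : ℝ}

/-- The operator of the sesquilinear form of the pencil. -/
def formOp (hδ : 0 < δ) (hβ : ContDiffOn ℝ 1 β (Icc 0 δ)) (ω : ℝ) : L2h3 β δ →L[ℂ] L2h3 β δ :=
  ((PiLp.continuousLinearEquiv 2 ℂ fun _ : Fin 3 => L2h β δ).symm : _ →L[ℂ] L2h3 β δ) ∘L
    ContinuousLinearMap.pi ![Complex.I • mulDeriv hδ hβ ∘L PiLp.proj 2 (fun _ => L2h β δ) 1,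
      (ω : ℂ) • PiLp.proj 2 (fun _ => L2h β δ) 1, (ω : ℂ) • PiLp.proj 2 (fun _ => L2h β δ) 2]

lemma inner_formOp (hδ : 0 < δ) (hβ : ContDiffOn ℝ 1 β (Icc 0 δ)) (ω : ℝ) (y x : L2h3 β δ) :
    inner ℂ y (formOp hδ hβ ω x) = Complex.I * inner ℂ (y 0) (mulDeriv hδ hβ (x 1))
      + (ω * inner ℂ (y 1) (x 1) + ω * inner ℂ (y 2) (x 2)) := by
  rw [PiLp.inner_apply, Fin.sum_univ_three, add_assoc]
  change inner ℂ (y 0) (Complex.I • mulDeriv hδ hβ (x 1))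
    + (inner ℂ (y 1) ((ω : ℂ) • x 1) + inner ℂ (y 2) ((ω : ℂ) • x 2)) = _
  rw [inner_smul_right, inner_smul_right, inner_smul_right]

/-- The coefficients do not depend on `ξ`. This invariance replaces difference quotients in the
proof of regularity. -/
lemma inner_formOp_translate (hδ : 0 < δ) (hβ : ContDiffOn ℝ 1 β (Icc 0 δ)) (ω s : ℝ)
    (y x : L2h3 β δ) : inner ℂ y (formOp hδ hβ ω (translate3 s x))
      = inner ℂ (translate3 (-s) y) (formOp hδ hβ ω x) := by
  simp only [inner_formOp, translate3_apply, translate_mulDeriv, inner_translate_right]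

/-- The first-order term is at most `Ω_*` times the Dirichlet energy, which leaves the fraction `|ω|
- Ω_*` of it. Poincaré's inequality, with constant `C`, then controls the full norm; hence the
divisor `1 + C`. -/
lemma exists_coercive (hδ : 0 < δ) (hβ : ContDiffOn ℝ 1 β (Icc 0 δ))
    (hβ' : ∀ η ∈ Ioo 0 δ, 0 < deriv β η) {ω : ℝ} (hω : omegaStar β δ < |ω|) :
    ∃ c : ℝ, 0 < c ∧ ∀ x ∈ formDomain hβ.continuousOn,
      c * ‖x‖ ^ 2 ≤ ‖inner ℂ x (formOp hδ hβ ω x)‖ := by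
  obtain ⟨C, hC, hP⟩ := exists_formDomain_norm_le hδ hβ.continuousOn
  refine ⟨(|ω| - omegaStar β δ) / (1 + C), div_pos (sub_pos.2 hω) (by positivity),
    fun x hx => ?_⟩
  have h1 := formDomain_norm_inner_le hδ hβ hβ' hx
  have h2 := hP x hx
  have h3 : ‖x‖ ^ 2 = ‖x 0‖ ^ 2 + ‖x 1‖ ^ 2 + ‖x 2‖ ^ 2 := by
    rw [PiLp.norm_sq_eq_of_L2, Fin.sum_univ_three]
  have e : ∀ f : L2h β δ, inner ℂ f f = ((‖f‖ ^ 2 : ℝ) : ℂ) := fun f => by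
    rw [inner_self_eq_norm_sq_to_K]
    exact (Complex.ofReal_pow _ _).symm
  have h4 : |ω| * (‖x 1‖ ^ 2 + ‖x 2‖ ^ 2)
      ≤ ‖inner ℂ x (formOp hδ hβ ω x)‖ + ‖inner ℂ (x 0) (mulDeriv hδ hβ (x 1))‖ := by
    have h5 : ((ω * (‖x 1‖ ^ 2 + ‖x 2‖ ^ 2) : ℝ) : ℂ) = inner ℂ x (formOp hδ hβ ω x)
        - Complex.I * inner ℂ (x 0) (mulDeriv hδ hβ (x 1)) := by
      rw [inner_formOp, e, e]
      push_cast
      ring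
    have h6 := congrArg norm h5
    rw [Complex.norm_real, Real.norm_eq_abs, abs_mul,
      abs_of_nonneg (by positivity : 0 ≤ ‖x 1‖ ^ 2 + ‖x 2‖ ^ 2)] at h6
    rw [h6]
    refine (norm_sub_le _ _).trans_eq ?_
    rw [norm_mul, Complex.norm_I, one_mul]
  have h7 : (|ω| - omegaStar β δ) * (‖x 1‖ ^ 2 + ‖x 2‖ ^ 2) ≤ ‖inner ℂ x (formOp hδ hβ ω x)‖ := by
    linarith
  refine le_trans ?_ h7
  rw [div_mul_eq_mul_div, mul_div_assoc]
  refine mul_le_mul_of_nonneg_left ?_ (sub_pos.2 hω).le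
  rw [div_le_iff₀ (by positivity), h3]
  nlinarith [mul_nonneg hC.le (sq_nonneg ‖x 1‖), sq_nonneg ‖x 1‖, sq_nonneg ‖x 2‖]

lemma isClosed_formDomain (hβ : ContinuousOn β (Icc 0 δ)) :
    IsClosed (formDomain hβ : Set (L2h3 β δ)) := Submodule.isClosed_topologicalClosure _

/-- A real test function that vanishes near the lower boundary, with its derivatives, as an element
of the form domain. -/
lemma exists_test_mem (hβ : ContinuousOn β (Icc 0 δ)) {χ : ℝ × ℝ → ℝ}
    (hχ : ContDiff ℝ (⊤ : ℕ∞) χ) (hc : HasCompactSupport χ) (hs : tsupport χ ⊆ {z | 0 < z.2}) :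
    ∃ y ∈ formDomain hβ, y 0 =ᵐ[volume.restrict (strip δ)] (fun z => (χ z : ℂ)) ∧
      y 2 =ᵐ[volume.restrict (strip δ)] fun z => ((fderiv ℝ χ z (0, 1) : ℝ) : ℂ) := by
  have hd : ∀ v, Continuous fun z => fderiv ℝ χ z v := fun v =>
    (hχ.continuous_fderiv (by simp)).clm_apply continuous_const
  have hdc : ∀ v, HasCompactSupport fun z => fderiv ℝ χ z v := fun v => hc.fderiv_apply (𝕜 := ℝ) v
  have m0 := memLp_stripMeasure hβ (memLp_test hχ.continuous hc (volume.restrict (strip δ)))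
  have m := fun v => memLp_stripMeasure hβ (memLp_test (hd v) (hdc v) (volume.restrict (strip δ)))
  have a := volume_ac_stripMeasure hβ
  have hf : ∀ z v, fderiv ℝ (fun z => (χ z : ℂ)) z v = ((fderiv ℝ χ z v : ℝ) : ℂ) := by
    intro z v
    have := (Complex.ofRealCLM.hasFDerivAt (x := χ z)).comp z
      ((hχ.differentiable (by simp)) z).hasFDerivAt
    have h2 : fderiv ℝ (fun z => (χ z : ℂ)) z = _ := this.fderiv
    rw [h2]
    rfl
  let y : L2h3 β δ := WithLp.toLp 2 ![m0.toLp, (m (1, 0)).toLp, (m (0, 1)).toLp]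
  have e0 : y 0 =ᵐ[volume.restrict (strip δ)] fun z => (χ z : ℂ) := a.ae_le m0.coeFn_toLp
  have e1 : y 1 =ᵐ[volume.restrict (strip δ)] fun z => ((fderiv ℝ χ z (1, 0) : ℝ) : ℂ) :=
    a.ae_le (m (1, 0)).coeFn_toLp
  have e2 : y 2 =ᵐ[volume.restrict (strip δ)] fun z => ((fderiv ℝ χ z (0, 1) : ℝ) : ℂ) :=
    a.ae_le (m (0, 1)).coeFn_toLp
  refine ⟨y, Submodule.le_topologicalClosure _ ⟨fun z => (χ z : ℂ),
    Complex.ofRealCLM.contDiff.comp hχ, hc.comp_left (g := ((↑) : ℝ → ℂ)) (by simp),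
    (closure_mono fun z hz => by simpa using hz).trans hs, e0, ?_, ?_⟩, e0, e2⟩
  · simp only [hf]
    exact e1
  · simp only [hf]
    exact e2

/-- Outside the spectral interval the pencil is surjective. -/
theorem pencil_surjective (hδ : 0 < δ) (hβ : ContDiffOn ℝ 1 β (Icc 0 δ))
    (hβ' : ∀ η ∈ Ioo 0 δ, 0 < deriv β η) {ω : ℝ} (hω : omegaStar β δ < |ω|) :
    Function.Surjective (pencil hδ hβ ω) := by
  intro f
  have hβc := hβ.continuousOn
  have hω0 : ω ≠ 0 := by
    rintro rfl
    rw [abs_zero] at hω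
    exact lt_asymm hω (isLUB_omegaStar hδ hβ hβ').2
  have hωc : (ω : ℂ) ≠ 0 := Complex.ofReal_ne_zero.2 hω0
  obtain ⟨c, hc, hcoer⟩ := exists_coercive hδ hβ hβ' hω
  have hV := isClosed_formDomain (δ := δ) hβc
  have in0 : ∀ (y : L2h3 β δ) (u : L2h β δ),
      inner ℂ y (WithLp.toLp 2 ![u, 0, 0] : L2h3 β δ) = inner ℂ (y 0) u := fun y u => by
    rw [PiLp.inner_apply, Fin.sum_univ_three]
    simp
  have in1 : ∀ (y : L2h3 β δ) (u : L2h β δ),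
      inner ℂ y (WithLp.toLp 2 ![0, u, 0] : L2h3 β δ) = inner ℂ (y 1) u := fun y u => by
    rw [PiLp.inner_apply, Fin.sum_univ_three]
    simp
  obtain ⟨x, hx, hxe⟩ := exists_inner_eq_of_coercive (formOp hδ hβ ω) hV hc hcoer
    (WithLp.toLp 2 ![f, 0, 0])
  -- The weak form of the equation differentiated in `ξ`: its right-hand side is `f_ξ`, with the
  -- derivative moved to the test element. The candidate `w` for the `ξ`-derivative of the solution
  -- lies in the form domain by construction.
  obtain ⟨w, hw, hwe⟩ := exists_inner_eq_of_coercive (formOp hδ hβ ω) hV hc hcoer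
    (WithLp.toLp 2 ![0, -f, 0])
  simp only [in0] at hxe
  simp only [in1, inner_neg_right] at hwe
  obtain ⟨x1, x2⟩ := formDomain_byParts hβc hx
  obtain ⟨w1, w2⟩ := formDomain_byParts hβc hw
  have hw0 : w 0 = x 1 := by
    refine ext_inner_left ℂ fun φ => ?_
    -- Duality: `z` solves the adjoint problem with an arbitrary right-hand side `φ`. Translating
    -- the solution against `z` equals translating `z` backward against `f`, and differentiating
    -- gives `⟨φ, x 1⟩ = -⟨z 1, f⟩ = ⟨φ, w 0⟩`.
    obtain ⟨z, hz, hze⟩ := exists_inner_eq_of_coercive (ContinuousLinearMap.adjoint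
      (formOp hδ hβ ω)) hV hc (fun x hx => by
        rw [ContinuousLinearMap.adjoint_inner_right, norm_inner_symm]
        exact hcoer x hx) (WithLp.toLp 2 ![φ, 0, 0])
    have hze' : ∀ y ∈ formDomain hβc, inner ℂ z (formOp hδ hβ ω y) = inner ℂ φ (y 0) := by
      intro y hy
      have := hze y hy
      rw [ContinuousLinearMap.adjoint_inner_right, in0] at this
      rw [← inner_conj_symm, this, inner_conj_symm]
    have key := inner_eq_neg_of_translate hβc x1 (formDomain_byParts hβc hz).1 (φ := φ) (Φ := f)
      fun s => by
        rw [← translate3_apply, ← hze' _ (translate3_mem hβc s hx), inner_formOp_translate,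
          hxe _ (translate3_mem hβc (-s) hz), translate3_apply]
    rw [key, ← hwe z hz, hze' w hw]
  -- What the equation leaves for `ω(-Φ_ηη + β'Φ_η)` once the `ξ`-derivatives are known to be in
  -- `L₂`.
  set G : L2h β δ := f - Complex.I • mulDeriv hδ hβ (x 1) + (ω : ℂ) • w 1 with hG
  -- The equation in divergence form, `(e^{-β}Φ_η)_η = -ω⁻¹ e^{-β} G`. The test functions need not
  -- vanish at `η = δ`, so the natural condition `Φ_η = 0` there is included.
  have hupper : ByParts δ {z | 0 < z.2} (0, 1)
      (fun z => ((Real.exp (-β z.2) : ℝ) : ℂ) * (x 2) z)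
      (fun z => ((Real.exp (-β z.2) : ℝ) : ℂ) * (-(ω : ℂ)⁻¹ • G : L2h β δ) z) := by
    intro χ hχ hχc hs
    obtain ⟨y, hy, e0, e2⟩ := exists_test_mem (δ := δ) hβc hχ hχc hs
    have hy1 := hxe y hy
    have hy2 := (formDomain_byParts hβc hy).1.inner_eq_neg hβc w1
    rw [hw0] at hy2
    rw [inner_formOp] at hy1
    have hy3 : inner ℂ (y 2) (x 2) = -inner ℂ (y 0) (-(ω : ℂ)⁻¹ • G) := by
      rw [hG, inner_smul_right, inner_add_right, inner_sub_right, inner_smul_right,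
        inner_smul_right, hy2, ← hy1]
      field_simp
      ring
    rw [inner_L2h hβc, inner_L2h hβc] at hy3
    refine Eq.trans (integral_congr_ae ?_) (hy3.trans (congrArg Neg.neg (integral_congr_ae ?_)))
    · filter_upwards [e2] with z hz
      rw [hz, Complex.conj_ofReal, Complex.real_smul]
      ring
    · filter_upwards [e0] with z hz
      rw [hz, Complex.conj_ofReal, Complex.real_smul]
      ring
  have hu : ZeroTraceUpper δ (x 2) (-(ω : ℂ)⁻¹ • G + mulDeriv hδ hβ (x 2) : L2h β δ) := by
    have hm := continuousOn_exp_neg hβc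
    -- Multiplication by `e^β` removes the weight; differentiating this factor restores the term
    -- `β'Φ_η` in `Φ_ηη`.
    refine (ByParts.mul hδ (memLp_mul hm (memLp_volume hβc (x 2)))
      (memLp_mul hm (memLp_volume hβc (-(ω : ℂ)⁻¹ • G))) hupper (continuousOn_exp hβc)
      ((continuousOn_exp hβc).mul (continuousOn_derivWithin hδ hβ))
      (fun η hη => hasDerivAt_exp hβ hη)).congr (ae_of_all _ fun z => ?_) ?_
    · beta_reduce
      rw [← mul_assoc, ← Complex.ofReal_mul, ← Real.exp_add]
      simp
    · filter_upwards [(volume_ac_stripMeasure hβc).ae_le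
        (Lp.coeFn_add (-(ω : ℂ)⁻¹ • G) (mulDeriv hδ hβ (x 2))), mulDeriv_coeFn hδ hβ (x 2)]
        with z h1 h2
      have he : ((Real.exp (β z.2) : ℝ) : ℂ) * ((Real.exp (-β z.2) : ℝ) : ℂ) = 1 := by
        rw [← Complex.ofReal_mul, ← Real.exp_add]
        simp
      rw [h1, Pi.add_apply, h2, Pi.mul_apply]
      push_cast at he ⊢
      linear_combination ((-(ω : ℂ)⁻¹ • G : L2h β δ) z
        + ((derivWithin β (Icc 0 δ) z.2 : ℝ) : ℂ) * (x 2) z) * he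
  rw [hw0] at w1 w2
  have st1 : strip δ ⊆ {z | z.2 < δ} := fun z hz => hz.2
  have st2 : strip δ ⊆ {z | 0 < z.2} := fun z hz => hz.1
  let J : Fin 6 → L2h β δ :=
    ![x 0, x 1, x 2, w 1, w 2, -(ω : ℂ)⁻¹ • G + mulDeriv hδ hβ (x 2)]
  have hJ : J ∈ domain hβ := ⟨x1, ByParts.mono x2 st1, w1, ByParts.mono w2 st1,
    ByParts.mono hu st2, x2, hu⟩
  refine ⟨⟨J, hJ⟩, ?_⟩
  rw [pencil_apply]
  change (ω : ℂ) • (-w 1 + (-(-(ω : ℂ)⁻¹ • G + mulDeriv hδ hβ (x 2)) + mulDeriv hδ hβ (x 2)))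
    + Complex.I • mulDeriv hδ hβ (x 1) = f
  have hGω : (ω : ℂ) • (ω : ℂ)⁻¹ • G = G := smul_inv_smul₀ hωc G
  rw [neg_add_rev, neg_smul, neg_neg, add_right_comm, neg_add_cancel, zero_add, smul_add, hGω, hG,
    smul_neg]
  abel

end Surjective

/-- The essential spectrum of the pencil. -/
theorem essSpectrum_eq {β : ℝ → ℝ} {δ : ℝ} (hδ : 0 < δ) (hβ : ContDiffOn ℝ 1 β (Icc 0 δ))
    (hβ' : ∀ η ∈ Ioo 0 δ, 0 < deriv β η) :
    essSpectrum hδ hβ = Icc (-omegaStar β δ) (omegaStar β δ) := by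
  ext ω
  rw [mem_Icc, ← abs_le]
  constructor
  · intro h
    by_contra hcon
    exact h (isFredholm_of_surjective hδ hβ ω (pencil_surjective hδ hβ hβ' (not_le.1 hcon)))
  · intro h
    obtain ⟨k, φ₀, φ₁, φ₂, hm⟩ := exists_isMode hδ hβ hβ' h
    exact hm.not_isFredholm hδ hβ

end

end ShelfWaves

theorem lemma3p3 (δ : ℝ) (hδ : 0 < δ) (β : ℝ → ℝ) (hβ : ContDiffOn ℝ 1 β (Set.Icc 0 δ))
    (hβ' : ∀ η ∈ Set.Ioo 0 δ, 0 < deriv β η) :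
    IsLUB (ShelfWaves.quotients β δ) (ShelfWaves.omegaStar β δ) ∧
      0 < ShelfWaves.omegaStar β δ ∧
      ShelfWaves.essSpectrum hδ hβ =
        Set.Icc (-ShelfWaves.omegaStar β δ) (ShelfWaves.omegaStar β δ) :=
  ⟨(ShelfWaves.isLUB_omegaStar hδ hβ hβ').1, (ShelfWaves.isLUB_omegaStar hδ hβ hβ').2,
    ShelfWaves.essSpectrum_eq hδ hβ hβ'⟩
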